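/- Let $\varepsilon,\mu,\beta,T>0$, let $b\in C^2[0,1]$ and $\eta_b=1-\beta b$, and suppose there are constants $c_1,c_2>0$ with $$\eta_b(x)\ge c_1,\qquad \eta_b(x)-\tfrac{\mu}{2}\eta_b^2(x)\eta_b''(x)\ge c_2\qquad(0\le x\le 1).$$ Let $r\ge 2$ and $0\le k\le r-2$ be integers, and let $(\zeta,u)$ be a solution on $[0,1]\times[0,T]$ of $$\zeta_t+\varepsilon(\zeta u)_x+(\eta_b u)_x=0,$$ $$\bigl(\eta_b-\tfrac{\mu}{2}\eta_b^2\eta_b''\bigr)u_t-\tfrac{\mu}{3}(\eta_b^3u_{tx})_x+\eta_b\zeta_x+\varepsilon\eta_b uu_x=0,$$ $$\zeta(x,0)=\zeta_0(x),\quad u(x,0)=u_0(x),\quad u(0,t)=u(1,t)=0,$$ that is smooth in the sense that $\zeta\in C([0,T];C^r[0,1])\cap C^1([0,T];C[0,1])$ and $u\in C([0,T];C^r[0,1])\cap C^1([0,T];C^2[0,1])$. Write $(\cdot,\cdot)$ and $\|\cdot\|$ for the inner product and norm of $L^2(0,1)$, $\|\cdot\|_1$ for the norm of $H^1(0,1)$,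 and $$A(v,w)=\bigl((\eta_b-\tfrac{\mu}{2}\eta_b^2\eta_b'')v,w\bigr)+\tfrac{\mu}{3}(\eta_b^3v',w').$$ For a partition $0=x_1<x_2<\dots<x_{N+1}=1$ put $h=\max_i(x_{i+1}-x_i)$, $$S_h=\{\phi\in C^k[0,1]:\ \phi|_{[x_i,x_{i+1}]}\text{ is a polynomial of degree at most } r-1 \text{ for each } i\},\qquad S_{h,0}=\{\phi\in S_h:\phi(0)=\phi(1)=0\}.$$ Then for every $\nu$ there exist $h_0>0$ and a constant $C$, both independent of the partition, such that for every partition which is quasiuniform with constant $\nu$ (that is, $h\le\nu\min_i(x_{i+1}-x_i)$) and satisfies $h\le h_0$, there is a unique pair of differentiable maps $\zeta_h:[0,T]\to S_h$, $u_h:[0,T]\to S_{h,0}$ such that for all $t\in[0,T]$ $$(\zeta_{ht},\phi)+\varepsilon\bigl((\zeta_hu_h)_x,\phi\bigr)+\bigl((\eta_bu_h)_x,\phi\bigr)=0\quad\forall\phi\in S_h,$$ $$A(u_{ht},\chi)+(\eta_b\zeta_{hx},\chi)+\varepsilon(\eta_bu_hu_{hx},\chi)=0\quad\forall\chi\in S_{h,0},$$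 with $\zeta_h(0)\in S_h$ the $L^2$-projection of $\zeta_0$, i.e. $(\zeta_h(0),\phi)=(\zeta_0,\phi)$ for all $\phi\in S_h$, and $u_h(0)\in S_{h,0}$ the elliptic projection of $u_0$, i.e. $A(u_h(0),\chi)=A(u_0,\chi)$ for all $\chi\in S_{h,0}$; and this pair satisfies $$\max_{0\le t\le T}\bigl(\|\zeta(t)-\zeta_h(t)\|+\|u(t)-u_h(t)\|_1\bigr)\le C\,h^{r-1}.$$ -/

import Mathlib

open Set

namespace Boussinesq

/-! ### Calculus on `[0,1] × [0,T]`

Space-time functions are written `w t x`. -/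

/-- The derivative in `x` on `[0,1]`, one-sided at the endpoints. For a continuous piecewise
polynomial it is the (weak) derivative at every point of `[0,1]` other than the nodes. -/
noncomputable def dx (f : ℝ → ℝ) : ℝ → ℝ := derivWithin f (Icc 0 1)

/-- The derivative in `t` on `[0,T]`, one-sided at the endpoints. -/
noncomputable def dt (T : ℝ) (w : ℝ → ℝ → ℝ) (t x : ℝ) : ℝ :=
  derivWithin (fun s => w s x) (Icc 0 T) t

/-- The inner product of `L²(0,1)`. -/
noncomputable def ip (f g : ℝ → ℝ) : ℝ := ∫ x in (0 : ℝ)..1, f x * g x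

/-- The norm of `L²(0,1)`. -/
noncomputable def l2norm (f : ℝ → ℝ) : ℝ := Real.sqrt (ip f f)

/-- The norm of `H¹(0,1)`. -/
noncomputable def h1norm (f : ℝ → ℝ) : ℝ := Real.sqrt (ip f f + ip (dx f) (dx f))

/-- `w ∈ C([0,T]; C^m[0,1])`: all `x`-derivatives of `w` up to order `m` exist and are continuous
on `[0,1] × [0,T]`. -/
def ContInTime (T : ℝ) (m : ℕ) (w : ℝ → ℝ → ℝ) : Prop :=
  (∀ t ∈ Icc 0 T, ContDiffOn ℝ m (w t) (Icc 0 1)) ∧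
  ∀ j ≤ m, ContinuousOn (fun p : ℝ × ℝ => iteratedDerivWithin j (w p.1) (Icc 0 1) p.2)
    (Icc 0 T ×ˢ Icc 0 1)

/-- `w` is differentiable in `t` at every point of `[0,1] × [0,T]`. -/
def DiffInTime (T : ℝ) (w : ℝ → ℝ → ℝ) : Prop :=
  ∀ x ∈ Icc (0 : ℝ) 1, DifferentiableOn ℝ (fun t => w t x) (Icc 0 T)

/-! ### The initial-boundary-value problem -/

/-- The undisturbed depth `η_b = 1 - β b`. -/
def etaB (β : ℝ) (b : ℝ → ℝ) (x : ℝ) : ℝ := 1 - β * b x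

/-- The coefficient `η_b - (μ/2) η_b² η_b''`. -/
noncomputable def massCoeff (μ : ℝ) (ηb : ℝ → ℝ) (x : ℝ) : ℝ :=
  ηb x - μ / 2 * ηb x ^ 2 * dx (dx ηb) x

/-- `(ζ, u)` satisfies the differential equations, the initial conditions and the boundary
conditions of the Peregrine system with bottom `η_b`. -/
structure IsIBVPSolution (ε μ T : ℝ) (ηb ζ₀ u₀ : ℝ → ℝ) (ζ u : ℝ → ℝ → ℝ) : Prop where
  mass : ∀ t ∈ Icc 0 T, ∀ x ∈ Icc (0 : ℝ) 1,
    dt T ζ t x + ε * dx (fun y => ζ t y * u t y) x + dx (fun y => ηb y * u t y) x = 0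
  momentum : ∀ t ∈ Icc 0 T, ∀ x ∈ Icc (0 : ℝ) 1,
    massCoeff μ ηb x * dt T u t x - μ / 3 * dx (fun y => ηb y ^ 3 * dx (dt T u t) y) x
      + ηb x * dx (ζ t) x + ε * ηb x * u t x * dx (u t) x = 0
  init_zeta : ∀ x ∈ Icc (0 : ℝ) 1, ζ 0 x = ζ₀ x
  init_u : ∀ x ∈ Icc (0 : ℝ) 1, u 0 x = u₀ x
  bdry_left : ∀ t ∈ Icc 0 T, u t 0 = 0
  bdry_right : ∀ t ∈ Icc 0 T, u t 1 = 0

/-- The smoothness asked of `(ζ, u)`: `ζ ∈ C([0,T]; C^r) ∩ C¹([0,T]; C)` and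
`u ∈ C([0,T]; C^r) ∩ C¹([0,T]; C²)`. -/
structure IsSmoothPair (T : ℝ) (r : ℕ) (ζ u : ℝ → ℝ → ℝ) : Prop where
  zeta_space : ContInTime T r ζ
  u_space : ContInTime T r u
  zeta_diff : DiffInTime T ζ
  u_diff : DiffInTime T u
  zeta_time : ContInTime T 0 (dt T ζ)
  u_time : ContInTime T 2 (dt T u)

/-! ### The finite element spaces -/

/-- A partition `0 = x_0 < x_1 < ⋯ < x_N = 1` of `[0,1]` into `N` intervals. -/
structure Mesh where
  N : ℕ
  node : Fin (N + 1) → ℝ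
  strictMono : StrictMono node
  node_first : node 0 = 0
  node_last : node (Fin.last N) = 1

/-- The length of the `i`-th interval. -/
def Mesh.length (M : Mesh) (i : Fin M.N) : ℝ := M.node i.succ - M.node i.castSucc

/-- The mesh width `h = max_i (x_{i+1} - x_i)`. -/
noncomputable def Mesh.h (M : Mesh) : ℝ := ⨆ i : Fin M.N, M.length i

/-- Quasiuniformity with constant `ν`: the mesh width is at most `ν` times the length of
each interval. -/
def Mesh.Quasiuniform (M : Mesh) (ν : ℝ) : Prop := ∀ i, M.h ≤ ν * M.length i

/-- `S_h`: the `C^k` functions on `[0,1]` that are polynomials of degree at most `r - 1` on each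
interval of the mesh. Only the values on `[0,1]` matter. -/
def Sh (M : Mesh) (r k : ℕ) : Set (ℝ → ℝ) :=
  {φ | ContDiffOn ℝ k φ (Icc 0 1) ∧
    ∀ i : Fin M.N, ∃ p : Polynomial ℝ, p.natDegree ≤ r - 1 ∧
      ∀ x ∈ Icc (M.node i.castSucc) (M.node i.succ), φ x = p.eval x}

/-- `S_{h,0}`: the elements of `S_h` that vanish at `0` and `1`. -/
def Sh0 (M : Mesh) (r k : ℕ) : Set (ℝ → ℝ) := {φ | φ ∈ Sh M r k ∧ φ 0 = 0 ∧ φ 1 = 0}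

/-! ### The Galerkin semidiscretization -/

/-- The bilinear form
`A(v,w) = ((η_b - (μ/2) η_b² η_b'') v, w) + (μ/3) (η_b³ v', w')`. -/
noncomputable def A (μ : ℝ) (ηb v w : ℝ → ℝ) : ℝ :=
  ip (fun x => massCoeff μ ηb x * v x) w + μ / 3 * ip (fun x => ηb x ^ 3 * dx v x) (dx w)

/-- `p` is the `L²`-projection of `v` onto `S`. -/
def IsL2Projection (S : Set (ℝ → ℝ)) (v p : ℝ → ℝ) : Prop :=
  p ∈ S ∧ ∀ φ ∈ S, ip p φ = ip v φ

/-- `p` is the elliptic projection of `v` onto `S` with respect to the form `A`. -/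
def IsEllipticProjection (μ : ℝ) (ηb : ℝ → ℝ) (S : Set (ℝ → ℝ)) (v p : ℝ → ℝ) : Prop :=
  p ∈ S ∧ ∀ χ ∈ S, A μ ηb p χ = A μ ηb v χ

/-- `(ζh, uh)` solves the semidiscrete initial value problem on `[0,T]`. Since `S_h` is finite
dimensional, pointwise differentiability in `t` is differentiability as a map into `S_h`. -/
structure IsSemidiscreteSolution (ε μ T : ℝ) (ηb ζ₀ u₀ : ℝ → ℝ) (M : Mesh) (r k : ℕ)
    (ζh uh : ℝ → ℝ → ℝ) : Prop where
  zeta_mem : ∀ t ∈ Icc 0 T, ζh t ∈ Sh M r k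
  u_mem : ∀ t ∈ Icc 0 T, uh t ∈ Sh0 M r k
  zeta_diff : DiffInTime T ζh
  u_diff : DiffInTime T uh
  mass : ∀ t ∈ Icc 0 T, ∀ φ ∈ Sh M r k,
    ip (dt T ζh t) φ + ε * ip (dx (fun y => ζh t y * uh t y)) φ
      + ip (dx (fun y => ηb y * uh t y)) φ = 0
  momentum : ∀ t ∈ Icc 0 T, ∀ χ ∈ Sh0 M r k,
    A μ ηb (dt T uh t) χ + ip (fun x => ηb x * dx (ζh t) x) χ
      + ε * ip (fun x => ηb x * uh t x * dx (uh t) x) χ = 0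
  init_zeta : IsL2Projection (Sh M r k) ζ₀ (ζh 0)
  init_u : IsEllipticProjection μ ηb (Sh0 M r k) u₀ (uh 0)

end Boussinesq

/-! The discrete solution is compared with the L²-projection Pζ and the elliptic projection Ru
rather than with (ζ, u) directly. Write θ = Pζ - ζh, ξ = Ru - uh, ρ = ζ - Pζ, σ = u - Ru and e = u -
uh = σ + ξ. Since θ and ξ are admissible test functions, the time derivatives of ρ and σ are
orthogonal to them. Hence the energy ‖θ‖² + A(ξ, ξ) obeys an identity free of time derivatives of
projection errors (`hasDerivAt_coordEnergy`). It starts from zero, because the discrete initial data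
are the projections, and by coercivity of A it controls ‖θ‖ and ‖ξ'‖.

In the right-hand side (`energy_rhs_le`), the terms containing θ' are integrated by parts: ((θ uh)',
θ) = ½ (uh' θ, θ), because uh vanishes at both ends, and in (η θ', ξ) the derivative moves to η ξ.
What remains contains ρ' and σ', which are O(h^(r-1)) in L²; this fixes the order of the estimate.
The cubic term needs |θ| ≤ 1, since uh' = u' - e' and e' is controlled only in L². The inverse
inequality θ² h ≤ C ‖θ‖² supplies this bound as long as the energy is at most κ h. Under that
proviso Gronwall's inequality bounds the energy by e^(BT) h^(2(r-1)), which for r ≥ 2 and small h is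
strictly below κ h. A continuation argument therefore removes the proviso (`lt_of_continuation`,
`exists_trajectory`).

For existence, the system is written in bases orthonormal for `ip` and for `A`, where it is an ODE
with a polynomial vector field (`galerkinField`). The field is cut off outside a ball; the energy
bound keeps the global solution of the truncated equation where the two fields agree. Uniqueness is
that of the ODE (`ode_unique`).

The projection errors (`exists_l2Projection_error`, `exists_ellipticProjection_error`) come from
best approximation together with splines of maximal smoothness, built by repeated integration
(`exists_spline_approx_pair`). Quasiuniformity enters only through the inverse inequalities. -/

namespace Boussinesq
open MeasureTheory

/-! ### Essentially bounded functions on the unit interval -/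

/-- Measurable, essentially bounded functions on `(0,1)`. -/
def EssBdd (f : ℝ → ℝ) : Prop := MemLp f ⊤ (volume.restrict (Ioc (0 : ℝ) 1))

section EssBdd
variable {f g f' g' : ℝ → ℝ}

lemma ae_of_Icc {p : ℝ → Prop} (h : ∀ x ∈ Icc (0 : ℝ) 1, p x) :
    ∀ᵐ x ∂(volume.restrict (Ioc (0 : ℝ) 1)), p x :=
  (ae_restrict_iff' measurableSet_Ioc).2 (ae_of_all _ fun x hx => h x ⟨hx.1.le, hx.2⟩)

lemma EssBdd.add (hf : EssBdd f) (hg : EssBdd g) : EssBdd (fun x => f x + g x) := MemLp.add hf hg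

lemma EssBdd.sub (hf : EssBdd f) (hg : EssBdd g) : EssBdd (fun x => f x - g x) := MemLp.sub hf hg

lemma EssBdd.mul (hf : EssBdd f) (hg : EssBdd g) : EssBdd (fun x => f x * g x) :=
  MemLp.mul (p := ⊤) (q := ⊤) hg hf

lemma EssBdd.const (c : ℝ) : EssBdd (fun _ => c) := memLp_const c

lemma EssBdd.const_mul (c : ℝ) (hf : EssBdd f) : EssBdd (fun x => c * f x) :=
  (EssBdd.const c).mul hf

lemma EssBdd.congr_ae (hf : EssBdd f) (h : f =ᵐ[volume.restrict (Ioc (0 : ℝ) 1)] g) : EssBdd g :=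
  (memLp_congr_ae h).1 hf

lemma EssBdd.congr (hf : EssBdd f) (h : ∀ x ∈ Icc (0 : ℝ) 1, f x = g x) : EssBdd g :=
  hf.congr_ae (ae_of_Icc h)

lemma EssBdd.sum {ι : Type*} {F : ι → ℝ → ℝ} (s : Finset ι) (h : ∀ i ∈ s, EssBdd (F i)) :
    EssBdd (fun x => ∑ i ∈ s, F i x) := memLp_finsetSum s h

lemma exists_bound (hf : ContinuousOn f (Icc 0 1)) : ∃ K, 0 ≤ K ∧ ∀ x ∈ Icc (0 : ℝ) 1, |f x| ≤ K := by
  obtain ⟨K, hK⟩ := isCompact_Icc.exists_bound_of_continuousOn hf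
  exact ⟨|K|, abs_nonneg _, fun x hx => (hK x hx).trans (le_abs_self _)⟩

lemma essBdd_of_continuousOn (hf : ContinuousOn f (Icc 0 1)) : EssBdd f := by
  obtain ⟨K, -, hK⟩ := exists_bound hf
  exact memLp_top_of_bound
    ((hf.mono Ioc_subset_Icc_self).aestronglyMeasurable measurableSet_Ioc) K (ae_of_Icc hK)

lemma EssBdd.integrable (hf : EssBdd f) : Integrable f (volume.restrict (Ioc (0 : ℝ) 1)) :=
  MemLp.integrable le_top hf

lemma EssBdd.intervalIntegrable (hf : EssBdd f) : IntervalIntegrable f volume 0 1 :=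
  (intervalIntegrable_iff_integrableOn_Ioc_of_le zero_le_one).2 hf.integrable

lemma integral_congr_ae01 (h : f =ᵐ[volume.restrict (Ioc (0 : ℝ) 1)] g) :
    ∫ x in (0 : ℝ)..1, f x = ∫ x in (0 : ℝ)..1, g x := by
  rw [intervalIntegral.integral_of_le zero_le_one, intervalIntegral.integral_of_le zero_le_one]
  exact integral_congr_ae h

/-! ### The `L²` inner product -/

lemma ip_comm (f g : ℝ → ℝ) : ip f g = ip g f := by simp [ip, mul_comm]

lemma ip_congr_ae (h : f =ᵐ[volume.restrict (Ioc (0 : ℝ) 1)] f')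
    (h' : g =ᵐ[volume.restrict (Ioc (0 : ℝ) 1)] g') : ip f g = ip f' g' :=
  integral_congr_ae01 (h.mul h')

lemma ip_congr (h : ∀ x ∈ Icc (0 : ℝ) 1, f x = f' x) (h' : ∀ x ∈ Icc (0 : ℝ) 1, g x = g' x) :
    ip f g = ip f' g' := ip_congr_ae (ae_of_Icc h) (ae_of_Icc h')

lemma ip_add_left (hf : EssBdd f) (hf' : EssBdd f') (hg : EssBdd g) :
    ip (fun x => f x + f' x) g = ip f g + ip f' g := by
  unfold ip
  rw [← intervalIntegral.integral_add (hf.mul hg).intervalIntegrable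
    (hf'.mul hg).intervalIntegrable]
  simp only [add_mul]

lemma ip_const_mul_left (c : ℝ) (f g : ℝ → ℝ) : ip (fun x => c * f x) g = c * ip f g := by
  unfold ip
  rw [← intervalIntegral.integral_const_mul]
  simp only [mul_assoc]

lemma ip_sub_left (hf : EssBdd f) (hf' : EssBdd f') (hg : EssBdd g) :
    ip (fun x => f x - f' x) g = ip f g - ip f' g := by
  unfold ip
  rw [← intervalIntegral.integral_sub (hf.mul hg).intervalIntegrable
    (hf'.mul hg).intervalIntegrable]
  simp only [sub_mul]

lemma ip_add_right (hf : EssBdd f) (hg : EssBdd g) (hg' : EssBdd g') :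
    ip f (fun x => g x + g' x) = ip f g + ip f g' := by
  rw [ip_comm, ip_add_left hg hg' hf, ip_comm g, ip_comm g']

lemma ip_sub_right (hf : EssBdd f) (hg : EssBdd g) (hg' : EssBdd g') :
    ip f (fun x => g x - g' x) = ip f g - ip f g' := by
  rw [ip_comm, ip_sub_left hg hg' hf, ip_comm g, ip_comm g']

lemma ip_const_mul_right (c : ℝ) (f g : ℝ → ℝ) : ip f (fun x => c * g x) = c * ip f g := by
  rw [ip_comm, ip_const_mul_left, ip_comm]

lemma ip_sum_left {ι : Type*} (s : Finset ι) {F : ι → ℝ → ℝ} (h : ∀ i ∈ s, EssBdd (F i))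
    (hg : EssBdd g) : ip (fun x => ∑ i ∈ s, F i x) g = ∑ i ∈ s, ip (F i) g := by
  unfold ip
  rw [← intervalIntegral.integral_finsetSum fun i hi => ((h i hi).mul hg).intervalIntegrable]
  simp only [Finset.sum_mul]

lemma ip_sum_right {ι : Type*} (s : Finset ι) {F : ι → ℝ → ℝ} (h : ∀ i ∈ s, EssBdd (F i))
    (hg : EssBdd g) : ip g (fun x => ∑ i ∈ s, F i x) = ∑ i ∈ s, ip g (F i) := by
  rw [ip_comm, ip_sum_left s h hg]
  simp only [ip_comm]

lemma ip_self_nonneg (f : ℝ → ℝ) : 0 ≤ ip f f :=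
  intervalIntegral.integral_nonneg zero_le_one fun _ _ => mul_self_nonneg _

lemma l2norm_nonneg (f : ℝ → ℝ) : 0 ≤ l2norm f := Real.sqrt_nonneg _

lemma l2norm_sq (f : ℝ → ℝ) : l2norm f ^ 2 = ip f f := Real.sq_sqrt (ip_self_nonneg f)

lemma l2norm_congr_ae (h : f =ᵐ[volume.restrict (Ioc (0 : ℝ) 1)] f') : l2norm f = l2norm f' := by
  rw [l2norm, ip_congr_ae h h, l2norm]

/-- The quadratic polynomial s ↦ ‖f - s g‖² is nonnegative, so its discriminant is at most zero. -/
lemma abs_ip_le (hf : EssBdd f) (hg : EssBdd g) : |ip f g| ≤ l2norm f * l2norm g := by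
  have key : ∀ s : ℝ, 0 ≤ ip g g * (s * s) + (-2 * ip f g) * s + ip f f := by
    intro s
    have h := ip_self_nonneg (fun x => f x - s * g x)
    rw [ip_sub_left hf (hg.const_mul s) (hf.sub (hg.const_mul s)),
      ip_sub_right hf hf (hg.const_mul s), ip_const_mul_left, ip_sub_right hg hf (hg.const_mul s),
      ip_const_mul_right, ip_const_mul_right, ip_comm g f] at h
    linarith
  have hd := discrim_le_zero key
  rw [discrim] at hd
  apply abs_le_of_sq_le_sq _ (mul_nonneg (l2norm_nonneg _) (l2norm_nonneg _))
  rw [mul_pow, l2norm_sq, l2norm_sq]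
  linarith

lemma l2norm_const_mul (c : ℝ) (f : ℝ → ℝ) : l2norm (fun x => c * f x) = |c| * l2norm f := by
  rw [l2norm, ip_const_mul_left, ip_const_mul_right, ← mul_assoc, Real.sqrt_mul (mul_self_nonneg c),
    Real.sqrt_mul_self_eq_abs, l2norm]

lemma l2norm_add_le (hf : EssBdd f) (hg : EssBdd g) :
    l2norm (fun x => f x + g x) ≤ l2norm f + l2norm g := by
  apply le_of_sq_le_sq _ (add_nonneg (l2norm_nonneg _) (l2norm_nonneg _))
  rw [l2norm_sq, ip_add_left hf hg (hf.add hg), ip_add_right hf hf hg, ip_add_right hg hf hg,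
    ip_comm g f, add_sq, l2norm_sq, l2norm_sq]
  have := (le_abs_self _).trans (abs_ip_le hf hg)
  linarith

lemma l2norm_sub_le (hf : EssBdd f) (hg : EssBdd g) :
    l2norm (fun x => f x - g x) ≤ l2norm f + l2norm g := by
  have h := l2norm_add_le hf (hg.const_mul (-1))
  rw [l2norm_const_mul] at h
  simpa [sub_eq_add_neg] using h

lemma l2norm_mono_ae (hg : EssBdd g)
    (h : ∀ᵐ x ∂(volume.restrict (Ioc (0 : ℝ) 1)), |f x| ≤ |g x|) : l2norm f ≤ l2norm g := by
  apply Real.sqrt_le_sqrt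
  unfold ip
  rw [intervalIntegral.integral_of_le zero_le_one, intervalIntegral.integral_of_le zero_le_one]
  apply integral_mono_of_nonneg (ae_of_all _ fun _ => mul_self_nonneg _) (hg.mul hg).integrable
  filter_upwards [h] with x hx
  exact abs_le_iff_mul_self_le.1 hx

lemma l2norm_mul_le {K : ℝ} (hK : 0 ≤ K) (hg : EssBdd g) (h : ∀ x ∈ Icc (0 : ℝ) 1, |f x| ≤ K) :
    l2norm (fun x => f x * g x) ≤ K * l2norm g := by
  have := l2norm_mono_ae (f := fun x => f x * g x) (hg.const_mul K) (ae_of_Icc fun x hx => by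
    rw [abs_mul, abs_mul, abs_of_nonneg hK]
    exact mul_le_mul_of_nonneg_right (h x hx) (abs_nonneg _))
  rwa [l2norm_const_mul, abs_of_nonneg hK] at this

lemma l2norm_const (c : ℝ) : l2norm (fun _ => c) = |c| := by
  simp [l2norm, ip, Real.sqrt_mul_self_eq_abs]

lemma l2norm_le_of_ae_bound {K : ℝ} (hK : 0 ≤ K)
    (h : ∀ᵐ x ∂(volume.restrict (Ioc (0 : ℝ) 1)), |f x| ≤ K) : l2norm f ≤ K := by
  have := l2norm_mono_ae (f := f) (EssBdd.const K) (h.mono fun x hx => hx.trans (le_abs_self _))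
  rwa [l2norm_const, abs_of_nonneg hK] at this

lemma l2norm_le_of_bound {K : ℝ} (h : ∀ x ∈ Icc (0 : ℝ) 1, |f x| ≤ K) : l2norm f ≤ K :=
  l2norm_le_of_ae_bound ((abs_nonneg _).trans (h 0 (by simp))) (ae_of_Icc h)

lemma integral_abs_le_l2norm (hf : EssBdd f) : ∫ x in (0 : ℝ)..1, |f x| ≤ l2norm f := by
  have h1 : EssBdd (fun x => |f x|) := MemLp.abs hf
  have h := abs_ip_le h1 (EssBdd.const 1)
  rw [l2norm_const, abs_one, mul_one] at h
  have h2 : l2norm (fun x => |f x|) ≤ l2norm f :=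
    l2norm_mono_ae hf (ae_of_all _ fun x => (abs_abs _).le)
  refine le_trans ?_ ((le_abs_self _).trans (h.trans h2))
  simp [ip]

end EssBdd

/-! ### Piecewise `C¹` functions on the unit interval -/

/-- Continuous functions on `[0,1]`, differentiable off a countable set, with essentially bounded
derivative. -/
structure PC1 (f : ℝ → ℝ) : Prop where
  cont : ContinuousOn f (Icc 0 1)
  diff : ∃ s : Set ℝ, s.Countable ∧ ∀ x ∈ Ioo (0 : ℝ) 1 \ s, DifferentiableAt ℝ f x
  bdd : EssBdd (dx f)

section PC1
variable {f g : ℝ → ℝ}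

lemma dx_eq_deriv {x : ℝ} (hx : x ∈ Ioo (0 : ℝ) 1) : dx f x = deriv f x :=
  derivWithin_of_mem_nhds (Icc_mem_nhds hx.1 hx.2)

lemma dx_congr (h : ∀ x ∈ Icc (0 : ℝ) 1, f x = g x) : ∀ x ∈ Icc (0 : ℝ) 1, dx f x = dx g x :=
  fun x hx => derivWithin_congr h (h x hx)

lemma ae_of_Ioo_diff_countable {p : ℝ → Prop} {s : Set ℝ} (hs : s.Countable)
    (h : ∀ x ∈ Ioo (0 : ℝ) 1 \ s, p x) : ∀ᵐ x ∂(volume.restrict (Ioc (0 : ℝ) 1)), p x := by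
  rw [ae_restrict_iff' measurableSet_Ioc]
  filter_upwards [(hs.insert (1 : ℝ)).ae_notMem volume] with x hx hx1
  simp only [mem_insert_iff, not_or] at hx
  exact h x ⟨⟨hx1.1, lt_of_le_of_ne hx1.2 hx.1⟩, hx.2⟩

lemma PC1.essBdd (hf : PC1 f) : EssBdd f := essBdd_of_continuousOn hf.cont

/-- At exceptional points `dx f` may be a default value. Integrals do not see these points, so the
sum and product rules for `dx` are stated almost everywhere. -/
lemma PC1.ae_hasDerivAt (hf : PC1 f) :
    ∀ᵐ x ∂(volume.restrict (Ioc (0 : ℝ) 1)), x ∈ Ioo (0 : ℝ) 1 ∧ HasDerivAt f (dx f x) x := by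
  obtain ⟨s, hs, h⟩ := hf.diff
  refine ae_of_Ioo_diff_countable hs fun x hx => ⟨hx.1, ?_⟩
  rw [dx_eq_deriv hx.1]
  exact (h x hx).hasDerivAt

lemma PC1.dx_add_ae (hf : PC1 f) (hg : PC1 g) :
    dx (fun x => f x + g x) =ᵐ[volume.restrict (Ioc (0 : ℝ) 1)] fun x => dx f x + dx g x := by
  filter_upwards [hf.ae_hasDerivAt, hg.ae_hasDerivAt] with x h1 h2
  rw [dx_eq_deriv h1.1]
  exact (h1.2.add h2.2).deriv

lemma PC1.dx_sub_ae (hf : PC1 f) (hg : PC1 g) :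
    dx (fun x => f x - g x) =ᵐ[volume.restrict (Ioc (0 : ℝ) 1)] fun x => dx f x - dx g x := by
  filter_upwards [hf.ae_hasDerivAt, hg.ae_hasDerivAt] with x h1 h2
  rw [dx_eq_deriv h1.1]
  exact (h1.2.sub h2.2).deriv

lemma PC1.dx_mul_ae (hf : PC1 f) (hg : PC1 g) :
    dx (fun x => f x * g x) =ᵐ[volume.restrict (Ioc (0 : ℝ) 1)]
      fun x => dx f x * g x + f x * dx g x := by
  filter_upwards [hf.ae_hasDerivAt, hg.ae_hasDerivAt] with x h1 h2
  rw [dx_eq_deriv h1.1]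
  exact (h1.2.mul h2.2).deriv

lemma PC1.diff_both (hf : PC1 f) (hg : PC1 g) : ∃ s : Set ℝ, s.Countable ∧
    ∀ x ∈ Ioo (0 : ℝ) 1 \ s, DifferentiableAt ℝ f x ∧ DifferentiableAt ℝ g x := by
  obtain ⟨s, hs, h⟩ := hf.diff
  obtain ⟨s', hs', h'⟩ := hg.diff
  exact ⟨s ∪ s', hs.union hs', fun x hx => ⟨h x ⟨hx.1, fun h => hx.2 (Or.inl h)⟩,
    h' x ⟨hx.1, fun h => hx.2 (Or.inr h)⟩⟩⟩

lemma PC1.add (hf : PC1 f) (hg : PC1 g) : PC1 (fun x => f x + g x) := by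
  obtain ⟨s, hs, h⟩ := hf.diff_both hg
  exact ⟨hf.cont.add hg.cont, ⟨s, hs, fun x hx => (h x hx).1.add (h x hx).2⟩,
    (hf.bdd.add hg.bdd).congr_ae (hf.dx_add_ae hg).symm⟩

lemma PC1.sub (hf : PC1 f) (hg : PC1 g) : PC1 (fun x => f x - g x) := by
  obtain ⟨s, hs, h⟩ := hf.diff_both hg
  exact ⟨hf.cont.sub hg.cont, ⟨s, hs, fun x hx => (h x hx).1.sub (h x hx).2⟩,
    (hf.bdd.sub hg.bdd).congr_ae (hf.dx_sub_ae hg).symm⟩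

lemma PC1.mul (hf : PC1 f) (hg : PC1 g) : PC1 (fun x => f x * g x) := by
  obtain ⟨s, hs, h⟩ := hf.diff_both hg
  exact ⟨hf.cont.mul hg.cont, ⟨s, hs, fun x hx => (h x hx).1.mul (h x hx).2⟩,
    ((hf.bdd.mul hg.essBdd).add (hf.essBdd.mul hg.bdd)).congr_ae (hf.dx_mul_ae hg).symm⟩

lemma dx_const (c : ℝ) : dx (fun _ => c) = fun _ => 0 := by
  funext x; simp [dx]

lemma PC1.const (c : ℝ) : PC1 (fun _ => c) :=
  ⟨continuousOn_const, ⟨∅, countable_empty, fun _ _ => differentiableAt_const c⟩, by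
    rw [dx_const]; exact EssBdd.const 0⟩

lemma PC1.const_mul (c : ℝ) (hf : PC1 f) : PC1 (fun x => c * f x) := (PC1.const c).mul hf

lemma PC1.dx_const_mul_ae (c : ℝ) (hf : PC1 f) :
    dx (fun x => c * f x) =ᵐ[volume.restrict (Ioc (0 : ℝ) 1)] fun x => c * dx f x := by
  filter_upwards [hf.ae_hasDerivAt] with x h1
  rw [dx_eq_deriv h1.1]
  exact (h1.2.const_mul c).deriv

lemma PC1.sum {ι : Type*} {F : ι → ℝ → ℝ} (s : Finset ι) (h : ∀ i ∈ s, PC1 (F i)) :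
    PC1 (fun x => ∑ i ∈ s, F i x) := by
  classical
  induction s using Finset.induction_on with
  | empty => simpa using PC1.const 0
  | insert a s ha ih =>
    simp only [Finset.sum_insert ha]
    exact (h a (Finset.mem_insert_self _ _)).add
      (ih fun i hi => h i (Finset.mem_insert_of_mem hi))

lemma continuousOn_dx (hf : ContDiffOn ℝ 1 f (Icc 0 1)) : ContinuousOn (dx f) (Icc 0 1) :=
  hf.continuousOn_derivWithin (uniqueDiffOn_Icc zero_lt_one) le_rfl

lemma pc1_of_contDiffOn (hf : ContDiffOn ℝ 1 f (Icc 0 1)) : PC1 f :=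
  ⟨hf.continuousOn, ⟨∅, countable_empty, fun x hx =>
    (hf.differentiableOn (by simp) x (Ioo_subset_Icc_self hx.1)).differentiableAt
      (Icc_mem_nhds hx.1.1 hx.1.2)⟩, essBdd_of_continuousOn (continuousOn_dx hf)⟩

lemma EssBdd.intervalIntegrable_sub (hf : EssBdd f) {a b : ℝ} (ha : a ∈ Icc (0 : ℝ) 1)
    (hb : b ∈ Icc (0 : ℝ) 1) : IntervalIntegrable f volume a b :=
  hf.intervalIntegrable.mono_set (by
    rw [uIcc_of_le zero_le_one]; exact uIcc_subset_Icc ha hb)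

lemma PC1.integral_dx (hf : PC1 f) {a b : ℝ} (ha : a ∈ Icc (0 : ℝ) 1) (hb : b ∈ Icc (0 : ℝ) 1) :
    ∫ x in a..b, dx f x = f b - f a := by
  obtain ⟨s, hs, h⟩ := hf.diff
  refine integral_eq_of_hasDerivAt_off_countable f (dx f) hs
    (hf.cont.mono (uIcc_subset_Icc ha hb)) (fun x hx => ?_) (hf.bdd.intervalIntegrable_sub ha hb)
  have hx1 : x ∈ Ioo (0 : ℝ) 1 :=
    ⟨lt_of_le_of_lt (le_min ha.1 hb.1) hx.1.1, lt_of_lt_of_le hx.1.2 (max_le ha.2 hb.2)⟩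
  rw [dx_eq_deriv hx1]
  exact (h x ⟨hx1, hx.2⟩).hasDerivAt

/-- Only one factor has to vanish at the endpoints. The other may be θ or ρ, whose boundary values
are free. -/
lemma PC1.ip_dx_left (hf : PC1 f) (hg : PC1 g) (h0 : g 0 = 0) (h1 : g 1 = 0) :
    ip (dx f) g = - ip f (dx g) := by
  have h := (hf.mul hg).integral_dx (a := 0) (b := 1) (by simp) (by simp)
  rw [integral_congr_ae01 (hf.dx_mul_ae hg), intervalIntegral.integral_add
    (hf.bdd.mul hg.essBdd).intervalIntegrable (hf.essBdd.mul hg.bdd).intervalIntegrable] at h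
  rw [h0, h1] at h
  simp only [ip]
  linarith

lemma abs_integral_le_l2norm (hf : EssBdd f) {a b : ℝ} (ha : a ∈ Icc (0 : ℝ) 1)
    (hb : b ∈ Icc (0 : ℝ) 1) : |∫ x in a..b, f x| ≤ l2norm f := by
  have h1 : EssBdd (fun x => |f x|) := MemLp.abs hf
  calc |∫ x in a..b, f x| ≤ ∫ x in uIoc a b, |f x| :=
        intervalIntegral.norm_integral_le_integral_norm_uIoc (f := f) (μ := volume)
    _ ≤ ∫ x in Ioc 0 1, |f x| := by
        apply setIntegral_mono_set h1.integrable (ae_of_all _ fun x => abs_nonneg _)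
        apply LE.le.eventuallyLE
        exact Ioc_subset_Ioc (le_min ha.1 hb.1) (max_le ha.2 hb.2)
    _ ≤ l2norm f := by
        rw [← intervalIntegral.integral_of_le zero_le_one]
        exact integral_abs_le_l2norm hf

lemma PC1.abs_sub_le (hf : PC1 f) {a b : ℝ} (ha : a ∈ Icc (0 : ℝ) 1) (hb : b ∈ Icc (0 : ℝ) 1) :
    |f b - f a| ≤ l2norm (dx f) := by
  rw [← hf.integral_dx ha hb]
  exact abs_integral_le_l2norm hf.bdd ha hb

lemma PC1.abs_le_of_zero (hf : PC1 f) (h0 : f 0 = 0) {x : ℝ} (hx : x ∈ Icc (0 : ℝ) 1) :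
    |f x| ≤ l2norm (dx f) := by
  simpa [h0] using hf.abs_sub_le (a := 0) (by simp) hx

lemma PC1.l2norm_le_of_zero (hf : PC1 f) (h0 : f 0 = 0) : l2norm f ≤ l2norm (dx f) :=
  l2norm_le_of_bound fun _ hx => hf.abs_le_of_zero h0 hx

/-- The oscillation of f is at most ‖f'‖, and |f x| is compared with the mean of |f|. This replaces
`abs_le_of_zero` for the projection error of ζ, which need not vanish at the endpoints. -/
lemma PC1.abs_le_add (hf : PC1 f) {x : ℝ} (hx : x ∈ Icc (0 : ℝ) 1) :
    |f x| ≤ l2norm f + l2norm (dx f) := by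
  have h1 : EssBdd (fun x => |f x|) := MemLp.abs hf.essBdd
  have h : ∫ y in (0 : ℝ)..1, (|f x| - l2norm (dx f)) ≤ ∫ y in (0 : ℝ)..1, |f y| := by
    refine intervalIntegral.integral_mono_on zero_le_one (by simp) h1.intervalIntegrable
      fun y hy => ?_
    have := hf.abs_sub_le hy hx
    have := abs_sub_abs_le_abs_sub (f x) (f y)
    linarith
  have h2 := integral_abs_le_l2norm hf.essBdd
  simp only [intervalIntegral.integral_const, sub_zero, one_smul] at h
  linarith

/-- Functions that are continuous on `[0,1]` and vanish in `L²` vanish on `[0,1]`. -/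
lemma eq_zero_of_ip_self (hf : ContinuousOn f (Icc 0 1)) (h : ip f f = 0) :
    ∀ x ∈ Icc (0 : ℝ) 1, f x = 0 := by
  have h2 := (intervalIntegral.integral_eq_zero_iff_of_nonneg_ae (f := fun x => f x * f x)
    (ae_of_all _ fun x => mul_self_nonneg _)
    ((essBdd_of_continuousOn hf).mul (essBdd_of_continuousOn hf)).intervalIntegrable).1 h
  simp only [Ioc_eq_empty (not_lt.2 (zero_le_one (α := ℝ))), union_empty] at h2
  have h3 : f =ᵐ[volume.restrict (Icc (0 : ℝ) 1)] fun _ => 0 := by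
    rw [restrict_Ioc_eq_restrict_Icc] at h2
    filter_upwards [h2] with x hx
    simpa using hx
  exact Measure.eqOn_Icc_of_ae_eq volume (by simp) h3 hf continuousOn_const

end PC1

/-! ### The energy inequality at a fixed time -/

section Energy
variable {f g : ℝ → ℝ}

lemma PC1.l2norm_dx_mul_le (hf : PC1 f) (hg : PC1 g) {F G : ℝ} (hF0 : 0 ≤ F) (hG0 : 0 ≤ G)
    (hF : ∀ x ∈ Icc (0 : ℝ) 1, |f x| ≤ F) (hG : ∀ x ∈ Icc (0 : ℝ) 1, |g x| ≤ G) :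
    l2norm (dx (fun x => f x * g x)) ≤ G * l2norm (dx f) + F * l2norm (dx g) := by
  rw [l2norm_congr_ae (hf.dx_mul_ae hg)]
  refine (l2norm_add_le (hf.bdd.mul hg.essBdd) (hf.essBdd.mul hg.bdd)).trans ?_
  refine add_le_add ?_ (l2norm_mul_le hF0 hg.bdd hF)
  have := l2norm_mul_le hG0 hf.bdd hG
  simpa only [mul_comm] using this

lemma abs_ip_le_of_le (hf : EssBdd f) (hg : EssBdd g) {a b : ℝ} (ha : l2norm f ≤ a)
    (hb : l2norm g ≤ b) : |ip f g| ≤ a * b :=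
  (abs_ip_le hf hg).trans (mul_le_mul ha hb (l2norm_nonneg _) ((l2norm_nonneg _).trans ha))

/-- Integration by parts: `((θ v)', θ) = ½ (v' θ, θ)` if `v` vanishes at the endpoints. -/
lemma PC1.ip_dx_mul_self {θ v : ℝ → ℝ} (hθ : PC1 θ) (hv : PC1 v) (h0 : v 0 = 0) (h1 : v 1 = 0) :
    ip (dx (fun x => θ x * v x)) θ = 1 / 2 * ip (fun x => dx v x * θ x) θ := by
  have e1 : ip (dx (fun x => θ x * v x)) θ
      = ip (fun x => dx θ x * v x) θ + ip (fun x => θ x * dx v x) θ := by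
    rw [ip_congr_ae (hθ.dx_mul_ae hv) (Filter.EventuallyEq.refl _ θ),
      ip_add_left (hθ.bdd.mul hv.essBdd) (hθ.essBdd.mul hv.bdd) hθ.essBdd]
  -- The integration by parts is against θ v, which vanishes at the endpoints because v does. It
  -- shows that (θ' v, θ) is the negative of ((θ v)', θ).
  have e2 : ip (dx θ) (fun x => θ x * v x) = - ip θ (dx (fun x => θ x * v x)) :=
    hθ.ip_dx_left (hθ.mul hv) (by simp [h0]) (by simp [h1])
  have e3 : ip (dx θ) (fun x => θ x * v x) = ip (fun x => dx θ x * v x) θ := by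
    simp only [ip]; congr 1; funext x; ring
  have e4 : ip (fun x => θ x * dx v x) θ = ip (fun x => dx v x * θ x) θ := by
    simp only [ip]; congr 1; funext x; ring
  rw [ip_comm θ, e3, e1] at e2
  rw [e1, ← e4]
  linarith

/-- The right-hand side of the energy identity for the difference between the exact and the
discrete solution. Here `p` and `q` are comparison functions for `ζ` and `u`. -/
theorem energy_rhs_le {ε K δ : ℝ} (hε : 0 < ε) (hK : 1 ≤ K) (hδ0 : 0 ≤ δ) (hδ1 : δ ≤ 1)
    {η ζ u p q ζh uh : ℝ → ℝ} (hη : PC1 η) (hζ : PC1 ζ) (hu : PC1 u) (hp : PC1 p) (hq : PC1 q)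
    (hζh : PC1 ζh) (huh : PC1 uh)
    (bη : ∀ x ∈ Icc (0 : ℝ) 1, |η x| ≤ K) (bη' : ∀ x ∈ Icc (0 : ℝ) 1, |dx η x| ≤ K)
    (bζ : ∀ x ∈ Icc (0 : ℝ) 1, |ζ x| ≤ K) (bζ' : ∀ x ∈ Icc (0 : ℝ) 1, |dx ζ x| ≤ K)
    (bu : ∀ x ∈ Icc (0 : ℝ) 1, |u x| ≤ K) (bu' : ∀ x ∈ Icc (0 : ℝ) 1, |dx u x| ≤ K)
    (u0 : u 0 = 0) (q0 : q 0 = 0) (q1 : q 1 = 0) (uh0 : uh 0 = 0) (uh1 : uh 1 = 0)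
    (hρ : l2norm (fun x => ζ x - p x) ≤ K * δ)
    (hρ' : l2norm (dx (fun x => ζ x - p x)) ≤ K * δ)
    (hσ' : l2norm (dx (fun x => u x - q x)) ≤ K * δ)
    (hθ1 : ∀ x ∈ Icc (0 : ℝ) 1, |p x - ζh x| ≤ 1) (hξ1 : l2norm (dx (fun x => q x - uh x)) ≤ 1) :
    - ε * ip (dx (fun x => ζ x * u x - ζh x * uh x)) (fun x => p x - ζh x)
      - ip (dx (fun x => η x * (u x - uh x))) (fun x => p x - ζh x)
      - ip (fun x => η x * dx (fun y => ζ y - ζh y) x) (fun x => q x - uh x)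
      - ε * ip (fun x => η x * (u x * dx u x - uh x * dx uh x)) (fun x => q x - uh x)
    ≤ (48 * ε + 15) * K ^ 3 * (δ ^ 2 + l2norm (fun x => p x - ζh x) ^ 2
        + l2norm (dx (fun x => q x - uh x)) ^ 2) := by
  set ρ : ℝ → ℝ := fun x => ζ x - p x with hρd
  set θ : ℝ → ℝ := fun x => p x - ζh x with hθd
  set ξ : ℝ → ℝ := fun x => q x - uh x with hξd
  set σ : ℝ → ℝ := fun x => u x - q x with hσd
  set e : ℝ → ℝ := fun x => u x - uh x with hed
  have Pρ : PC1 ρ := hζ.sub hp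
  have Pθ : PC1 θ := hp.sub hζh
  have Pξ : PC1 ξ := hq.sub huh
  have Pσ : PC1 σ := hu.sub hq
  have Pe : PC1 e := hu.sub huh
  have e0 : e 0 = 0 := by simp [hed, u0, uh0]
  have ξ0 : ξ 0 = 0 := by simp [hξd, q0, uh0]
  have ξ1 : ξ 1 = 0 := by simp [hξd, q1, uh1]
  set a := l2norm θ with had
  set d := l2norm (dx ξ) with hdd
  have a0 : 0 ≤ a := l2norm_nonneg _
  have d0 : 0 ≤ d := l2norm_nonneg _
  -- Each term is bounded by a multiple of K³ w², and w² ≤ 3 (δ² + a² + d²). The multiples add up to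
  -- 2 + 9 + 1 + 4 = 16 for the terms with the factor ε and to 2 + 1 + 2 = 5 for the others, whence
  -- 48 ε + 15.
  set w := δ + a + d with hw
  have w0 : 0 ≤ w := by positivity
  have K0 : 0 ≤ K := zero_le_one.trans hK
  have Kδ0 : 0 ≤ K * δ := mul_nonneg K0 hδ0
  have Kδ : K * δ ≤ K := mul_le_of_le_one_right K0 hδ1
  have δw : δ ≤ w := by linarith
  have aw : a ≤ w := by linarith
  have dw : d ≤ w := by linarith
  have dKd : d ≤ K * d := le_mul_of_one_le_left d0 hK
  have Ka0 : 0 ≤ K * a := mul_nonneg K0 a0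
  have exle : l2norm (dx e) ≤ K * δ + d := by
    have h : dx e =ᵐ[volume.restrict (Ioc (0 : ℝ) 1)] fun x => dx σ x + dx ξ x := by
      have : e = fun x => σ x + ξ x := by funext x; simp [hed, hσd, hξd]
      rw [this]
      exact Pσ.dx_add_ae Pξ
    rw [l2norm_congr_ae h]
    exact (l2norm_add_le Pσ.bdd Pξ.bdd).trans (add_le_add hσ' le_rfl)
  have exw : l2norm (dx e) ≤ K * w := by
    have : K * w = K * δ + K * a + K * d := by rw [hw]; ring
    linarith
  have ex2 : l2norm (dx e) ≤ 2 * K := by linarith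
  have ebd : ∀ x ∈ Icc (0 : ℝ) 1, |e x| ≤ l2norm (dx e) := fun x hx => Pe.abs_le_of_zero e0 hx
  have ebw : ∀ x ∈ Icc (0 : ℝ) 1, |e x| ≤ K * w := fun x hx => (ebd x hx).trans exw
  have Kw0 : 0 ≤ K * w := mul_nonneg K0 w0
  -- The maximum of |uh| is controlled through u and ‖e'‖ ≤ 2K, since e vanishes at 0; no inverse
  -- inequality is needed here.
  have uhb : ∀ x ∈ Icc (0 : ℝ) 1, |uh x| ≤ 3 * K := fun x hx => by
    have h1 := bu x hx
    have h2 := (ebd x hx).trans ex2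
    have h3 : uh x = u x - e x := by simp [hed]
    rw [h3]
    exact (abs_sub _ _).trans (by linarith)
  have uhx : l2norm (dx uh) ≤ 3 * K := by
    have h : dx uh =ᵐ[volume.restrict (Ioc (0 : ℝ) 1)] fun x => dx u x - dx e x := by
      have : uh = fun x => u x - e x := by funext x; simp [hed]
      rw [this]
      exact hu.dx_sub_ae Pe
    rw [l2norm_congr_ae h]
    have := l2norm_sub_le hu.bdd Pe.bdd
    have := l2norm_le_of_bound bu'
    linarith
  have ξb : ∀ x ∈ Icc (0 : ℝ) 1, |ξ x| ≤ d := fun x hx => Pξ.abs_le_of_zero ξ0 hx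
  have ξn : l2norm ξ ≤ w := (Pξ.l2norm_le_of_zero ξ0).trans dw
  have ρb : ∀ x ∈ Icc (0 : ℝ) 1, |ρ x| ≤ 2 * K * δ := fun x hx =>
    (Pρ.abs_le_add hx).trans (by linarith)
  have ww : 0 ≤ w * w := mul_nonneg w0 w0
  have K2 : K ≤ K ^ 3 := le_self_pow₀ hK (by norm_num)
  have K3 : K ^ 2 ≤ K ^ 3 := pow_le_pow_right₀ hK (by norm_num)
  -- the term `(ζ e)'`
  have T1 : |ip (dx (fun x => ζ x * e x)) θ| ≤ 2 * (K ^ 3 * (w * w)) := by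
    have h := Pe.l2norm_dx_mul_le hζ Kw0 K0 ebw bζ
    have h2 := mul_le_mul_of_nonneg_left exw K0
    have h3 := mul_le_mul_of_nonneg_left (l2norm_le_of_bound bζ') Kw0
    have h4 : l2norm (dx (fun x => ζ x * e x)) ≤ 2 * (K ^ 2 * w) := by
      simp only [mul_comm (ζ _)]
      nlinarith only [h, h2, h3]
    refine (abs_ip_le_of_le (hζ.mul Pe).bdd Pθ.essBdd h4 aw).trans ?_
    have := mul_le_mul_of_nonneg_right K3 ww
    nlinarith only [this]
  -- the term `(ρ uh)'`
  have T2 : |ip (dx (fun x => ρ x * uh x)) θ| ≤ 9 * (K ^ 3 * (w * w)) := by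
    have h := Pρ.l2norm_dx_mul_le huh (by positivity) (by positivity) ρb uhb
    have h2 := mul_le_mul_of_nonneg_left hρ' (show 0 ≤ 3 * K by positivity)
    have h3 := mul_le_mul_of_nonneg_left uhx (show 0 ≤ 2 * K * δ by positivity)
    have h5 := mul_le_mul_of_nonneg_left δw (sq_nonneg K)
    have h4 : l2norm (dx (fun x => ρ x * uh x)) ≤ 9 * (K ^ 2 * w) := by
      nlinarith only [h, h2, h3, h5]
    refine (abs_ip_le_of_le (Pρ.mul huh).bdd Pθ.essBdd h4 aw).trans ?_
    have := mul_le_mul_of_nonneg_right K3 ww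
    nlinarith only [this]
  -- the term `(θ uh)'`
  have T3 : |ip (dx (fun x => θ x * uh x)) θ| ≤ K ^ 3 * (w * w) := by
    rw [Pθ.ip_dx_mul_self huh uh0 uh1]
    -- `dx uh` is controlled only in L². It is split into `dx u`, which is bounded pointwise, and
    -- `dx e`, for which one factor θ is absorbed by |θ| ≤ 1.
    have h : (fun x => dx uh x * θ x) =ᵐ[volume.restrict (Ioc (0 : ℝ) 1)]
        fun x => dx u x * θ x - θ x * dx e x := by
      filter_upwards [hu.dx_sub_ae huh] with x hx
      have hx' : dx e x = dx u x - dx uh x := hx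
      rw [hx']
      ring
    rw [ip_congr_ae h (Filter.EventuallyEq.refl _ θ),
      ip_sub_left (hu.bdd.mul Pθ.essBdd) (Pθ.essBdd.mul Pe.bdd) Pθ.essBdd]
    have h1 := abs_ip_le_of_le (hu.bdd.mul Pθ.essBdd) Pθ.essBdd
      ((l2norm_mul_le K0 Pθ.essBdd bu').trans (mul_le_mul_of_nonneg_left aw K0)) aw
    have h2 := abs_ip_le_of_le (Pθ.essBdd.mul Pe.bdd) Pθ.essBdd
      ((l2norm_mul_le zero_le_one Pe.bdd hθ1).trans ((one_mul _).le.trans exw)) aw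
    rw [abs_mul, abs_of_pos (by norm_num : (0 : ℝ) < 1 / 2)]
    have h3 := abs_sub (ip (fun x => dx u x * θ x) θ) (ip (fun x => θ x * dx e x) θ)
    have := mul_le_mul_of_nonneg_right K2 ww
    nlinarith only [this, h1, h2, h3]
  -- the term `(η e)'`
  have T4 : |ip (dx (fun x => η x * e x)) θ| ≤ 2 * (K ^ 3 * (w * w)) := by
    have h := hη.l2norm_dx_mul_le Pe K0 Kw0 bη ebw
    have h2 := mul_le_mul_of_nonneg_left exw K0
    have h3 := mul_le_mul_of_nonneg_left (l2norm_le_of_bound bη') Kw0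
    have h4 : l2norm (dx (fun x => η x * e x)) ≤ 2 * (K ^ 2 * w) := by
      nlinarith only [h, h2, h3]
    refine (abs_ip_le_of_le (hη.mul Pe).bdd Pθ.essBdd h4 aw).trans ?_
    have := mul_le_mul_of_nonneg_right K3 ww
    nlinarith only [this]
  have T5 : |ip (fun x => η x * dx ρ x) ξ| ≤ K ^ 3 * (w * w) := by
    have h4 : l2norm (fun x => η x * dx ρ x) ≤ K ^ 2 * w := by
      have := l2norm_mul_le K0 Pρ.bdd bη
      have h2 := mul_le_mul_of_nonneg_left hρ' K0
      have h5 := mul_le_mul_of_nonneg_left δw (sq_nonneg K)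
      nlinarith only [this, h2, h5]
    refine (abs_ip_le_of_le (hη.essBdd.mul Pρ.bdd) Pξ.essBdd h4 ξn).trans ?_
    have := mul_le_mul_of_nonneg_right K3 ww
    nlinarith only [this]
  have T6 : |ip (fun x => η x * dx θ x) ξ| ≤ 2 * (K ^ 3 * (w * w)) := by
    -- No bound on `dx θ` is available, so the derivative is moved to η ξ, which vanishes at both
    -- ends.
    have h1 : ip (fun x => η x * dx θ x) ξ = ip (dx θ) (fun x => η x * ξ x) := by
      simp only [ip]; congr 1; funext x; ring
    rw [h1, Pθ.ip_dx_left (hη.mul Pξ) (by simp [ξ0]) (by simp [ξ1]), abs_neg]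
    have h := hη.l2norm_dx_mul_le Pξ K0 d0 bη ξb
    have h3 := mul_le_mul_of_nonneg_left (l2norm_le_of_bound bη') d0
    have h5 := mul_le_mul_of_nonneg_left dw K0
    have h4 : l2norm (dx (fun x => η x * ξ x)) ≤ 2 * (K * w) := by
      nlinarith only [h, h3, h5]
    refine (abs_ip_le_of_le Pθ.essBdd (hη.mul Pξ).bdd aw h4).trans ?_
    have := mul_le_mul_of_nonneg_right K2 ww
    nlinarith only [this]
  have T7 : |ip (fun x => η x * (u x * dx u x - uh x * dx uh x)) ξ| ≤ 4 * (K ^ 3 * (w * w)) := by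
    have h : (fun x => η x * (u x * dx u x - uh x * dx uh x))
        =ᵐ[volume.restrict (Ioc (0 : ℝ) 1)] fun x => η x * (u x * dx e x + e x * dx uh x) := by
      filter_upwards [hu.dx_sub_ae huh] with x hx
      have hx' : dx e x = dx u x - dx uh x := hx
      rw [hx']
      simp only [hed]
      ring
    rw [ip_congr_ae h (Filter.EventuallyEq.refl _ ξ)]
    have b1 := (hu.essBdd.mul Pe.bdd)
    have b2 := (Pe.essBdd.mul huh.bdd)
    have h1 := l2norm_mul_le K0 Pe.bdd bu
    have h2 := l2norm_mul_le Kw0 huh.bdd ebw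
    have h3 := l2norm_add_le b1 b2
    have h4 := l2norm_mul_le K0 (b1.add b2) bη
    have h5 := mul_le_mul_of_nonneg_left exw K0
    have h6 := mul_le_mul_of_nonneg_left uhx Kw0
    have h7 : l2norm (fun x => u x * dx e x + e x * dx uh x) ≤ 4 * (K ^ 2 * w) := by
      nlinarith only [h1, h2, h3, h5, h6]
    have h8 : l2norm (fun x => η x * (u x * dx e x + e x * dx uh x)) ≤ 4 * (K ^ 3 * w) := by
      have := mul_le_mul_of_nonneg_left h7 K0
      nlinarith only [this, h4]
    refine (abs_ip_le_of_le (hη.essBdd.mul (b1.add b2)) Pξ.essBdd h8 ξn).trans (le_of_eq ?_)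
    ring
  -- assembling
  have S1 : ip (dx (fun x => ζ x * u x - ζh x * uh x)) θ
      = ip (dx (fun x => ζ x * e x)) θ + ip (dx (fun x => ρ x * uh x)) θ
        + ip (dx (fun x => θ x * uh x)) θ := by
    have h : (fun x => ζ x * u x - ζh x * uh x)
        = fun x => (ζ x * e x + ρ x * uh x) + θ x * uh x := by
      funext x; simp only [hed, hρd, hθd]; ring
    have P1 := hζ.mul Pe
    have P2 := Pρ.mul huh
    have P3 := Pθ.mul huh
    have h2 : dx (fun x => ζ x * u x - ζh x * uh x) =ᵐ[volume.restrict (Ioc (0 : ℝ) 1)]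
        fun x => (dx (fun x => ζ x * e x) x + dx (fun x => ρ x * uh x) x)
          + dx (fun x => θ x * uh x) x := by
      rw [h]
      filter_upwards [(P1.add P2).dx_add_ae P3, P1.dx_add_ae P2] with x h1 h2
      rw [h1, h2]
    rw [ip_congr_ae h2 (Filter.EventuallyEq.refl _ θ), ip_add_left (P1.bdd.add P2.bdd) P3.bdd
      Pθ.essBdd, ip_add_left P1.bdd P2.bdd Pθ.essBdd]
  have S2 : ip (fun x => η x * dx (fun y => ζ y - ζh y) x) ξ
      = ip (fun x => η x * dx ρ x) ξ + ip (fun x => η x * dx θ x) ξ := by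
    have h : (fun y => ζ y - ζh y) = fun x => ρ x + θ x := by
      funext x; simp only [hρd, hθd]; ring
    rw [← ip_add_left (hη.essBdd.mul Pρ.bdd) (hη.essBdd.mul Pθ.bdd) Pξ.essBdd, h]
    apply ip_congr_ae _ (Filter.EventuallyEq.refl _ ξ)
    filter_upwards [Pρ.dx_add_ae Pθ] with x hx
    rw [hx]
    ring
  rw [S1, S2]
  have hw2 : w * w ≤ 3 * (δ ^ 2 + a ^ 2 + d ^ 2) := by
    rw [hw]
    nlinarith only [sq_nonneg (δ - a), sq_nonneg (δ - d), sq_nonneg (a - d)]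
  set W := K ^ 3 * (w * w) with hW
  have A1 : - (ip (dx (fun x => ζ x * e x)) θ + ip (dx (fun x => ρ x * uh x)) θ
        + ip (dx (fun x => θ x * uh x)) θ)
      - ip (fun x => η x * (u x * dx u x - uh x * dx uh x)) ξ ≤ 16 * W := by
    linarith only [(abs_le.1 T1).1, (abs_le.1 T2).1, (abs_le.1 T3).1, (abs_le.1 T7).1]
  have A2 := mul_le_mul_of_nonneg_left A1 hε.le
  have A3 : (16 * ε + 5) * W ≤ (48 * ε + 15) * K ^ 3 * (δ ^ 2 + a ^ 2 + d ^ 2) := by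
    have := mul_le_mul_of_nonneg_left hw2 (show 0 ≤ (16 * ε + 5) * K ^ 3 by positivity)
    linarith
  linarith only [A2, A3, (abs_le.1 T4).1, (abs_le.1 T5).1, (abs_le.1 T6).1]

end Energy

/-! ### Meshes -/

namespace Mesh
variable (M : Mesh)

/-- The nodes of the mesh, indexed by `ℕ` and constant after the last one. -/
def X (i : ℕ) : ℝ := M.node ⟨min i M.N, Nat.lt_succ_of_le (min_le_right _ _)⟩

lemma X_mono : Monotone M.X := fun i j hij =>
  M.strictMono.monotone (by simpa using min_le_min_right M.N hij)

lemma X_zero : M.X 0 = 0 := by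
  rw [← M.node_first]; simp [X]

lemma X_N : M.X M.N = 1 := by
  rw [← M.node_last]; simp [X, Fin.last]

lemma X_castSucc (i : Fin M.N) : M.node i.castSucc = M.X i := by
  unfold X; congr 1; ext; simp [i.2.le]

lemma X_succ (i : Fin M.N) : M.node i.succ = M.X (i + 1) := by
  unfold X; congr 1; ext; simp [Nat.succ_le_of_lt i.2]

lemma X_lt {i : ℕ} (hi : i < M.N) : M.X i < M.X (i + 1) := by
  have := M.strictMono (Fin.castSucc_lt_succ (i := ⟨i, hi⟩))
  rwa [X_castSucc, X_succ] at this

lemma X_mem (i : ℕ) : M.X i ∈ Icc (0 : ℝ) 1 := by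
  refine ⟨M.X_zero ▸ M.X_mono (Nat.zero_le i), ?_⟩
  rcases le_total i M.N with h | h
  · exact M.X_N ▸ M.X_mono h
  · have : M.X i = M.X M.N := by simp [X, h]
    rw [this, X_N]

lemma length_eq (i : Fin M.N) : M.length i = M.X (i + 1) - M.X i := by
  rw [length, X_castSucc, X_succ]

lemma X_sub_le {i : ℕ} (hi : i < M.N) : M.X (i + 1) - M.X i ≤ M.h := by
  rw [← M.length_eq ⟨i, hi⟩]
  exact le_ciSup (f := M.length) (Set.finite_range _).bddAbove ⟨i, hi⟩

lemma N_pos : 0 < M.N := by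
  rcases Nat.eq_zero_or_pos M.N with h | h
  · have h1 := M.X_N
    rw [h, M.X_zero] at h1
    exact absurd h1 zero_ne_one
  · exact h

lemma h_pos : 0 < M.h := by
  have h1 := M.X_sub_le M.N_pos
  have h2 := M.X_lt M.N_pos
  linarith

lemma h_le_one : M.h ≤ 1 := by
  have : Nonempty (Fin M.N) := ⟨⟨0, M.N_pos⟩⟩
  refine ciSup_le fun i => ?_
  rw [M.length_eq]
  linarith [(M.X_mem i).1, (M.X_mem (i + 1)).2]

lemma exists_interval {x : ℝ} (hx : x ∈ Icc (0 : ℝ) 1) :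
    ∃ j < M.N, x ∈ Icc (M.X j) (M.X (j + 1)) := by
  have hex : ∃ n, x ≤ M.X n := ⟨M.N, by rw [M.X_N]; exact hx.2⟩
  classical
  have hle : Nat.find hex ≤ M.N := Nat.find_min' hex (by rw [M.X_N]; exact hx.2)
  have hs := Nat.find_spec hex
  rcases Nat.eq_zero_or_pos (Nat.find hex) with h | h
  · refine ⟨0, M.N_pos, by rw [M.X_zero]; exact hx.1, ?_⟩
    rw [h] at hs
    exact hs.trans (M.X_mono (Nat.zero_le _))
  · refine ⟨Nat.find hex - 1, by omega, ?_, ?_⟩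
    · exact (not_le.1 (Nat.find_min hex (Nat.sub_lt h one_pos))).le
    · rwa [Nat.sub_add_cancel h]

end Mesh

/-! ### Splines of maximal smoothness -/

/-- Splines of degree `d` and maximal smoothness: piecewise constants and their `d`-fold iterated
integrals. -/
def Spl (M : Mesh) : ℕ → Set (ℝ → ℝ)
  | 0 => {s | EssBdd s ∧ ∀ i < M.N, ∃ c, ∀ x ∈ Ioo (M.X i) (M.X (i + 1)), s x = c}
  | d + 1 => {F | ∃ c, ∃ s ∈ Spl M d, ∀ x ∈ Icc (0 : ℝ) 1, F x = c + ∫ y in (0 : ℝ)..x, s y}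

section Spl
variable {M : Mesh} {f g s : ℝ → ℝ}

lemma EssBdd.continuousOn_integral (hs : EssBdd s) (c : ℝ) :
    ContinuousOn (fun x => c + ∫ y in (0 : ℝ)..x, s y) (Icc 0 1) := by
  have := intervalIntegral.continuousOn_primitive_interval (μ := volume) (f := s) (a := 0) (b := 1)
    (by
      rw [uIcc_of_le zero_le_one]
      exact (integrableOn_Icc_iff_integrableOn_Ioc).2 hs.integrable)
  rw [uIcc_of_le zero_le_one] at this
  exact continuousOn_const.add this

lemma Spl.essBdd {d : ℕ} : ∀ {s : ℝ → ℝ}, s ∈ Spl M d → EssBdd s := by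
  induction d with
  | zero => exact fun h => h.1
  | succ d ih =>
    rintro F ⟨c, s, hs, h⟩
    exact (essBdd_of_continuousOn ((ih hs).continuousOn_integral c)).congr fun x hx => (h x hx).symm

lemma EssBdd.integral_add (hf : EssBdd f) (hg : EssBdd g) {a b : ℝ} (ha : a ∈ Icc (0 : ℝ) 1)
    (hb : b ∈ Icc (0 : ℝ) 1) :
    ∫ y in a..b, (f y + g y) = (∫ y in a..b, f y) + ∫ y in a..b, g y :=
  intervalIntegral.integral_add (hf.intervalIntegrable_sub ha hb) (hg.intervalIntegrable_sub ha hb)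

lemma Spl.add {d : ℕ} : ∀ {f g : ℝ → ℝ}, f ∈ Spl M d → g ∈ Spl M d →
    (fun x => f x + g x) ∈ Spl M d := by
  induction d with
  | zero =>
    intro f g hf hg
    refine ⟨hf.1.add hg.1, fun i hi => ?_⟩
    obtain ⟨c, hc⟩ := hf.2 i hi
    obtain ⟨c', hc'⟩ := hg.2 i hi
    exact ⟨c + c', fun x hx => by simp only [hc x hx, hc' x hx]⟩
  | succ d ih =>
    rintro f g ⟨c, s, hs, h⟩ ⟨c', s', hs', h'⟩
    refine ⟨c + c', _, ih hs hs', fun x hx => ?_⟩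
    beta_reduce
    rw [h x hx, h' x hx, EssBdd.integral_add (Spl.essBdd hs) (Spl.essBdd hs') (by simp) hx]
    ring

lemma Spl.const_mul {d : ℕ} (a : ℝ) : ∀ {f : ℝ → ℝ}, f ∈ Spl M d →
    (fun x => a * f x) ∈ Spl M d := by
  induction d with
  | zero =>
    intro f hf
    refine ⟨hf.1.const_mul a, fun i hi => ?_⟩
    obtain ⟨c, hc⟩ := hf.2 i hi
    exact ⟨a * c, fun x hx => by simp only [hc x hx]⟩
  | succ d ih =>
    rintro f ⟨c, s, hs, h⟩
    refine ⟨a * c, _, ih hs, fun x hx => ?_⟩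
    beta_reduce
    rw [h x hx, intervalIntegral.integral_const_mul]
    ring

lemma Spl.zero_mem (d : ℕ) : (fun _ => 0) ∈ Spl M d := by
  induction d with
  | zero => exact ⟨EssBdd.const 0, fun i _ => ⟨0, fun _ _ => rfl⟩⟩
  | succ d ih => exact ⟨0, _, ih, fun x _ => by simp⟩

lemma Spl.const_mem (d : ℕ) (a : ℝ) : (fun _ => a) ∈ Spl M d := by
  cases d with
  | zero => exact ⟨EssBdd.const a, fun i _ => ⟨a, fun _ _ => rfl⟩⟩
  | succ d => exact ⟨a, _, Spl.zero_mem d, fun x _ => by simp⟩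

lemma Spl.id_mem (d : ℕ) : (fun x => x) ∈ Spl M (d + 1) :=
  ⟨0, _, Spl.const_mem d 1, fun x _ => by simp⟩

lemma Spl.sub {d : ℕ} (hf : f ∈ Spl M d) (hg : g ∈ Spl M d) :
    (fun x => f x - g x) ∈ Spl M d := by
  simpa [sub_eq_add_neg] using Spl.add hf (Spl.const_mul (-1) hg)

lemma Spl.sum {d : ℕ} {ι : Type*} {F : ι → ℝ → ℝ} (t : Finset ι) (h : ∀ i ∈ t, F i ∈ Spl M d) :
    (fun x => ∑ i ∈ t, F i x) ∈ Spl M d := by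
  classical
  induction t using Finset.induction_on with
  | empty => simpa using Spl.const_mem d 0
  | insert a s ha ih =>
    simp only [Finset.sum_insert ha]
    exact Spl.add (h a (Finset.mem_insert_self _ _))
      (ih fun i hi => h i (Finset.mem_insert_of_mem hi))

/-- The number of mesh intervals over which a step function of degree `d` rises. -/
def stepWidth : ℕ → ℕ
  | 0 => 1
  | d + 1 => 2 * stepWidth d + 1

lemma stepWidth_pos (d : ℕ) : 0 < stepWidth d := by cases d <;> simp [stepWidth]

/-- Spline approximations of a Heaviside function. -/
lemma exists_step (M : Mesh) (d : ℕ) : ∀ i, i + stepWidth d ≤ M.N → ∃ H ∈ Spl M d,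
    (∀ x ∈ Icc (0 : ℝ) 1, H x ∈ Icc (0 : ℝ) 1) ∧ (∀ x ∈ Icc (0 : ℝ) 1, x ≤ M.X i → H x = 0) ∧
    (∀ x ∈ Icc (0 : ℝ) 1, M.X (i + stepWidth d) ≤ x → H x = 1) := by
  induction d with
  | zero =>
    intro i hi
    simp only [stepWidth] at hi ⊢
    -- In degree zero the exact Heaviside function jumping at the i-th node serves.
    refine ⟨(Ioi (M.X i)).indicator 1, ⟨?_, fun j hj => ?_⟩, fun x _ => ?_, fun x _ hx => ?_,
      fun x _ hx => ?_⟩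
    · refine memLp_top_of_bound ((measurable_const (a := (1 : ℝ))).indicator
        measurableSet_Ioi).aestronglyMeasurable 1 (ae_of_all _ fun x => ?_)
      by_cases h : x ∈ Ioi (M.X i) <;> simp [h]
    · rcases lt_or_ge j i with h | h
      · refine ⟨0, fun x hx => indicator_of_notMem ?_ _⟩
        exact not_lt.2 (hx.2.le.trans (M.X_mono h))
      · refine ⟨1, fun x hx => ?_⟩
        rw [indicator_of_mem (show x ∈ Ioi (M.X i) from (M.X_mono h).trans_lt hx.1)]
        rfl
    · by_cases h : x ∈ Ioi (M.X i) <;> simp [h]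
    · exact indicator_of_notMem (not_lt.2 hx) _
    · rw [indicator_of_mem (show x ∈ Ioi (M.X i) from (M.X_lt (by omega)).trans_le hx)]
      rfl
  | succ d ih =>
    intro i hi
    simp only [stepWidth] at hi ⊢
    set L := stepWidth d with hL
    obtain ⟨H, hH, H01, Hz, Ho⟩ := ih i (by omega)
    obtain ⟨G, hG, G01, Gz, Go⟩ := ih (i + L + 1) (by omega)
    have hB := Spl.sub hH hG
    -- H has finished rising one interval before G starts. Hence B is a nonnegative bump, equal to 1
    -- on that interval and to 0 outside the 2L + 1 intervals following node i; its normalised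
    -- primitive is the step of the next degree.
    set B : ℝ → ℝ := fun x => H x - G x with hBd
    have hBe : EssBdd B := Spl.essBdd hB
    have B0 : ∀ x ∈ Icc (0 : ℝ) 1, 0 ≤ B x := fun x hx => by
      rcases le_total x (M.X (i + L + 1)) with h | h
      · simp only [hBd, Gz x hx h, sub_zero]
        exact (H01 x hx).1
      · simp only [hBd, Ho x hx ((M.X_mono (by omega)).trans h)]
        linarith [(G01 x hx).2]
    have nonneg : ∀ a ∈ Icc (0 : ℝ) 1, ∀ b ∈ Icc (0 : ℝ) 1, a ≤ b → 0 ≤ ∫ y in a..b, B y :=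
      fun a ha b hb hab => intervalIntegral.integral_nonneg hab fun u hu =>
        B0 u ⟨ha.1.trans hu.1, hu.2.trans hb.2⟩
    have split : ∀ b ∈ Icc (0 : ℝ) 1, ∀ c ∈ Icc (0 : ℝ) 1,
        (∫ y in (0 : ℝ)..b, B y) + ∫ y in b..c, B y = ∫ y in (0 : ℝ)..c, B y := fun b hb c hc =>
      intervalIntegral.integral_add_adjacent_intervals
        (hBe.intervalIntegrable_sub (by simp) hb) (hBe.intervalIntegrable_sub hb hc)
    have m0 : (0 : ℝ) ∈ Icc (0 : ℝ) 1 := by simp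
    have m1 : (1 : ℝ) ∈ Icc (0 : ℝ) 1 := by simp
    have hab : M.X (i + L) < M.X (i + L + 1) := M.X_lt (by omega)
    -- The plateau between the two rises makes the total mass J of the bump positive.
    have mid : ∫ y in M.X (i + L)..M.X (i + L + 1), B y = M.X (i + L + 1) - M.X (i + L) := by
      rw [intervalIntegral.integral_congr (g := fun _ => 1)]
      · simp
      · intro x hx
        rw [uIcc_of_le hab.le] at hx
        have hx1 : x ∈ Icc (0 : ℝ) 1 :=
          ⟨(M.X_mem _).1.trans hx.1, hx.2.trans (M.X_mem _).2⟩
        simp only [hBd, Ho x hx1 hx.1, Gz x hx1 hx.2, sub_zero]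
    have Jpos : 0 < ∫ y in (0 : ℝ)..1, B y := by
      rw [← split _ (M.X_mem (i + L + 1)) 1 m1, ← split _ (M.X_mem (i + L)) _ (M.X_mem _), mid]
      have := nonneg 0 m0 _ (M.X_mem (i + L)) (M.X_mem _).1
      have := nonneg _ (M.X_mem (i + L + 1)) 1 m1 (M.X_mem _).2
      linarith
    set J := ∫ y in (0 : ℝ)..1, B y with hJ
    refine ⟨fun x => J⁻¹ * ∫ y in (0 : ℝ)..x, B y,
      ⟨0, _, Spl.const_mul J⁻¹ hB, fun x hx => ?_⟩, fun x hx => ⟨?_, ?_⟩, fun x hx hxi => ?_,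
      fun x hx hxi => ?_⟩
    · rw [intervalIntegral.integral_const_mul, zero_add]
    · exact mul_nonneg (inv_nonneg.2 Jpos.le) (nonneg 0 m0 x hx hx.1)
    · rw [inv_mul_le_iff₀ Jpos, mul_one, hJ, ← split x hx 1 m1]
      linarith [nonneg x hx 1 m1 hx.2]
    · have : ∫ y in (0 : ℝ)..x, B y = ∫ y in (0 : ℝ)..x, (0 : ℝ) := by
        refine intervalIntegral.integral_congr fun y hy => ?_
        rw [uIcc_of_le hx.1] at hy
        have hy1 : y ∈ Icc (0 : ℝ) 1 := ⟨hy.1, hy.2.trans hx.2⟩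
        have hyi : y ≤ M.X i := hy.2.trans hxi
        simp only [hBd, Hz y hy1 hyi, Gz y hy1 (hyi.trans (M.X_mono (by omega))), sub_zero]
      simp [this]
    · have : ∫ y in x..1, B y = ∫ y in x..1, (0 : ℝ) := by
        refine intervalIntegral.integral_congr fun y hy => ?_
        rw [uIcc_of_le hx.2] at hy
        have hy1 : y ∈ Icc (0 : ℝ) 1 := ⟨hx.1.trans hy.1, hy.2⟩
        have hyi := hxi.trans hy.1
        simp only [hBd, Ho y hy1 ((M.X_mono (by omega)).trans hyi),
          Go y hy1 ((M.X_mono (by omega)).trans hyi), sub_self]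
      have h2 := split x hx 1 m1
      rw [this, intervalIntegral.integral_zero, add_zero] at h2
      beta_reduce
      rw [h2, ← hJ, inv_mul_cancel₀ Jpos.ne']

/-- Lipschitz functions on `[0,1]`. -/
def Lip01 (K : ℝ) (g : ℝ → ℝ) : Prop :=
  ∀ x ∈ Icc (0 : ℝ) 1, ∀ y ∈ Icc (0 : ℝ) 1, |g x - g y| ≤ K * |x - y|

/-- A quasi-interpolant of first order. -/
lemma exists_quasiInterpolant (M : Mesh) (d : ℕ) {K : ℝ} (hK : 0 ≤ K) (hg : Lip01 K g) :
    ∃ s ∈ Spl M d, ∀ x ∈ Icc (0 : ℝ) 1, |g x - s x| ≤ (stepWidth d + 1) * (K * M.h) := by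
  have hH : ∀ i, ∃ H ∈ Spl M d, (∀ x ∈ Icc (0 : ℝ) 1, H x ∈ Icc (0 : ℝ) 1) ∧
      (∀ x ∈ Icc (0 : ℝ) 1, x ≤ M.X i → H x = 0) ∧
      (i + stepWidth d ≤ M.N → ∀ x ∈ Icc (0 : ℝ) 1, M.X (i + stepWidth d) ≤ x → H x = 1) := by
    intro i
    by_cases hi : i + stepWidth d ≤ M.N
    · obtain ⟨H, h1, h2, h3, h4⟩ := exists_step M d i hi
      exact ⟨H, h1, h2, h3, fun _ => h4⟩
    -- Too close to the right end no step fits. Zero is harmless there, because any interval to the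
    -- right of such a node is within `stepWidth d` intervals of it.
    · exact ⟨fun _ => 0, Spl.zero_mem d, fun _ _ => by simp, fun _ _ _ => rfl,
        fun h => absurd h hi⟩
  choose H hS H01 Hz Ho using hH
  refine ⟨fun x => g 0 + ∑ i ∈ Finset.range M.N, (g (M.X (i + 1)) - g (M.X i)) * H i x,
    Spl.add (Spl.const_mem d _) (Spl.sum _ fun i _ => Spl.const_mul _ (hS i)), fun x hx => ?_⟩
  obtain ⟨j, hj, hxj⟩ := M.exists_interval hx
  have hΔ : ∀ i < M.N, |g (M.X (i + 1)) - g (M.X i)| ≤ K * M.h := fun i hi =>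
    (hg _ (M.X_mem _) _ (M.X_mem _)).trans (mul_le_mul_of_nonneg_left
      (by rw [abs_of_pos (sub_pos.2 (M.X_lt hi))]; exact M.X_sub_le hi) hK)
  have hKh : 0 ≤ K * M.h := mul_nonneg hK M.h_pos.le
  -- With exact Heaviside functions the sum telescopes to the value of g at the node left of x. The
  -- splines differ from these at x only for the `stepWidth d` indices up to j.
  have tel : g (M.X j) = g 0 + ∑ i ∈ Finset.range M.N,
      (g (M.X (i + 1)) - g (M.X i)) * (if i < j then 1 else 0) := by
    have h1 : ∑ i ∈ Finset.range M.N, (g (M.X (i + 1)) - g (M.X i)) * (if i < j then (1 : ℝ) else 0)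
        = ∑ i ∈ Finset.range j, (g (M.X (i + 1)) - g (M.X i)) := by
      simp only [mul_ite, mul_one, mul_zero]
      rw [← Finset.sum_filter]
      congr 1
      ext i
      simp only [Finset.mem_filter, Finset.mem_range]
      omega
    rw [h1, Finset.sum_range_sub (fun i => g (M.X i)), M.X_zero]
    ring
  have dif : |∑ i ∈ Finset.range M.N, (g (M.X (i + 1)) - g (M.X i))
      * (H i x - (if i < j then 1 else 0))| ≤ stepWidth d * (K * M.h) := by
    refine (Finset.abs_sum_le_sum_abs _ _).trans ?_
    have : ∀ i ∈ Finset.range M.N, |(g (M.X (i + 1)) - g (M.X i))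
        * (H i x - (if i < j then 1 else 0))|
        ≤ if i ∈ Finset.Icc (j + 1 - stepWidth d) j then K * M.h else 0 := by
      intro i hi
      have hL := stepWidth_pos d
      rw [abs_mul]
      split_ifs with h1 h2 h2
      · refine (mul_le_mul (hΔ i (Finset.mem_range.1 hi)) ?_ (abs_nonneg _) hKh).trans (mul_one _).le
        have := H01 i x hx
        exact abs_le.2 ⟨by linarith [this.1], by linarith [this.2]⟩
      · rw [Finset.mem_Icc] at h2
        rw [Ho i (by omega) x hx ((M.X_mono (by omega)).trans hxj.1)]
        simp
      · refine (mul_le_mul (hΔ i (Finset.mem_range.1 hi)) ?_ (abs_nonneg _) hKh).trans (mul_one _).le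
        have := H01 i x hx
        exact abs_le.2 ⟨by linarith [this.1], by linarith [this.2]⟩
      · rw [Finset.mem_Icc] at h2
        rw [Hz i x hx (hxj.2.trans (M.X_mono (by omega)))]
        simp
    refine (Finset.sum_le_sum this).trans ?_
    rw [← Finset.sum_filter, Finset.sum_const, nsmul_eq_mul]
    refine mul_le_mul_of_nonneg_right ?_ hKh
    have hc : (Finset.filter (· ∈ Finset.Icc (j + 1 - stepWidth d) j) (Finset.range M.N)).card
        ≤ (Finset.Icc (j + 1 - stepWidth d) j).card :=
      Finset.card_le_card fun i hi => (Finset.mem_filter.1 hi).2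
    rw [Nat.card_Icc] at hc
    exact_mod_cast hc.trans (by omega)
  have e1 : g x - (g 0 + ∑ i ∈ Finset.range M.N, (g (M.X (i + 1)) - g (M.X i)) * H i x)
      = (g x - g (M.X j)) - ∑ i ∈ Finset.range M.N, (g (M.X (i + 1)) - g (M.X i))
      * (H i x - (if i < j then 1 else 0)) := by
    rw [tel]
    simp only [mul_sub, Finset.sum_sub_distrib]
    ring
  rw [e1]
  refine (abs_sub _ _).trans ?_
  have h2 : |g x - g (M.X j)| ≤ K * M.h :=
    (hg _ hx _ (M.X_mem _)).trans (mul_le_mul_of_nonneg_left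
      (by rw [abs_of_nonneg (sub_nonneg.2 hxj.1)]; linarith [M.X_sub_le hj, hxj.2]) hK)
  linarith


/-! ### Approximation by splines -/

lemma lip01_of_dx_le {K : ℝ} (hf : DifferentiableOn ℝ f (Icc 0 1))
    (h : ∀ x ∈ Icc (0 : ℝ) 1, |dx f x| ≤ K) : Lip01 K f := fun _ hx _ hy =>
  (convex_Icc 0 1).norm_image_sub_le_of_norm_derivWithin_le hf h hy hx

/-- Where the derivative exists it is a limit of slopes; elsewhere `derivWithin` is zero, which is
why K ≥ 0 is required. -/
lemma Lip01.abs_dx_le {K : ℝ} (hK : 0 ≤ K) (hf : Lip01 K f) {x : ℝ} (hx : x ∈ Icc (0 : ℝ) 1) :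
    |dx f x| ≤ K := by
  by_cases hd : DifferentiableWithinAt ℝ f (Icc 0 1) x
  · have h1 := hd.hasDerivWithinAt
    have h2 := hasDerivWithinAt_iff_tendsto_slope.1 h1
    have : (nhdsWithin x (Icc (0 : ℝ) 1 \ {x})).NeBot := accPt_principal_iff_nhdsWithin.1
      (uniqueDiffWithinAt_iff_accPt.1 (uniqueDiffOn_Icc zero_lt_one x hx))
    refine le_of_tendsto h2.abs ?_
    filter_upwards [self_mem_nhdsWithin] with y hy
    rw [slope_def_field, abs_div, div_le_iff₀ (abs_pos.2 (sub_ne_zero.2 hy.2))]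
    exact hf y hy.1 x hx
  · rw [dx, derivWithin_zero_of_not_differentiableWithinAt hd, abs_zero]
    exact hK

lemma dx_eq_of_integral {c : ℝ} (hs : ContinuousOn s (Icc 0 1))
    (h : ∀ x ∈ Icc (0 : ℝ) 1, f x = c + ∫ y in (0 : ℝ)..x, s y) {x : ℝ}
    (hx : x ∈ Icc (0 : ℝ) 1) : HasDerivWithinAt f (s x) (Icc 0 1) x := by
  have : Fact (x ∈ Icc (0 : ℝ) 1) := ⟨hx⟩
  have h1 := intervalIntegral.integral_hasDerivWithinAt_right (f := s) (a := 0) (b := x)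
    ((essBdd_of_continuousOn hs).intervalIntegrable_sub (by simp) hx) (s := Icc 0 1) (t := Icc 0 1)
    (hs.stronglyMeasurableAtFilter_nhdsWithin measurableSet_Icc x) (hs x hx)
  exact (h1.const_add c).congr h (h x hx)

/-- The difference between `f` and the integral of an approximation of `f'` is Lipschitz. -/
lemma lip01_sub_integral {K : ℝ} (hf : ContDiffOn ℝ 1 f (Icc 0 1)) (hs : EssBdd s)
    (h : ∀ x ∈ Icc (0 : ℝ) 1, |dx f x - s x| ≤ K) :
    Lip01 K (fun x => f x - (f 0 + ∫ y in (0 : ℝ)..x, s y)) := by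
  intro x hx y hy
  have hP := pc1_of_contDiffOn hf
  have h1 := hP.integral_dx hy hx
  have h2 := intervalIntegral.integral_add_adjacent_intervals
    (hs.intervalIntegrable_sub (a := 0) (by simp) hy) (hs.intervalIntegrable_sub hy hx)
  have h3 := intervalIntegral.integral_sub (hP.bdd.intervalIntegrable_sub hy hx)
    (hs.intervalIntegrable_sub hy hx)
  have h4 : f x - (f 0 + ∫ y in (0 : ℝ)..x, s y) - (f y - (f 0 + ∫ y in (0 : ℝ)..y, s y))
      = ∫ z in y..x, (dx f z - s z) := by
    rw [h3, h1, ← h2]; ring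
  rw [h4]
  refine intervalIntegral.norm_integral_le_of_norm_le_const (f := fun z => dx f z - s z) fun z hz => h z ?_
  exact uIcc_subset_Icc hy hx (uIoc_subset_uIcc hz)

/-- Splines of degree `d` approximate smooth functions to order `d + 1`. -/
theorem exists_spline_approx (d : ℕ) : ∃ C, 0 ≤ C ∧ ∀ (M : Mesh) (f : ℝ → ℝ) (K : ℝ), 0 ≤ K →
    ContDiffOn ℝ (d + 1 : ℕ) f (Icc 0 1) →
    (∀ x ∈ Icc (0 : ℝ) 1, |iteratedDerivWithin (d + 1) f (Icc 0 1) x| ≤ K) →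
    ∃ s ∈ Spl M d, ∀ x ∈ Icc (0 : ℝ) 1, |f x - s x| ≤ C * K * M.h ^ (d + 1) := by
  induction d with
  | zero =>
    refine ⟨stepWidth 0 + 1, by positivity, fun M f K hK hf hb => ?_⟩
    have hL : Lip01 K f := lip01_of_dx_le (hf.differentiableOn (by simp)) fun x hx => by
      simpa [dx, iteratedDerivWithin_one] using hb x hx
    obtain ⟨s, hs, h⟩ := exists_quasiInterpolant M 0 hK hL
    exact ⟨s, hs, fun x hx => (h x hx).trans (by rw [zero_add, pow_one, mul_assoc])⟩
  | succ d ih =>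
    obtain ⟨C, hC, ih⟩ := ih
    refine ⟨(stepWidth (d + 1) + 1) * C, by positivity, fun M f K hK hf hb => ?_⟩
    have hf' : ContDiffOn ℝ (d + 1 : ℕ) (dx f) (Icc 0 1) :=
      hf.derivWithin (uniqueDiffOn_Icc zero_lt_one) (by norm_cast)
    have hb' : ∀ x ∈ Icc (0 : ℝ) 1, |iteratedDerivWithin (d + 1) (dx f) (Icc 0 1) x| ≤ K :=
      fun x hx => by
        have := hb x hx
        rwa [iteratedDerivWithin_succ'] at this
    -- Integrating an approximation of f' leaves a remainder whose Lipschitz constant is O(h^(d+1));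
    -- quasi-interpolation of the remainder gains the last power of h.
    obtain ⟨s, hs, h⟩ := ih M (dx f) K hK hf' hb'
    have hg := lip01_sub_integral (hf.of_le (by norm_cast; omega)) (Spl.essBdd hs) h
    have hh := M.h_pos.le
    obtain ⟨G, hG, hGb⟩ := exists_quasiInterpolant M (d + 1) (by positivity) hg
    refine ⟨_, Spl.add ⟨f 0, s, hs, fun x _ => rfl⟩ hG, fun x hx => ?_⟩
    have := hGb x hx
    rw [sub_sub] at this
    refine this.trans (le_of_eq ?_)
    ring

/-- Simultaneous approximation of a function and its derivative: `F` is of optimal order for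
the derivative, and `F + G` is of optimal order for the function itself. -/
theorem exists_spline_approx_pair (d : ℕ) : ∃ C, 0 ≤ C ∧ ∀ (M : Mesh) (f : ℝ → ℝ) (K : ℝ), 0 ≤ K →
    ContDiffOn ℝ (d + 2 : ℕ) f (Icc 0 1) →
    (∀ x ∈ Icc (0 : ℝ) 1, |iteratedDerivWithin (d + 2) f (Icc 0 1) x| ≤ K) →
    ∃ F ∈ Spl M (d + 1), ∃ G ∈ Spl M (d + 1), F 0 = f 0 ∧
      Lip01 (C * K * M.h ^ (d + 1)) (fun x => f x - F x) ∧
      ∀ x ∈ Icc (0 : ℝ) 1, |f x - F x - G x| ≤ C * K * M.h ^ (d + 2) := by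
  obtain ⟨C, hC, h⟩ := exists_spline_approx d
  refine ⟨(stepWidth (d + 1) + 1) * C, by positivity, fun M f K hK hf hb => ?_⟩
  have hf' : ContDiffOn ℝ (d + 1 : ℕ) (dx f) (Icc 0 1) :=
    hf.derivWithin (uniqueDiffOn_Icc zero_lt_one) (by norm_cast)
  have hb' : ∀ x ∈ Icc (0 : ℝ) 1, |iteratedDerivWithin (d + 1) (dx f) (Icc 0 1) x| ≤ K :=
    fun x hx => by
      have := hb x hx
      rwa [iteratedDerivWithin_succ'] at this
  obtain ⟨s, hs, h⟩ := h M (dx f) K hK hf' hb'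
  have hg := lip01_sub_integral (hf.of_le (by norm_cast; omega)) (Spl.essBdd hs) h
  have hh := M.h_pos.le
  obtain ⟨G, hG, hGb⟩ := exists_quasiInterpolant M (d + 1) (by positivity) hg
  -- F is the primitive of s and G the quasi-interpolant of f - F. The Lipschitz bound is stated for
  -- F alone because the quasi-interpolant comes without a derivative estimate.
  refine ⟨_, ⟨f 0, s, hs, fun x _ => rfl⟩, G, hG, by simp, fun x hx y hy => ?_, fun x hx => ?_⟩
  · refine (hg x hx y hy).trans (mul_le_mul_of_nonneg_right ?_ (abs_nonneg _))
    have : C * K * M.h ^ (d + 1) ≤ (stepWidth (d + 1) + 1) * (C * K * M.h ^ (d + 1)) :=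
      le_mul_of_one_le_left (by positivity) (by simp)
    linarith
  · refine (hGb x hx).trans (le_of_eq ?_)
    ring

/-! ### Splines belong to the finite element spaces -/

lemma exists_antiderivative (p : Polynomial ℝ) :
    ∃ q : Polynomial ℝ, q.natDegree ≤ p.natDegree + 1 ∧ Polynomial.derivative q = p := by
  refine ⟨∑ i ∈ Finset.range (p.natDegree + 1),
    Polynomial.C (p.coeff i / (i + 1)) * Polynomial.X ^ (i + 1), ?_, ?_⟩
  · refine Polynomial.natDegree_sum_le_of_forall_le _ _ fun i hi => ?_
    refine (Polynomial.natDegree_C_mul_X_pow_le _ _).trans ?_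
    have := Finset.mem_range.1 hi
    omega
  · conv_rhs => rw [p.as_sum_range_C_mul_X_pow]
    rw [Polynomial.derivative_sum]
    refine Finset.sum_congr rfl fun i _ => ?_
    rw [Polynomial.derivative_C_mul_X_pow]
    congr 2
    have : (i : ℝ) + 1 ≠ 0 := by positivity
    push_cast
    field_simp

lemma Spl.continuousOn {d : ℕ} (h : f ∈ Spl M (d + 1)) : ContinuousOn f (Icc 0 1) := by
  obtain ⟨c, s, hs, h⟩ := h
  exact ((Spl.essBdd hs).continuousOn_integral c).congr h

/-- The intervals are open because in degree zero the values at the nodes are arbitrary. -/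
lemma Spl.piecewise {d : ℕ} : ∀ {f : ℝ → ℝ}, f ∈ Spl M d → ∀ i < M.N,
    ∃ p : Polynomial ℝ, p.natDegree ≤ d ∧ ∀ x ∈ Ioo (M.X i) (M.X (i + 1)), f x = p.eval x := by
  induction d with
  | zero =>
    intro f hf i hi
    obtain ⟨c, hc⟩ := hf.2 i hi
    exact ⟨Polynomial.C c, by simp, fun x hx => by simp [hc x hx]⟩
  | succ d ih =>
    rintro f ⟨c, s, hs, h⟩ i hi
    obtain ⟨p, hp, hps⟩ := ih hs i hi
    obtain ⟨q, hq, hqp⟩ := exists_antiderivative p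
    refine ⟨Polynomial.C (f (M.X i) - q.eval (M.X i)) + q, ?_, fun x hx => ?_⟩
    · refine (Polynomial.natDegree_C_add).le.trans (by omega)
    · have hx1 : x ∈ Icc (0 : ℝ) 1 := ⟨(M.X_mem i).1.trans hx.1.le, hx.2.le.trans (M.X_mem _).2⟩
      have hb := Spl.essBdd hs
      have h2 := intervalIntegral.integral_add_adjacent_intervals
        (hb.intervalIntegrable_sub (a := 0) (by simp) (M.X_mem i)) (hb.intervalIntegrable_sub (M.X_mem i) hx1)
      have h3 : ∫ y in M.X i..x, s y = q.eval x - q.eval (M.X i) := by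
        rw [intervalIntegral.integral_congr_Ioo_of_le (g := fun y => p.eval y) hx.1.le fun y hy =>
          hps y ⟨hy.1, hy.2.trans hx.2⟩]
        refine intervalIntegral.integral_eq_sub_of_hasDerivAt (f := fun y => q.eval y) (fun y _ => ?_)
          (p.continuous.intervalIntegrable _ _)
        rw [← hqp]
        exact q.hasDerivAt y
      rw [h x hx1, ← h2, h3, h _ (M.X_mem i)]
      simp only [Polynomial.eval_add, Polynomial.eval_C]
      ring

lemma Spl.contDiffOn {d : ℕ} : ∀ {f : ℝ → ℝ}, f ∈ Spl M (d + 1) →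
    ContDiffOn ℝ d f (Icc 0 1) := by
  induction d with
  | zero =>
    intro f hf
    exact contDiffOn_zero.2 (Spl.continuousOn hf)
  | succ d ih =>
    rintro f ⟨c, s, hs, h⟩
    have hd : ∀ x ∈ Icc (0 : ℝ) 1, HasDerivWithinAt f (s x) (Icc 0 1) x := fun x hx =>
      dx_eq_of_integral (Spl.continuousOn hs) h hx
    have : ((d + 1 : ℕ) : WithTop ℕ∞) = (d : WithTop ℕ∞) + 1 := by norm_cast
    rw [this, contDiffOn_succ_iff_derivWithin (uniqueDiffOn_Icc zero_lt_one)]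
    refine ⟨fun x hx => (hd x hx).differentiableWithinAt, by simp, (ih hs).congr fun x hx => ?_⟩
    exact (hd x hx).derivWithin (uniqueDiffOn_Icc zero_lt_one x hx)

/-- Polynomial identities extend from open to closed intervals. -/
lemma eq_on_Icc_of_Ioo {a b : ℝ} (hab : a < b) (hf : ContinuousOn f (Icc a b))
    (hg : ContinuousOn g (Icc a b)) (h : ∀ x ∈ Ioo a b, f x = g x) :
    ∀ x ∈ Icc a b, f x = g x := by
  have : EqOn f g (Icc a b) := by
    refine Set.EqOn.of_subset_closure (s := Ioo a b) h hf hg Ioo_subset_Icc_self ?_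
    rw [closure_Ioo hab.ne]
  exact this

/-- With r = d + 2 this is where k ≤ r - 2 matters: splines of maximal smoothness lie in S_h for all
these k, so one approximation result serves them all. -/
lemma Spl.subset_Sh {d k : ℕ} (hk : k ≤ d) : Spl M (d + 1) ⊆ Sh M (d + 2) k := by
  intro f hf
  refine ⟨(Spl.contDiffOn hf).of_le (by exact_mod_cast hk), fun i => ?_⟩
  obtain ⟨p, hp, h⟩ := Spl.piecewise hf i i.2
  refine ⟨p, by omega, ?_⟩
  rw [M.X_castSucc, M.X_succ]
  exact eq_on_Icc_of_Ioo (M.X_lt i.2)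
    ((Spl.continuousOn hf).mono (Icc_subset_Icc (M.X_mem _).1 (M.X_mem _).2))
    p.continuous.continuousOn h

end Spl

/-! ### Inverse inequalities -/

/-- Norm equivalence for polynomials of bounded degree on the unit interval. -/
lemma exists_polynomial_bound_unit (n : ℕ) : ∃ C, 0 ≤ C ∧ ∀ p : Polynomial ℝ, p.natDegree ≤ n →
    ∀ x ∈ Icc (0 : ℝ) 1, p.eval x ^ 2 ≤ C * ip (fun y => p.eval y) (fun y => p.eval y) ∧
      p.derivative.eval x ^ 2 ≤ C * ip (fun y => p.eval y) (fun y => p.eval y) := by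
  let F : (Fin (n + 1) → ℝ) → ℝ → ℝ := fun c y => ∑ i, c i * y ^ (i : ℕ)
  have hFc : ∀ c, Continuous (F c) := fun c => by fun_prop
  have hmon : ∀ i : ℕ, EssBdd (fun y => y ^ i) := fun i =>
    essBdd_of_continuousOn (by fun_prop)
  have hI : Continuous fun c => ip (F c) (F c) := by
    have : ∀ c, ip (F c) (F c) = ∑ i : Fin (n + 1), ∑ j : Fin (n + 1),
        c i * (c j * ip (fun y => y ^ (i : ℕ)) (fun y => y ^ (j : ℕ))) := by
      intro c
      let G : Fin (n + 1) → ℝ → ℝ := fun i y => c i * y ^ (i : ℕ)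
      have hG : ∀ i ∈ Finset.univ, EssBdd (G i) := fun i _ => (hmon i).const_mul _
      refine (ip_sum_left _ hG (essBdd_of_continuousOn (hFc c).continuousOn)).trans ?_
      refine Finset.sum_congr rfl fun i _ => ?_
      refine (ip_sum_right _ hG (hG i (Finset.mem_univ i))).trans ?_
      refine Finset.sum_congr rfl fun j _ => ?_
      rw [ip_const_mul_left, ip_const_mul_right]
    simp only [this]
    fun_prop
  have hpos : ∀ c ≠ 0, 0 < ip (F c) (F c) := by
    intro c hc
    refine lt_of_le_of_ne (ip_self_nonneg _) fun h0 => hc ?_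
    have hz := eq_zero_of_ip_self (hFc c).continuousOn h0.symm
    let q : Polynomial ℝ := ∑ i : Fin (n + 1), Polynomial.C (c i) * Polynomial.X ^ (i : ℕ)
    have hq : q = 0 := by
      refine Polynomial.eq_zero_of_infinite_isRoot q ((Icc_infinite zero_lt_one).mono fun x hx => ?_)
      have := hz x hx
      simp only [mem_ofPred_eq, Polynomial.IsRoot, q, Polynomial.eval_finsetSum,
        Polynomial.eval_mul, Polynomial.eval_C, Polynomial.eval_pow, Polynomial.eval_X]
      exact this
    funext i
    have h1 : q.coeff i = c i := by
      simp only [q, Polynomial.finsetSum_coeff, Polynomial.coeff_C_mul, Polynomial.coeff_X_pow]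
      rw [Finset.sum_eq_single i]
      · simp
      · intro j _ hj
        rw [if_neg (fun h => hj (Fin.ext h.symm)), mul_zero]
      · simp
    rw [← h1, hq]
    simp
  -- The squared L²-norm is continuous and positive on the compact unit sphere of coefficient
  -- vectors. Its minimum there extends to all vectors by homogeneity.
  obtain ⟨m, hm, hmb⟩ : ∃ m > 0, ∀ c, m * ‖c‖ ^ 2 ≤ ip (F c) (F c) := by
    obtain ⟨c₀, hc₀, hmin⟩ := (isCompact_sphere (0 : Fin (n + 1) → ℝ) 1).exists_isMinOn
      (NormedSpace.sphere_nonempty.2 zero_le_one) hI.continuousOn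
    have hc0 : c₀ ≠ 0 := fun h => by
      rw [mem_sphere_zero_iff_norm, h, norm_zero] at hc₀
      exact zero_ne_one hc₀
    refine ⟨_, hpos c₀ hc0, fun c => ?_⟩
    rcases eq_or_ne c 0 with rfl | hc
    · rw [norm_zero, zero_pow two_ne_zero, mul_zero]; exact ip_self_nonneg _
    have hn : 0 < ‖c‖ := norm_pos_iff.2 hc
    have h1 : ip (F c₀) (F c₀) ≤ ip (F (‖c‖⁻¹ • c)) (F (‖c‖⁻¹ • c)) :=
      hmin (by simp [norm_smul, hn.ne'])
    have h2 : F (‖c‖⁻¹ • c) = fun y => ‖c‖⁻¹ * F c y := by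
      funext y
      simp [F, Finset.mul_sum, mul_assoc]
    rw [h2, ip_const_mul_left, ip_const_mul_right] at h1
    calc _ ≤ ‖c‖⁻¹ * (‖c‖⁻¹ * ip (F c) (F c)) * ‖c‖ ^ 2 :=
          mul_le_mul_of_nonneg_right h1 (sq_nonneg _)
      _ = ip (F c) (F c) := by field_simp
  -- The derivative is a sum of n + 1 terms, each at most (n + 1) ‖c‖ on [0,1]. The same constant
  -- covers the polynomial itself.
  refine ⟨((n + 1) * (n + 1)) ^ 2 / m, by positivity, fun p hp x hx => ?_⟩
  let c : Fin (n + 1) → ℝ := fun i => p.coeff i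
  have hpF : (fun y => p.eval y) = F c := by
    funext y
    rw [Polynomial.eval_eq_sum_range' (Nat.lt_succ_of_le hp), Finset.sum_range]
  have hci : ∀ i : ℕ, i < n + 1 → |p.coeff i| ≤ ‖c‖ := fun i hi => norm_le_pi_norm c ⟨i, hi⟩
  have hxp : ∀ i : ℕ, |x ^ i| ≤ 1 := fun i => by
    rw [abs_of_nonneg (pow_nonneg hx.1 i)]
    exact pow_le_one₀ hx.1 hx.2
  have key : ∀ z : ℝ, |z| ≤ ((n + 1) * (n + 1)) * ‖c‖ →
      z ^ 2 ≤ ((n + 1) * (n + 1)) ^ 2 / m * ip (fun y => p.eval y) (fun y => p.eval y) := by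
    intro z hz
    rw [hpF, div_mul_eq_mul_div, le_div_iff₀ hm]
    have h1 : z ^ 2 ≤ (((n + 1) * (n + 1)) * ‖c‖) ^ 2 := by
      rw [← sq_abs]
      exact pow_le_pow_left₀ (abs_nonneg _) hz 2
    calc z ^ 2 * m ≤ (((n + 1) * (n + 1)) * ‖c‖) ^ 2 * m := mul_le_mul_of_nonneg_right h1 hm.le
      _ = ((n + 1) * (n + 1)) ^ 2 * (m * ‖c‖ ^ 2) := by ring
      _ ≤ _ := mul_le_mul_of_nonneg_left (hmb c) (by positivity)
  constructor
  · apply key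
    rw [Polynomial.eval_eq_sum_range' (Nat.lt_succ_of_le hp)]
    refine (Finset.abs_sum_le_sum_abs _ _).trans ?_
    have : ∀ i ∈ Finset.range (n + 1), |p.coeff i * x ^ i| ≤ ‖c‖ := fun i hi => by
      rw [abs_mul]
      exact (mul_le_mul (hci i (Finset.mem_range.1 hi)) (hxp i) (abs_nonneg _)
        (norm_nonneg _)).trans (mul_one _).le
    refine (Finset.sum_le_card_nsmul _ _ _ this).trans ?_
    rw [Finset.card_range, nsmul_eq_mul]
    push_cast
    have : (0 : ℝ) ≤ (n + 1) * ‖c‖ * n := by positivity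
    linarith
  · apply key
    rw [Polynomial.derivative_eval, Polynomial.sum_over_range' p (by simp) (n + 1) (Nat.lt_succ_of_le hp)]
    refine (Finset.abs_sum_le_sum_abs _ _).trans ?_
    have : ∀ i ∈ Finset.range (n + 1), |p.coeff i * i * x ^ (i - 1)| ≤ (n + 1) * ‖c‖ := fun i hi => by
      rw [abs_mul, abs_mul, mul_comm |p.coeff i|]
      have hi' := Finset.mem_range.1 hi
      have h1 : |(i : ℝ)| ≤ n + 1 := by
        rw [Nat.abs_cast]; exact_mod_cast hi'.le
      refine (mul_le_mul (mul_le_mul h1 (hci i hi') (abs_nonneg _) (by positivity)) (hxp _)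
        (abs_nonneg _) (by positivity)).trans (mul_one _).le
    refine (Finset.sum_le_card_nsmul _ _ _ this).trans ?_
    rw [Finset.card_range, nsmul_eq_mul]
    push_cast
    exact (mul_assoc _ _ _).symm.le

/-- The scaled form on an interval `[a,b]`. -/
lemma exists_polynomial_bound (n : ℕ) : ∃ C, 0 ≤ C ∧ ∀ p : Polynomial ℝ, p.natDegree ≤ n →
    ∀ a b : ℝ, a < b → ∀ x ∈ Icc a b,
      p.eval x ^ 2 * (b - a) ≤ C * ∫ y in a..b, p.eval y * p.eval y ∧
      p.derivative.eval x ^ 2 * (b - a) ^ 3 ≤ C * ∫ y in a..b, p.eval y * p.eval y := by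
  obtain ⟨C, hC, h⟩ := exists_polynomial_bound_unit n
  refine ⟨C, hC, fun p hp a b hab x hx => ?_⟩
  have hl : 0 < b - a := sub_pos.2 hab
  -- Transport to the unit interval divides the integral by b - a and multiplies the derivative by b
  -- - a, whence the exponents 1 and 3.
  let q : Polynomial ℝ := p.comp (Polynomial.C (b - a) * Polynomial.X + Polynomial.C a)
  have hq : q.natDegree ≤ n := by
    refine Polynomial.natDegree_comp_le.trans ?_
    have := Polynomial.natDegree_linear_le (a := b - a) (b := a)
    nlinarith
  have hqe : ∀ y, q.eval y = p.eval ((b - a) * y + a) := fun y => by simp [q]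
  have hqd : ∀ y, q.derivative.eval y = (b - a) * p.derivative.eval ((b - a) * y + a) := fun y => by
    simp [q, Polynomial.derivative_comp]
  have hip : (b - a) * ip (fun y => q.eval y) (fun y => q.eval y)
      = ∫ y in a..b, p.eval y * p.eval y := by
    unfold ip
    simp only [hqe]
    have := intervalIntegral.smul_integral_comp_mul_add (a := 0) (b := 1)
      (fun z => p.eval z * p.eval z) (b - a) a
    simpa using this
  have hx' : (x - a) / (b - a) ∈ Icc (0 : ℝ) 1 :=
    ⟨div_nonneg (sub_nonneg.2 hx.1) hl.le, (div_le_one hl).2 (by linarith [hx.2])⟩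
  have hxe : (b - a) * ((x - a) / (b - a)) + a = x := by field_simp; ring
  obtain ⟨h1, h2⟩ := h q hq _ hx'
  rw [hqe, hxe] at h1
  rw [hqd, hxe] at h2
  rw [← hip]
  constructor
  · nlinarith
  · nlinarith

/-! ### Algebra and piecewise regularity of `Sh`, and its inverse inequalities. -/

section Sh
variable {M : Mesh} {r k : ℕ} {φ ψ : ℝ → ℝ}

lemma Sh.poly (h : φ ∈ Sh M r k) {i : ℕ} (hi : i < M.N) : ∃ p : Polynomial ℝ, p.natDegree ≤ r - 1 ∧
    ∀ x ∈ Icc (M.X i) (M.X (i + 1)), φ x = p.eval x := by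
  have := h.2 ⟨i, hi⟩
  rwa [M.X_castSucc, M.X_succ] at this

lemma Sh.add (h : φ ∈ Sh M r k) (h' : ψ ∈ Sh M r k) : (fun x => φ x + ψ x) ∈ Sh M r k := by
  refine ⟨h.1.add h'.1, fun i => ?_⟩
  obtain ⟨p, hp, hp'⟩ := h.2 i
  obtain ⟨q, hq, hq'⟩ := h'.2 i
  exact ⟨p + q, Polynomial.natDegree_add_le_of_degree_le hp hq, fun x hx => by
    simp only [hp' x hx, hq' x hx, Polynomial.eval_add]⟩

lemma Sh.const_mul (c : ℝ) (h : φ ∈ Sh M r k) : (fun x => c * φ x) ∈ Sh M r k := by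
  refine ⟨contDiffOn_const.mul h.1, fun i => ?_⟩
  obtain ⟨p, hp, hp'⟩ := h.2 i
  exact ⟨Polynomial.C c * p, (Polynomial.natDegree_C_mul_le _ _).trans hp, fun x hx => by
    simp only [hp' x hx, Polynomial.eval_mul, Polynomial.eval_C]⟩

lemma Sh.zero : (fun _ => 0) ∈ Sh M r k :=
  ⟨contDiffOn_const, fun _ => ⟨0, by simp, by simp⟩⟩

lemma Sh.congr (h : φ ∈ Sh M r k) (e : ∀ x ∈ Icc (0 : ℝ) 1, φ x = ψ x) : ψ ∈ Sh M r k := by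
  refine ⟨h.1.congr fun x hx => (e x hx).symm, fun i => ?_⟩
  obtain ⟨p, hp, hp'⟩ := h.2 i
  refine ⟨p, hp, fun x hx => ?_⟩
  rw [← hp' x hx, e]
  rw [M.X_castSucc, M.X_succ] at hx
  exact ⟨(M.X_mem _).1.trans hx.1, hx.2.trans (M.X_mem _).2⟩

lemma Sh0.add (h : φ ∈ Sh0 M r k) (h' : ψ ∈ Sh0 M r k) : (fun x => φ x + ψ x) ∈ Sh0 M r k :=
  ⟨Sh.add h.1 h'.1, by simp [h.2.1, h'.2.1], by simp [h.2.2, h'.2.2]⟩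

lemma Sh0.const_mul (c : ℝ) (h : φ ∈ Sh0 M r k) : (fun x => c * φ x) ∈ Sh0 M r k :=
  ⟨Sh.const_mul c h.1, by simp [h.2.1], by simp [h.2.2]⟩

lemma Sh0.zero : (fun _ => 0) ∈ Sh0 M r k := ⟨Sh.zero, rfl, rfl⟩

lemma Sh0.congr (h : φ ∈ Sh0 M r k) (e : ∀ x ∈ Icc (0 : ℝ) 1, φ x = ψ x) : ψ ∈ Sh0 M r k :=
  ⟨Sh.congr h.1 e, by rw [← e 0 (by simp), h.2.1], by rw [← e 1 (by simp), h.2.2]⟩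

lemma Mesh.exists_open_interval (M : Mesh) {x : ℝ} (hx : x ∈ Ioo (0 : ℝ) 1 \ range M.X) :
    ∃ j < M.N, x ∈ Ioo (M.X j) (M.X (j + 1)) := by
  obtain ⟨j, hj, hxj⟩ := M.exists_interval (Ioo_subset_Icc_self hx.1)
  exact ⟨j, hj, lt_of_le_of_ne hxj.1 fun h => hx.2 ⟨_, h⟩,
    lt_of_le_of_ne hxj.2 fun h => hx.2 ⟨_, h.symm⟩⟩

lemma hasDerivAt_of_eq_poly {p : Polynomial ℝ} {a b x : ℝ} (h : ∀ y ∈ Icc a b, φ y = p.eval y)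
    (hx : x ∈ Ioo a b) : HasDerivAt φ (p.derivative.eval x) x :=
  (p.hasDerivAt x).congr_of_eventuallyEq (by
    filter_upwards [Icc_mem_nhds hx.1 hx.2] with y hy using h y hy)

lemma Mesh.ae_open_interval (M : Mesh) {P : ℝ → Prop}
    (h : ∀ j < M.N, ∀ x ∈ Ioo (M.X j) (M.X (j + 1)), P x) :
    ∀ᵐ x ∂(volume.restrict (Ioc (0 : ℝ) 1)), P x :=
  ae_of_Ioo_diff_countable (countable_range M.X) fun x hx => by
    obtain ⟨j, hj, hxj⟩ := M.exists_open_interval hx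
    exact h j hj x hxj

lemma dx_eq_poly {p : Polynomial ℝ} {j : ℕ}
    (h : ∀ y ∈ Icc (M.X j) (M.X (j + 1)), φ y = p.eval y) {x : ℝ}
    (hx : x ∈ Ioo (M.X j) (M.X (j + 1))) : dx φ x = p.derivative.eval x := by
  rw [dx_eq_deriv ⟨(M.X_mem j).1.trans_lt hx.1, hx.2.trans_le (M.X_mem _).2⟩]
  exact (hasDerivAt_of_eq_poly h hx).deriv

/-- Off the nodes the function is locally a polynomial. Its derivative agrees almost everywhere with
a finite sum of truncated polynomials, hence is measurable and bounded. -/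
lemma Sh.pc1 (h : φ ∈ Sh M r k) : PC1 φ := by
  refine ⟨h.1.continuousOn, ⟨_, countable_range M.X, fun x hx => ?_⟩, ?_⟩
  · obtain ⟨j, hj, hxj⟩ := M.exists_open_interval hx
    obtain ⟨p, -, hp⟩ := Sh.poly h hj
    exact (hasDerivAt_of_eq_poly hp hxj).differentiableAt
  · have hp : ∀ i, ∃ p : Polynomial ℝ, i < M.N →
        ∀ x ∈ Icc (M.X i) (M.X (i + 1)), φ x = p.eval x := fun i => by
      by_cases hi : i < M.N
      · obtain ⟨p, -, hp⟩ := Sh.poly h hi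
        exact ⟨p, fun _ => hp⟩
      · exact ⟨0, fun h => absurd h hi⟩
    choose p hp using hp
    have hS : EssBdd (fun x => ∑ i ∈ Finset.range M.N,
        (Ioo (M.X i) (M.X (i + 1))).indicator (fun y => (p i).derivative.eval y) x) :=
      EssBdd.sum _ fun i _ => MemLp.indicator measurableSet_Ioo
        (essBdd_of_continuousOn (p i).derivative.continuous.continuousOn)
    refine hS.congr_ae (M.ae_open_interval fun j hj x hx => ?_)
    beta_reduce
    rw [dx_eq_poly (hp j hj) hx, Finset.sum_eq_single j, indicator_of_mem hx]
    · intro i _ hij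
      refine indicator_of_notMem (fun hxi => ?_) _
      rcases lt_or_gt_of_ne hij with h1 | h1
      · exact absurd (hx.1.trans hxi.2) (not_lt.2 (M.X_mono h1))
      · exact absurd (hxi.1.trans hx.2) (not_lt.2 (M.X_mono h1))
    · exact fun h => absurd (Finset.mem_range.2 hj) h

lemma Mesh.sum_integral (M : Mesh) {f : ℝ → ℝ} (hf : EssBdd f) :
    ∑ i ∈ Finset.range M.N, ∫ x in M.X i..M.X (i + 1), f x = ∫ x in (0 : ℝ)..1, f x := by
  rw [intervalIntegral.sum_integral_adjacent_intervals fun i _ =>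
    hf.intervalIntegrable_sub (M.X_mem i) (M.X_mem (i + 1)), M.X_zero, M.X_N]

lemma Mesh.integral_sub_le (M : Mesh) {f : ℝ → ℝ} (hf : EssBdd f) (h0 : ∀ x, 0 ≤ f x) {i : ℕ}
    (hi : i < M.N) : ∫ x in M.X i..M.X (i + 1), f x ≤ ∫ x in (0 : ℝ)..1, f x := by
  rw [← M.sum_integral hf]
  exact Finset.single_le_sum (f := fun i => ∫ x in M.X i..M.X (i + 1), f x)
    (fun j _ => intervalIntegral.integral_nonneg (M.X_mono (Nat.le_succ j)) fun x _ => h0 x)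
    (Finset.mem_range.2 hi)

lemma Mesh.Quasiuniform.le {ν : ℝ} (h : M.Quasiuniform ν) {i : ℕ} (hi : i < M.N) :
    M.h ≤ ν * (M.X (i + 1) - M.X i) := by
  rw [← M.length_eq ⟨i, hi⟩]; exact h _

lemma Mesh.Quasiuniform.pos {ν : ℝ} (h : M.Quasiuniform ν) : 0 < ν := by
  have h1 := h.le M.N_pos
  have h2 := M.X_lt M.N_pos
  by_contra hν
  have := mul_nonpos_of_nonpos_of_nonneg (not_lt.1 hν) (sub_pos.2 h2).le
  linarith [M.h_pos]

/-- The inverse inequality for the maximum norm. -/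
lemma exists_inverse_sup (r : ℕ) (ν : ℝ) : ∃ C, 0 ≤ C ∧ ∀ (M : Mesh) (k : ℕ), M.Quasiuniform ν →
    ∀ φ ∈ Sh M r k, ∀ x ∈ Icc (0 : ℝ) 1, φ x ^ 2 * M.h ≤ C * ip φ φ := by
  obtain ⟨C, hC, h⟩ := exists_polynomial_bound (r - 1)
  -- The sign of ν is unknown until a mesh is given; quasiuniformity then forces ν > 0.
  refine ⟨|ν| * C, by positivity, fun M k hν φ hφ x hx => ?_⟩
  obtain ⟨j, hj, hxj⟩ := M.exists_interval hx
  obtain ⟨p, hp, hpe⟩ := Sh.poly hφ hj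
  have hab := M.X_lt hj
  obtain ⟨h1, -⟩ := h p hp _ _ hab x hxj
  have h2 : ∫ y in M.X j..M.X (j + 1), p.eval y * p.eval y
      = ∫ y in M.X j..M.X (j + 1), φ y * φ y := by
    refine intervalIntegral.integral_congr fun y hy => ?_
    rw [uIcc_of_le hab.le] at hy
    simp only [hpe y hy]
  have hb := (Sh.pc1 hφ).essBdd
  have h3 := M.integral_sub_le (hb.mul hb) (fun x => mul_self_nonneg _) hj
  rw [h2, ← hpe x hxj] at h1
  have h4 := mul_le_mul_of_nonneg_left (hν.le hj) (sq_nonneg (φ x))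
  rw [abs_of_pos hν.pos]
  have h5 := mul_le_mul_of_nonneg_left (h1.trans (mul_le_mul_of_nonneg_left h3 hC)) hν.pos.le
  unfold ip
  nlinarith

/-- The inverse inequality for the derivative in `L²`. -/
lemma exists_inverse_deriv (r : ℕ) (ν : ℝ) : ∃ C, 0 ≤ C ∧ ∀ (M : Mesh) (k : ℕ),
    M.Quasiuniform ν → ∀ φ ∈ Sh M r k, l2norm (dx φ) * M.h ≤ C * l2norm φ := by
  obtain ⟨C, hC, h⟩ := exists_polynomial_bound (r - 1)
  refine ⟨|ν| * Real.sqrt C, by positivity, fun M k hν φ hφ => ?_⟩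
  have hb := (Sh.pc1 hφ).essBdd
  have hb' := (Sh.pc1 hφ).bdd
  have key : ip (dx φ) (dx φ) * M.h ^ 2 ≤ ν ^ 2 * C * ip φ φ := by
    have e1 : ip (dx φ) (dx φ) = _ := (M.sum_integral (hb'.mul hb')).symm
    have e2 : ip φ φ = _ := (M.sum_integral (hb.mul hb)).symm
    rw [e1, e2, Finset.sum_mul, Finset.mul_sum]
    refine Finset.sum_le_sum fun j hj => ?_
    have hj := Finset.mem_range.1 hj
    obtain ⟨p, hp, hpe⟩ := Sh.poly hφ hj
    have hab := M.X_lt hj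
    have hl : 0 < M.X (j + 1) - M.X j := sub_pos.2 hab
    have h2 : ∫ y in M.X j..M.X (j + 1), p.eval y * p.eval y
        = ∫ y in M.X j..M.X (j + 1), φ y * φ y := by
      refine intervalIntegral.integral_congr fun y hy => ?_
      rw [uIcc_of_le hab.le] at hy
      simp only [hpe y hy]
    set I := ∫ y in M.X j..M.X (j + 1), φ y * φ y with hI
    have I0 : 0 ≤ I := intervalIntegral.integral_nonneg hab.le fun x _ => mul_self_nonneg _
    have h3 : ∫ y in M.X j..M.X (j + 1), dx φ y * dx φ y
        = ∫ y in M.X j..M.X (j + 1), p.derivative.eval y * p.derivative.eval y :=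
      intervalIntegral.integral_congr_Ioo_of_le hab.le fun y hy => by
        simp only [dx_eq_poly hpe hy]
    have h4 : ∫ y in M.X j..M.X (j + 1), p.derivative.eval y * p.derivative.eval y
        ≤ ∫ y in M.X j..M.X (j + 1), C * I / (M.X (j + 1) - M.X j) ^ 3 := by
      refine intervalIntegral.integral_mono_on hab.le
        ((p.derivative.continuous.mul p.derivative.continuous).intervalIntegrable _ _)
        (by simp) fun y hy => ?_
      rw [le_div_iff₀ (by positivity), ← sq, ← h2]
      exact (h p hp _ _ hab y hy).2
    rw [intervalIntegral.integral_const, smul_eq_mul] at h4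
    have h5 : (M.X (j + 1) - M.X j) * (C * I / (M.X (j + 1) - M.X j) ^ 3)
        = C * I / (M.X (j + 1) - M.X j) ^ 2 := by field_simp
    rw [h5, le_div_iff₀ (by positivity)] at h4
    rw [h3]
    have h6 : M.h ^ 2 ≤ ν ^ 2 * (M.X (j + 1) - M.X j) ^ 2 := by
      rw [← mul_pow]
      exact pow_le_pow_left₀ M.h_pos.le (hν.le hj) 2
    have h7 : 0 ≤ ∫ y in M.X j..M.X (j + 1), p.derivative.eval y * p.derivative.eval y :=
      intervalIntegral.integral_nonneg hab.le fun x _ => mul_self_nonneg _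
    have h8 := mul_le_mul_of_nonneg_left h6 h7
    have h9 := mul_le_mul_of_nonneg_left h4 (sq_nonneg ν)
    nlinarith
  apply le_of_sq_le_sq _ (by have := l2norm_nonneg φ; positivity)
  rw [mul_pow, mul_pow, mul_pow, l2norm_sq, l2norm_sq, sq_abs, Real.sq_sqrt hC]
  exact key

/-- An element of `S_h` that is close to a Lipschitz function has a bounded derivative. -/
lemma exists_inverse_lip (r : ℕ) (ν : ℝ) : ∃ C, 0 ≤ C ∧ ∀ (M : Mesh) (k : ℕ),
    M.Quasiuniform ν → ∀ φ ∈ Sh M r k, ∀ (g : ℝ → ℝ) (K B : ℝ), 0 ≤ K → 0 ≤ B → Lip01 K g →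
      (∀ x ∈ Icc (0 : ℝ) 1, |g x - φ x| ≤ B) → l2norm (dx φ) * M.h ≤ C * (B + K * M.h) := by
  obtain ⟨C, hC, h⟩ := exists_polynomial_bound (r - 1)
  refine ⟨|ν| * Real.sqrt C, by positivity, fun M k hν φ hφ g K B hK hB hg hgφ => ?_⟩
  have hh := M.h_pos
  rw [← le_div_iff₀ hh]
  have hBK : 0 ≤ B + K * M.h := by positivity
  refine l2norm_le_of_ae_bound (by positivity) (M.ae_open_interval fun j hj x hx => ?_)
  obtain ⟨p, hp, hpe⟩ := Sh.poly hφ hj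
  rw [dx_eq_poly hpe hx, le_div_iff₀ hh]
  have hab := M.X_lt hj
  have hl : 0 < M.X (j + 1) - M.X j := sub_pos.2 hab
  -- Subtracting a constant keeps the derivative and leaves a polynomial of size at most B + K h on
  -- this interval.
  let q : Polynomial ℝ := p - Polynomial.C (g (M.X j))
  have hq : q.natDegree ≤ r - 1 := by simpa [q] using hp
  have hqd : q.derivative = p.derivative := by simp [q]
  obtain ⟨-, h1⟩ := h q hq _ _ hab x (Ioo_subset_Icc_self hx)
  have hqb : ∀ y ∈ Icc (M.X j) (M.X (j + 1)), |q.eval y| ≤ B + K * M.h := fun y hy => by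
    have hy1 : y ∈ Icc (0 : ℝ) 1 := ⟨(M.X_mem _).1.trans hy.1, hy.2.trans (M.X_mem _).2⟩
    have e : q.eval y = (g y - g (M.X j)) - (g y - φ y) := by
      simp [q, hpe y hy]
    rw [e]
    refine (abs_sub _ _).trans ?_
    have h2 := hgφ y hy1
    have h3 := hg y hy1 _ (M.X_mem j)
    rw [abs_of_nonneg (sub_nonneg.2 hy.1)] at h3
    have h4 : y - M.X j ≤ M.h := by linarith [hy.2, M.X_sub_le hj]
    have := mul_le_mul_of_nonneg_left h4 hK
    linarith
  have h2 : ∫ y in M.X j..M.X (j + 1), q.eval y * q.eval y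
      ≤ ∫ y in M.X j..M.X (j + 1), (B + K * M.h) ^ 2 := by
    refine intervalIntegral.integral_mono_on hab.le
      ((q.continuous.mul q.continuous).intervalIntegrable _ _) (by simp) fun y hy => ?_
    rw [← sq, ← sq_abs]
    exact pow_le_pow_left₀ (abs_nonneg _) (hqb y hy) 2
  rw [intervalIntegral.integral_const, smul_eq_mul] at h2
  rw [hqd] at h1
  have h3 : p.derivative.eval x ^ 2 * (M.X (j + 1) - M.X j) ^ 2 ≤ C * (B + K * M.h) ^ 2 := by
    have := h1.trans (mul_le_mul_of_nonneg_left h2 hC)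
    refine le_of_mul_le_mul_right ?_ hl
    nlinarith
  apply le_of_sq_le_sq _ (by positivity)
  rw [mul_pow, mul_pow, mul_pow, sq_abs, sq_abs, Real.sq_sqrt hC]
  have h6 : M.h ^ 2 ≤ ν ^ 2 * (M.X (j + 1) - M.X j) ^ 2 := by
    rw [← mul_pow]
    exact pow_le_pow_left₀ hh.le (hν.le hj) 2
  have h8 := mul_le_mul_of_nonneg_left h6 (sq_nonneg (p.derivative.eval x))
  have h9 := mul_le_mul_of_nonneg_left h3 (sq_nonneg ν)
  nlinarith

end Sh

/-! ### Finite element spaces and orthonormal bases -/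

/-- Linear spaces of piecewise `C¹` functions on `[0,1]`. -/
structure IsFESpace (S : Set (ℝ → ℝ)) : Prop where
  zero : (fun _ => 0) ∈ S
  add : ∀ f ∈ S, ∀ g ∈ S, (fun x => f x + g x) ∈ S
  smul : ∀ (c : ℝ), ∀ f ∈ S, (fun x => c * f x) ∈ S
  congr : ∀ f ∈ S, ∀ g : ℝ → ℝ, (∀ x ∈ Icc (0 : ℝ) 1, f x = g x) → g ∈ S
  pc1 : ∀ f ∈ S, PC1 f

/-- Inner products on piecewise `C¹` functions. -/
structure IsForm (B : (ℝ → ℝ) → (ℝ → ℝ) → ℝ) : Prop where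
  symm : ∀ f g, B f g = B g f
  add : ∀ f g h, PC1 f → PC1 g → PC1 h → B (fun x => f x + g x) h = B f h + B g h
  smul : ∀ (c : ℝ) f g, PC1 f → PC1 g → B (fun x => c * f x) g = c * B f g
  congr : ∀ f f' g g', (∀ x ∈ Icc (0 : ℝ) 1, f x = f' x) → (∀ x ∈ Icc (0 : ℝ) 1, g x = g' x) →
    B f g = B f' g'
  nonneg : ∀ f, PC1 f → 0 ≤ B f f
  definite : ∀ f, PC1 f → B f f = 0 → ∀ x ∈ Icc (0 : ℝ) 1, f x = 0

/-- An orthonormal basis of `S` whose coefficient functionals are combinations of the values at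
the points `P`. -/
structure IsOrthoBasis (S : Set (ℝ → ℝ)) (B : (ℝ → ℝ) → (ℝ → ℝ) → ℝ) {κ : Type} [Fintype κ]
    (P : κ → ℝ) {n : ℕ} (φ : Fin n → ℝ → ℝ) (a : Fin n → κ → ℝ) : Prop where
  mem : ∀ i, φ i ∈ S
  ortho : ∀ i j, B (φ i) (φ j) = if i = j then 1 else 0
  coef : ∀ v ∈ S, ∀ i, B v (φ i) = ∑ k, a i k * v (P k)
  repr : ∀ v ∈ S, ∀ x ∈ Icc (0 : ℝ) 1, v x = ∑ i, B v (φ i) * φ i x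

section Basis
variable {S : Set (ℝ → ℝ)} {B : (ℝ → ℝ) → (ℝ → ℝ) → ℝ} {κ : Type} [Fintype κ] {P : κ → ℝ}

lemma IsFESpace.sum (hS : IsFESpace S) {ι : Type*} (s : Finset ι) {F : ι → ℝ → ℝ}
    (h : ∀ i ∈ s, F i ∈ S) : (fun x => ∑ i ∈ s, F i x) ∈ S := by
  classical
  induction s using Finset.induction_on with
  | empty => simpa using hS.zero
  | insert a s ha ih =>
    simp only [Finset.sum_insert ha]
    exact hS.add _ (h a (Finset.mem_insert_self _ _)) _
      (ih fun i hi => h i (Finset.mem_insert_of_mem hi))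

lemma IsFESpace.sub (hS : IsFESpace S) {f g : ℝ → ℝ} (hf : f ∈ S) (hg : g ∈ S) :
    (fun x => f x - g x) ∈ S := by
  simpa [sub_eq_add_neg] using hS.add _ hf _ (hS.smul (-1) _ hg)

/-- The linear combination of the functions `φ i` with coefficients `c i`. -/
def comb {n : ℕ} (φ : Fin n → ℝ → ℝ) (c : Fin n → ℝ) (x : ℝ) : ℝ := ∑ i, c i * φ i x

lemma IsFESpace.comb_mem (hS : IsFESpace S) {n : ℕ} {φ : Fin n → ℝ → ℝ} (h : ∀ i, φ i ∈ S)
    (c : Fin n → ℝ) : comb φ c ∈ S := hS.sum _ fun i _ => hS.smul (c i) _ (h i)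

lemma IsForm.sum_left (hB : IsForm B) {ι : Type*} (s : Finset ι) {F : ι → ℝ → ℝ} {g : ℝ → ℝ}
    (h : ∀ i ∈ s, PC1 (F i)) (hg : PC1 g) (c : ι → ℝ) :
    B (fun x => ∑ i ∈ s, c i * F i x) g = ∑ i ∈ s, c i * B (F i) g := by
  classical
  induction s using Finset.induction_on with
  | empty =>
    have := hB.smul 0 _ g (PC1.const 0) hg
    simpa using this
  | insert a s ha ih =>
    simp only [Finset.sum_insert ha]
    have h' : ∀ i ∈ s, PC1 (F i) := fun i hi => h i (Finset.mem_insert_of_mem hi)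
    have ha' := h a (Finset.mem_insert_self _ _)
    rw [hB.add _ _ _ (ha'.const_mul _) (PC1.sum s fun i hi => (h' i hi).const_mul _) hg, ih h',
      hB.smul _ _ _ ha' hg]

lemma IsForm.comb_left (hB : IsForm B) {n : ℕ} {φ : Fin n → ℝ → ℝ} {g : ℝ → ℝ}
    (h : ∀ i, PC1 (φ i)) (hg : PC1 g) (c : Fin n → ℝ) :
    B (comb φ c) g = ∑ i, c i * B (φ i) g := hB.sum_left _ (fun i _ => h i) hg c

lemma IsForm.comb_right (hB : IsForm B) {n : ℕ} {φ : Fin n → ℝ → ℝ} {g : ℝ → ℝ}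
    (h : ∀ i, PC1 (φ i)) (hg : PC1 g) (c : Fin n → ℝ) :
    B g (comb φ c) = ∑ i, c i * B g (φ i) := by
  rw [hB.symm, hB.comb_left h hg]
  simp only [hB.symm g]

lemma IsForm.sub_left (hB : IsForm B) {f g h : ℝ → ℝ} (hf : PC1 f) (hg : PC1 g) (hh : PC1 h) :
    B (fun x => f x - g x) h = B f h - B g h := by
  have h1 := hB.add f (fun x => (-1) * g x) h hf (hg.const_mul _) hh
  rw [hB.smul _ _ _ hg hh] at h1
  simpa [sub_eq_add_neg] using h1

/-- Evaluation at the points P is injective on S up to values off [0,1], so S is finite dimensional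
and has an orthonormal basis. The coefficient functionals then factor through the point values. This
later turns pointwise differentiability in time into differentiability of the coefficients. -/
theorem exists_orthoBasis (hS : IsFESpace S) (hB : IsForm B) (hP : ∀ k, P k ∈ Icc (0 : ℝ) 1)
    (hinj : ∀ v ∈ S, (∀ k, v (P k) = 0) → ∀ x ∈ Icc (0 : ℝ) 1, v x = 0) :
    ∃ (n : ℕ) (φ : Fin n → ℝ → ℝ) (a : Fin n → κ → ℝ), IsOrthoBasis S B P φ a := by
  classical
  -- Functions are normalised to vanish off [0,1]; without this B would not be definite.
  let V : Submodule ℝ (ℝ → ℝ) :=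
    { carrier := {f | f ∈ S ∧ ∀ x, x ∉ Icc (0 : ℝ) 1 → f x = 0}
      add_mem' := fun {f g} hf hg => ⟨hS.add f hf.1 g hg.1, fun x hx => by
        simp [hf.2 x hx, hg.2 x hx]⟩
      zero_mem' := ⟨hS.zero, fun _ _ => rfl⟩
      smul_mem' := fun c f hf => ⟨hS.smul c f hf.1, fun x hx => by simp [hf.2 x hx]⟩ }
  let E : V →ₗ[ℝ] (κ → ℝ) :=
    { toFun := fun v k => (v : ℝ → ℝ) (P k)
      map_add' := fun _ _ => rfl
      map_smul' := fun _ _ => rfl }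
  have hE : LinearMap.ker E = ⊥ := by
    rw [LinearMap.ker_eq_bot']
    intro v hv
    ext x
    by_cases hx : x ∈ Icc (0 : ℝ) 1
    · exact hinj v v.2.1 (fun k => congrFun hv k) x hx
    · exact v.2.2 x hx
  have : FiniteDimensional ℝ V := FiniteDimensional.of_injective E (LinearMap.ker_eq_bot.1 hE)
  have hpc : ∀ v : V, PC1 (v : ℝ → ℝ) := fun v => hS.pc1 _ v.2.1
  let core : InnerProductSpace.Core ℝ V :=
    { inner := fun v w => B v w
      conj_inner_symm := fun v w => hB.symm _ _
      re_inner_nonneg := fun v => hB.nonneg _ (hpc v)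
      add_left := fun u v w => hB.add _ _ _ (hpc u) (hpc v) (hpc w)
      smul_left := fun u v c => hB.smul c _ _ (hpc u) (hpc v)
      definite := fun v hv => by
        ext x
        by_cases hx : x ∈ Icc (0 : ℝ) 1
        · exact hB.definite _ (hpc v) hv x hx
        · exact v.2.2 x hx }
  let _ : NormedAddCommGroup V := core.toNormedAddCommGroup
  let _ : InnerProductSpace ℝ V := InnerProductSpace.ofCore core.toCore
  have : FiniteDimensional ℝ V := FiniteDimensional.of_injective E (LinearMap.ker_eq_bot.1 hE)
  let b := stdOrthonormalBasis ℝ V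
  have hinner : ∀ v w : V, inner ℝ v w = B v w := fun _ _ => rfl
  -- A left inverse g of evaluation recovers a function from its point values. The weights `a i k`
  -- are the coefficients of the images under g of the unit vectors.
  obtain ⟨g, hg⟩ := E.exists_leftInverse_of_injective hE
  let ℓ : Fin (Module.finrank ℝ V) → V →ₗ[ℝ] ℝ := fun i =>
    { toFun := fun v => B v (b i : ℝ → ℝ)
      map_add' := fun v w => hB.add _ _ _ (hpc v) (hpc w) (hpc _)
      map_smul' := fun c v => hB.smul c _ _ (hpc v) (hpc _) }
  have hrep : ∀ v ∈ S, ∃ w : V, ∀ x ∈ Icc (0 : ℝ) 1, v x = (w : ℝ → ℝ) x := fun v hv => by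
    have hc : ∀ x ∈ Icc (0 : ℝ) 1, v x = (Icc (0 : ℝ) 1).indicator v x := fun x hx =>
      (indicator_of_mem hx _).symm
    exact ⟨⟨_, hS.congr v hv _ hc, fun x hx => indicator_of_notMem hx _⟩, hc⟩
  refine ⟨_, fun i => (b i : ℝ → ℝ), fun i k => (ℓ i ∘ₗ g) (Pi.single k 1), fun i => (b i).2.1,
    fun i j => ?_, fun v hv i => ?_, fun v hv x hx => ?_⟩
  · rw [← hinner]
    exact orthonormal_iff_ite.1 b.orthonormal i j
  · obtain ⟨w, hw⟩ := hrep v hv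
    have h1 : B v (b i : ℝ → ℝ) = ℓ i w := hB.congr _ _ _ _ hw fun _ _ => rfl
    have h2 : g (E w) = w := LinearMap.congr_fun hg w
    have h3 : (ℓ i ∘ₗ g) (E w) = ℓ i w := by rw [LinearMap.comp_apply, h2]
    rw [h1, ← h3, LinearMap.pi_apply_eq_sum_univ]
    refine Finset.sum_congr rfl fun k _ => ?_
    rw [hw _ (hP k), smul_eq_mul, mul_comm]
    congr 2
    funext j
    simp [Pi.single_apply, eq_comm]
  · obtain ⟨w, hw⟩ := hrep v hv
    have h1 := congrArg (fun z : V => (z : ℝ → ℝ) x) (b.sum_repr' w)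
    rw [hw x hx]
    rw [← h1]
    simp only [Submodule.coe_sum, Submodule.coe_smul, Finset.sum_apply, Pi.smul_apply, smul_eq_mul]
    refine Finset.sum_congr rfl fun i _ => ?_
    congr 1
    rw [hinner, hB.symm]
    exact (hB.congr _ _ _ _ hw fun _ _ => rfl).symm

variable {n : ℕ} {φ : Fin n → ℝ → ℝ} {a : Fin n → κ → ℝ}

lemma IsOrthoBasis.comb_coef (h : IsOrthoBasis S B P φ a) (hS : IsFESpace S) (hB : IsForm B)
    (c : Fin n → ℝ) (i : Fin n) : B (comb φ c) (φ i) = c i := by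
  rw [hB.comb_left (fun i => hS.pc1 _ (h.mem i)) (hS.pc1 _ (h.mem i))]
  simp [h.ortho]

lemma IsOrthoBasis.comb_self (h : IsOrthoBasis S B P φ a) (hS : IsFESpace S) (hB : IsForm B)
    (c : Fin n → ℝ) : B (comb φ c) (comb φ c) = ∑ i, c i ^ 2 := by
  rw [hB.comb_right (fun i => hS.pc1 _ (h.mem i)) (hS.pc1 _ (hS.comb_mem h.mem c))]
  simp only [h.comb_coef hS hB, sq]

/-- The orthogonal projection onto the span of `φ`. -/
def proj (B : (ℝ → ℝ) → (ℝ → ℝ) → ℝ) (φ : Fin n → ℝ → ℝ) (v : ℝ → ℝ) : ℝ → ℝ :=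
  comb φ fun i => B v (φ i)

lemma IsOrthoBasis.proj_mem (h : IsOrthoBasis S B P φ a) (hS : IsFESpace S) (v : ℝ → ℝ) :
    proj B φ v ∈ S := hS.comb_mem h.mem _

lemma IsOrthoBasis.form_proj (h : IsOrthoBasis S B P φ a) (hS : IsFESpace S) (hB : IsForm B)
    {v w : ℝ → ℝ} (hv : PC1 v) (hw : w ∈ S) : B (proj B φ v) w = B v w := by
  have hp : ∀ i, PC1 (φ i) := fun i => hS.pc1 _ (h.mem i)
  have hw' : ∀ g, B g w = B g (comb φ fun i => B w (φ i)) := fun g =>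
    hB.congr _ _ _ _ (fun _ _ => rfl) (h.repr w hw)
  rw [hw', hw' v, hB.comb_right hp hv, hB.comb_right hp (hS.pc1 _ (h.proj_mem hS v))]
  refine Finset.sum_congr rfl fun i _ => ?_
  rw [proj, h.comb_coef hS hB]

/-- The projection is the best approximation. -/
lemma IsOrthoBasis.proj_best (h : IsOrthoBasis S B P φ a) (hS : IsFESpace S) (hB : IsForm B)
    {v χ : ℝ → ℝ} (hv : PC1 v) (hχ : χ ∈ S) :
    B (fun x => v x - proj B φ v x) (fun x => v x - proj B φ v x)
      ≤ B (fun x => v x - χ x) (fun x => v x - χ x) := by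
  have hpm := h.proj_mem hS v
  have hp := hS.pc1 _ hpm
  set p := proj B φ v with hpd
  have hq := hS.sub hpm hχ
  have hq1 := hS.pc1 _ hq
  have hσ := hv.sub hp
  have e : ∀ x ∈ Icc (0 : ℝ) 1, v x - χ x = (v x - p x) + (p x - χ x) := fun x _ => by ring
  -- Galerkin orthogonality; the inequality is then Pythagoras' theorem.
  have h0 : B (fun x => v x - p x) (fun x => p x - χ x) = 0 := by
    rw [hB.sub_left hv hp hq1, hpd, h.form_proj hS hB hv hq, sub_self]
  have h1 : B (fun x => v x - p x) (fun x => (v x - p x) + (p x - χ x))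
      = B (fun x => v x - p x) (fun x => v x - p x) := by
    rw [hB.symm, hB.add _ _ _ hσ hq1 hσ, hB.symm (fun x => p x - χ x), h0, add_zero]
  have h2 : B (fun x => p x - χ x) (fun x => (v x - p x) + (p x - χ x))
      = B (fun x => p x - χ x) (fun x => p x - χ x) := by
    rw [hB.symm, hB.add _ _ _ hσ hq1 hq1, h0, zero_add]
  rw [hB.congr _ _ _ _ e e, hB.add _ _ _ hσ hq1 (hσ.add hq1), h1, h2]
  have := hB.nonneg _ hq1
  linarith

end Basis

/-! ### The two inner products -/

lemma isForm_ip : IsForm ip where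
  symm := ip_comm
  add _ _ _ hf hg hh := ip_add_left hf.essBdd hg.essBdd hh.essBdd
  smul c f g _ _ := ip_const_mul_left c f g
  congr _ _ _ _ := ip_congr
  nonneg f _ := ip_self_nonneg f
  definite _ hf := eq_zero_of_ip_self hf.cont

/-- The assumptions on the bottom topography. -/
structure IsBottom (μ c₁ c₂ : ℝ) (η : ℝ → ℝ) : Prop where
  mu_pos : 0 < μ
  c1_pos : 0 < c₁
  c2_pos : 0 < c₂
  smooth : ContDiffOn ℝ 2 η (Icc 0 1)
  lower : ∀ x ∈ Icc (0 : ℝ) 1, c₁ ≤ η x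
  mass_lower : ∀ x ∈ Icc (0 : ℝ) 1, c₂ ≤ massCoeff μ η x

section Bottom
variable {μ c₁ c₂ : ℝ} {η v w : ℝ → ℝ}

lemma IsBottom.dx_smooth (h : IsBottom μ c₁ c₂ η) : ContDiffOn ℝ 1 (dx η) (Icc 0 1) :=
  h.smooth.derivWithin (uniqueDiffOn_Icc zero_lt_one) (by norm_num)

lemma IsBottom.pc1 (h : IsBottom μ c₁ c₂ η) : PC1 η :=
  pc1_of_contDiffOn (h.smooth.of_le (by norm_num))

lemma IsBottom.cont (h : IsBottom μ c₁ c₂ η) : ContinuousOn η (Icc 0 1) := h.pc1.cont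

lemma IsBottom.cont_mass (h : IsBottom μ c₁ c₂ η) : ContinuousOn (massCoeff μ η) (Icc 0 1) :=
  h.cont.sub ((continuousOn_const.mul (h.cont.pow 2)).mul (continuousOn_dx h.dx_smooth))

lemma IsBottom.essBdd_mass (h : IsBottom μ c₁ c₂ η) : EssBdd (massCoeff μ η) :=
  essBdd_of_continuousOn h.cont_mass

lemma IsBottom.essBdd_cube (h : IsBottom μ c₁ c₂ η) : EssBdd (fun x => η x ^ 3) :=
  essBdd_of_continuousOn (h.cont.pow 3)

lemma A_symm (μ : ℝ) (η v w : ℝ → ℝ) : A μ η v w = A μ η w v := by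
  unfold A ip
  congr 1
  · congr 1; funext x; ring
  · congr 2; funext x; ring

lemma A_congr (μ : ℝ) (η : ℝ → ℝ) {v v' w w' : ℝ → ℝ} (h : ∀ x ∈ Icc (0 : ℝ) 1, v x = v' x)
    (h' : ∀ x ∈ Icc (0 : ℝ) 1, w x = w' x) : A μ η v w = A μ η v' w' := by
  unfold A
  rw [ip_congr (f' := fun x => massCoeff μ η x * v' x) (fun x hx => by rw [h x hx]) h',
    ip_congr (f' := fun x => η x ^ 3 * dx v' x) (fun x hx => by rw [dx_congr h x hx]) (dx_congr h')]

lemma IsBottom.A_self_ge (h : IsBottom μ c₁ c₂ η) (hv : PC1 v) :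
    c₂ * ip v v + μ / 3 * (c₁ ^ 3 * ip (dx v) (dx v)) ≤ A μ η v v := by
  unfold A
  have key : ∀ {m g : ℝ → ℝ} {c : ℝ}, EssBdd m → EssBdd g → (∀ x ∈ Icc (0 : ℝ) 1, c ≤ m x) →
      c * ip g g ≤ ip (fun x => m x * g x) g := by
    intro m g c hm hg hc
    rw [← ip_const_mul_left]
    refine intervalIntegral.integral_mono_on zero_le_one ((hg.const_mul c).mul hg).intervalIntegrable
      ((hm.mul hg).mul hg).intervalIntegrable fun x hx => ?_
    rw [mul_assoc, mul_assoc]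
    exact mul_le_mul_of_nonneg_right (hc x hx) (mul_self_nonneg _)
  have h1 := key h.essBdd_mass hv.essBdd h.mass_lower
  have h2 := key h.essBdd_cube hv.bdd (c := c₁ ^ 3)
    fun x hx => pow_le_pow_left₀ h.c1_pos.le (h.lower x hx) 3
  have h3 := mul_le_mul_of_nonneg_left h2 (show 0 ≤ μ / 3 by linarith [h.mu_pos])
  linarith

lemma IsBottom.isForm (h : IsBottom μ c₁ c₂ η) : IsForm (A μ η) where
  symm := A_symm μ η
  add f g w hf hg hw := by
    unfold A
    have e1 : ip (fun x => massCoeff μ η x * (f x + g x)) w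
        = ip (fun x => massCoeff μ η x * f x) w + ip (fun x => massCoeff μ η x * g x) w := by
      simp only [mul_add]
      exact ip_add_left (h.essBdd_mass.mul hf.essBdd) (h.essBdd_mass.mul hg.essBdd) hw.essBdd
    have e2 : ip (fun x => η x ^ 3 * dx (fun x => f x + g x) x) (dx w)
        = ip (fun x => η x ^ 3 * dx f x) (dx w) + ip (fun x => η x ^ 3 * dx g x) (dx w) := by
      rw [← ip_add_left (h.essBdd_cube.mul hf.bdd) (h.essBdd_cube.mul hg.bdd) hw.bdd]
      refine ip_congr_ae ?_ (Filter.EventuallyEq.refl _ _)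
      filter_upwards [hf.dx_add_ae hg] with x hx
      rw [hx, mul_add]
    rw [e1, e2]
    ring
  smul c f w hf hw := by
    unfold A
    have e1 : ip (fun x => massCoeff μ η x * (c * f x)) w
        = c * ip (fun x => massCoeff μ η x * f x) w := by
      rw [← ip_const_mul_left]
      simp only [mul_left_comm]
    have e2 : ip (fun x => η x ^ 3 * dx (fun x => c * f x) x) (dx w)
        = c * ip (fun x => η x ^ 3 * dx f x) (dx w) := by
      rw [← ip_const_mul_left]
      refine ip_congr_ae ?_ (Filter.EventuallyEq.refl _ _)
      filter_upwards [hf.dx_const_mul_ae c] with x hx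
      rw [hx, mul_left_comm]
    rw [e1, e2]
    ring
  congr _ _ _ _ := A_congr μ η
  nonneg f hf := by
    refine le_trans ?_ (h.A_self_ge hf)
    have := h.mu_pos
    have := h.c1_pos
    have := h.c2_pos
    have := ip_self_nonneg f
    have := ip_self_nonneg (dx f)
    positivity
  definite f hf h0 := by
    refine eq_zero_of_ip_self hf.cont (le_antisymm ?_ (ip_self_nonneg f))
    have h1 := h.A_self_ge hf
    have h2 : 0 ≤ μ / 3 * (c₁ ^ 3 * ip (dx f) (dx f)) := by
      have := h.mu_pos
      have := h.c1_pos
      have := ip_self_nonneg (dx f)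
      positivity
    by_contra hlt
    have := mul_pos h.c2_pos (not_le.1 hlt)
    linarith

/-- Coercivity with respect to the derivative. -/
lemma IsBottom.coercive (h : IsBottom μ c₁ c₂ η) (hv : PC1 v) :
    μ / 3 * c₁ ^ 3 * l2norm (dx v) ^ 2 ≤ A μ η v v := by
  have h1 := h.A_self_ge hv
  have := mul_nonneg h.c2_pos.le (ip_self_nonneg v)
  rw [l2norm_sq]
  linarith

/-- As v vanishes at 0, ‖v‖ ≤ ‖v'‖, so the derivative alone dominates A. Together with `coercive`
this makes A(v, v) equivalent to ‖v'‖² for such v. -/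
lemma IsBottom.exists_A_self_le (h : IsBottom μ c₁ c₂ η) : ∃ C, 0 ≤ C ∧ ∀ v, PC1 v → v 0 = 0 →
    A μ η v v ≤ C * l2norm (dx v) ^ 2 := by
  obtain ⟨K₁, hK₁, b₁⟩ := exists_bound h.cont_mass
  obtain ⟨K₂, hK₂, b₂⟩ := exists_bound (h.cont.pow 3)
  have hμ := h.mu_pos
  refine ⟨K₁ + μ / 3 * K₂, by positivity, fun v hv h0 => ?_⟩
  have h1 := abs_ip_le (h.essBdd_mass.mul hv.essBdd) hv.essBdd
  have h2 := abs_ip_le (h.essBdd_cube.mul hv.bdd) hv.bdd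
  have h3 := l2norm_mul_le hK₁ hv.essBdd b₁
  have h4 := l2norm_mul_le hK₂ hv.bdd b₂
  have h5 := hv.l2norm_le_of_zero h0
  have n0 := l2norm_nonneg v
  have n1 := l2norm_nonneg (dx v)
  have h6 : ip (fun x => massCoeff μ η x * v x) v ≤ K₁ * l2norm (dx v) ^ 2 := by
    refine (le_abs_self _).trans (h1.trans ?_)
    calc _ ≤ (K₁ * l2norm v) * l2norm v := mul_le_mul_of_nonneg_right h3 n0
      _ = K₁ * l2norm v ^ 2 := by ring
      _ ≤ _ := mul_le_mul_of_nonneg_left (pow_le_pow_left₀ n0 h5 2) hK₁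
  have h7 : ip (fun x => η x ^ 3 * dx v x) (dx v) ≤ K₂ * l2norm (dx v) ^ 2 := by
    refine (le_abs_self _).trans (h2.trans ?_)
    calc _ ≤ (K₂ * l2norm (dx v)) * l2norm (dx v) := mul_le_mul_of_nonneg_right h4 n1
      _ = _ := by ring
  unfold A
  have h8 := mul_le_mul_of_nonneg_left h7 (show 0 ≤ μ / 3 by positivity)
  linarith

end Bottom

/-! ### Finite element spaces, point values that determine their elements, and orthonormal bases. -/

section Spaces
variable (M : Mesh) (r k : ℕ)

lemma isFESpace_Sh : IsFESpace (Sh M r k) :=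
  ⟨Sh.zero, fun _ hf _ hg => Sh.add hf hg, fun c _ hf => Sh.const_mul c hf,
    fun _ hf _ e => Sh.congr hf e, fun _ hf => Sh.pc1 hf⟩

lemma isFESpace_Sh0 : IsFESpace (Sh0 M r k) :=
  ⟨Sh0.zero, fun _ hf _ hg => Sh0.add hf hg, fun c _ hf => Sh0.const_mul c hf,
    fun _ hf _ e => Sh0.congr hf e, fun _ hf => Sh.pc1 hf.1⟩

/-- The points at which elements of `S_h` are evaluated: `r` points in each mesh interval. -/
noncomputable def Mesh.pt (q : Fin M.N × Fin r) : ℝ :=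
  M.X q.1 + (M.X (q.1 + 1) - M.X q.1) * (q.2 / r)

lemma Mesh.pt_mem_interval (q : Fin M.N × Fin r) :
    M.pt r q ∈ Icc (M.X q.1) (M.X (q.1 + 1)) := by
  have h1 : 0 < M.X (q.1 + 1) - M.X q.1 := sub_pos.2 (M.X_lt q.1.2)
  have hr : (0 : ℝ) < r := by exact_mod_cast (Nat.zero_le _).trans_lt q.2.2
  have h2 : (0 : ℝ) ≤ (q.2 : ℝ) / r := by positivity
  have h3 : (q.2 : ℝ) / r ≤ 1 := (div_le_one hr).2 (by exact_mod_cast q.2.2.le)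
  constructor
  · have := mul_nonneg h1.le h2
    simp only [pt]
    linarith
  · have := mul_le_mul_of_nonneg_left h3 h1.le
    simp only [pt]
    linarith

lemma Mesh.pt_mem (q : Fin M.N × Fin r) : M.pt r q ∈ Icc (0 : ℝ) 1 := by
  have h := M.pt_mem_interval r q
  exact ⟨(M.X_mem _).1.trans h.1, h.2.trans (M.X_mem _).2⟩

variable {M r k}

/-- On each interval a polynomial of degree less than r has r distinct zeros. -/
lemma Sh.eq_zero_of_pt (hr : 0 < r) {v : ℝ → ℝ} (hv : v ∈ Sh M r k) (h : ∀ q, v (M.pt r q) = 0) :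
    ∀ x ∈ Icc (0 : ℝ) 1, v x = 0 := by
  intro x hx
  obtain ⟨j, hj, hxj⟩ := M.exists_interval hx
  obtain ⟨p, hp, hpe⟩ := Sh.poly hv hj
  have hl : 0 < M.X (j + 1) - M.X j := sub_pos.2 (M.X_lt hj)
  have hr' : (0 : ℝ) < r := by exact_mod_cast hr
  have : p = 0 := by
    refine Polynomial.eq_zero_of_natDegree_lt_card_of_eval_eq_zero p
      (f := fun i : Fin r => M.pt r (⟨j, hj⟩, i)) (fun i i' hii => ?_) (fun i => ?_) ?_
    · simp only [Mesh.pt] at hii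
      have h1 := mul_left_cancel₀ hl.ne' (add_left_cancel hii)
      have h2 := (div_left_inj' hr'.ne').1 h1
      exact Fin.ext (by exact_mod_cast h2)
    · rw [← hpe _ (M.pt_mem_interval r (⟨j, hj⟩, i)), h]
    · rw [Fintype.card_fin]; omega
  rw [hpe x hxj, this, Polynomial.eval_zero]

theorem exists_basis_Sh (M : Mesh) (k : ℕ) (hr : 0 < r) :
    ∃ (n : ℕ) (φ : Fin n → ℝ → ℝ) (a : Fin n → Fin M.N × Fin r → ℝ),
      IsOrthoBasis (Sh M r k) ip (M.pt r) φ a :=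
  exists_orthoBasis (isFESpace_Sh M r k) isForm_ip (M.pt_mem r) fun _ hv h =>
    Sh.eq_zero_of_pt hr hv h

theorem exists_basis_Sh0 {μ c₁ c₂ : ℝ} {η : ℝ → ℝ} (h : IsBottom μ c₁ c₂ η) (M : Mesh) (k : ℕ)
    (hr : 0 < r) : ∃ (n : ℕ) (φ : Fin n → ℝ → ℝ) (a : Fin n → Fin M.N × Fin r → ℝ),
      IsOrthoBasis (Sh0 M r k) (A μ η) (M.pt r) φ a :=
  exists_orthoBasis (isFESpace_Sh0 M r k) h.isForm (M.pt_mem r) fun _ hv h =>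
    Sh.eq_zero_of_pt hr hv.1 h

end Spaces

/-! ### Errors of the projections -/

section Projection

lemma Lip01.l2norm_dx_le {K : ℝ} (hK : 0 ≤ K) {f : ℝ → ℝ} (hf : Lip01 K f) : l2norm (dx f) ≤ K :=
  l2norm_le_of_bound fun _ hx => hf.abs_dx_le hK hx

lemma PC1.l2norm_dx_add_le {f g : ℝ → ℝ} (hf : PC1 f) (hg : PC1 g) :
    l2norm (dx (fun x => f x + g x)) ≤ l2norm (dx f) + l2norm (dx g) := by
  rw [l2norm_congr_ae (hf.dx_add_ae hg)]
  exact l2norm_add_le hf.bdd hg.bdd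

lemma PC1.l2norm_dx_sub_le {f g : ℝ → ℝ} (hf : PC1 f) (hg : PC1 g) :
    l2norm (dx (fun x => f x - g x)) ≤ l2norm (dx f) + l2norm (dx g) := by
  rw [l2norm_congr_ae (hf.dx_sub_ae hg)]
  exact l2norm_sub_le hf.bdd hg.bdd

/-- The derivative of f - Pf is split along (f - F) - G + (F + G - Pf). The first part is small by
construction, G has a small derivative because it is close to the Lipschitz function f - F, and the
last part lies in S_h and is O(h^r) in L², so the inverse inequality costs one power of h. -/
theorem exists_l2Projection_error {r : ℕ} (hr : 2 ≤ r) (ν : ℝ) : ∃ C, 0 ≤ C ∧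
    ∀ (M : Mesh) (k : ℕ), M.Quasiuniform ν → k ≤ r - 2 →
    ∀ (f : ℝ → ℝ) (K : ℝ), 0 ≤ K → ContDiffOn ℝ r f (Icc 0 1) →
    (∀ x ∈ Icc (0 : ℝ) 1, |iteratedDerivWithin r f (Icc 0 1) x| ≤ K) →
    ∀ {κ : Type} [Fintype κ] {P : κ → ℝ} {n : ℕ} {φ : Fin n → ℝ → ℝ} {a : Fin n → κ → ℝ},
      IsOrthoBasis (Sh M r k) ip P φ a →
      l2norm (fun x => f x - proj ip φ f x) ≤ C * K * M.h ^ (r - 1) ∧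
      l2norm (dx (fun x => f x - proj ip φ f x)) ≤ C * K * M.h ^ (r - 1) := by
  obtain ⟨d, rfl⟩ : ∃ d, r = d + 2 := ⟨r - 2, by omega⟩
  obtain ⟨C₁, hC₁, h₁⟩ := exists_spline_approx_pair d
  obtain ⟨C₂, hC₂, h₂⟩ := exists_inverse_deriv (d + 2) ν
  obtain ⟨C₃, hC₃, h₃⟩ := exists_inverse_lip (d + 2) ν
  refine ⟨C₁ * (1 + 2 * C₃ + 2 * C₂), by positivity,
    fun M k hν hk f K hK hf hb κ _ P n φ a hφ => ?_⟩
  have hh := M.h_pos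
  obtain ⟨F, hF, G, hG, -, hL, hA⟩ := h₁ M f K hK hf hb
  simp only [Nat.add_sub_cancel, show d + 2 - 1 = d + 1 from rfl] at hk ⊢
  have hFS : F ∈ Sh M (d + 2) k := Spl.subset_Sh hk hF
  have hGS : G ∈ Sh M (d + 2) k := Spl.subset_Sh hk hG
  have hS := isFESpace_Sh M (d + 2) k
  have Pf : PC1 f := pc1_of_contDiffOn (hf.of_le (by norm_cast; omega))
  have hpm := hφ.proj_mem hS f
  have hFG := Sh.add hFS hGS
  set p := proj ip φ f with hp
  set E := C₁ * K * M.h ^ (d + 1) with hE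
  have hE0 : 0 ≤ E := by positivity
  have hA' : ∀ x ∈ Icc (0 : ℝ) 1, |f x - (F x + G x)| ≤ E * M.h := fun x hx => by
    have := hA x hx
    rw [sub_sub] at this
    refine this.trans (le_of_eq ?_)
    rw [hE]; ring
  have e1 : l2norm (fun x => f x - (F x + G x)) ≤ E * M.h := l2norm_le_of_bound hA'
  have e2 : l2norm (fun x => f x - p x) ≤ E * M.h :=
    (Real.sqrt_le_sqrt (hφ.proj_best hS isForm_ip Pf hFG)).trans e1
  have P1 := Pf.sub (Sh.pc1 hFS)
  have P2 := Sh.pc1 hGS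
  have hD := hS.sub hFG hpm
  have P3 := Sh.pc1 hD
  have e3 : l2norm (dx G) ≤ 2 * C₃ * E := by
    have := h₃ M k hν G hGS (fun x => f x - F x) E (E * M.h) hE0 (by positivity) hL
      fun x hx => by rw [sub_sub]; exact hA' x hx
    refine le_of_mul_le_mul_right (this.trans (le_of_eq ?_)) hh
    ring
  have e4 : l2norm (dx (fun x => F x + G x - p x)) ≤ 2 * C₂ * E := by
    have h5 := h₂ M k hν _ hD
    have h6 : l2norm (fun x => F x + G x - p x) ≤ 2 * (E * M.h) := by
      have e : (fun x => F x + G x - p x) = fun x => (f x - p x) - (f x - (F x + G x)) := by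
        funext x; ring
      rw [e]
      refine (l2norm_sub_le (Pf.sub (Sh.pc1 hpm)).essBdd (Pf.sub (Sh.pc1 hFG)).essBdd).trans ?_
      linarith
    refine le_of_mul_le_mul_right (h5.trans ((mul_le_mul_of_nonneg_left h6 hC₂).trans
      (le_of_eq ?_))) hh
    ring
  have hCE : C₁ * (1 + 2 * C₃ + 2 * C₂) * K * M.h ^ (d + 1) = E + 2 * C₃ * E + 2 * C₂ * E := by
    rw [hE]; ring
  have n1 : 0 ≤ 2 * C₃ * E := by positivity
  have n2 : 0 ≤ 2 * C₂ * E := by positivity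
  rw [hCE]
  constructor
  · have := mul_le_mul_of_nonneg_left M.h_le_one hE0
    linarith
  · have e : (fun x => f x - p x) = fun x => ((f x - F x) - G x) + (F x + G x - p x) := by
      funext x; ring
    rw [e]
    refine ((P1.sub P2).l2norm_dx_add_le P3).trans ?_
    have := P1.l2norm_dx_sub_le P2
    have := hL.l2norm_dx_le hE0
    linarith

/-- This is Céa's argument: coercivity and best approximation with respect to A transfer the order
of the splines in H¹. No inverse inequality is used, so the mesh is arbitrary. -/
theorem exists_ellipticProjection_error {r : ℕ} (hr : 2 ≤ r) {μ c₁ c₂ : ℝ} {η : ℝ → ℝ}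
    (hη : IsBottom μ c₁ c₂ η) : ∃ C, 0 ≤ C ∧
    ∀ (M : Mesh) (k : ℕ), k ≤ r - 2 →
    ∀ (f : ℝ → ℝ) (K : ℝ), 0 ≤ K → ContDiffOn ℝ r f (Icc 0 1) → f 0 = 0 → f 1 = 0 →
    (∀ x ∈ Icc (0 : ℝ) 1, |iteratedDerivWithin r f (Icc 0 1) x| ≤ K) →
    ∀ {κ : Type} [Fintype κ] {P : κ → ℝ} {n : ℕ} {φ : Fin n → ℝ → ℝ} {a : Fin n → κ → ℝ},
      IsOrthoBasis (Sh0 M r k) (A μ η) P φ a →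
      l2norm (dx (fun x => f x - proj (A μ η) φ f x)) ≤ C * K * M.h ^ (r - 1) := by
  obtain ⟨d, rfl⟩ : ∃ d, r = d + 2 := ⟨r - 2, by omega⟩
  obtain ⟨C₁, hC₁, h₁⟩ := exists_spline_approx_pair d
  obtain ⟨C₂, hC₂, h₂⟩ := hη.exists_A_self_le
  set α := μ / 3 * c₁ ^ 3 with hα
  have hα0 : 0 < α := by have := hη.mu_pos; have := hη.c1_pos; positivity
  refine ⟨Real.sqrt (C₂ / α) * (2 * C₁), by positivity,
    fun M k hk f K hK hf f0 f1 hb κ _ P n φ a hφ => ?_⟩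
  have hh := M.h_pos
  obtain ⟨F, hF, -, -, hF0, hL, -⟩ := h₁ M f K hK hf hb
  simp only [Nat.add_sub_cancel, show d + 2 - 1 = d + 1 from rfl] at hk ⊢
  have hS := isFESpace_Sh0 M (d + 2) k
  have Pf : PC1 f := pc1_of_contDiffOn (hf.of_le (by norm_cast; omega))
  set E := C₁ * K * M.h ^ (d + 1) with hE
  have hE0 : 0 ≤ E := by positivity
  rw [f0] at hF0
  have hF1 : |F 1| ≤ E := by
    have := hL 1 (by simp) 0 (by simp)
    simpa [f0, f1, hF0] using this
  -- F vanishes at 0 but only nearly at 1. Subtracting the linear function F(1) x, whose slope is at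
  -- most E, repairs the boundary value and at most doubles the Lipschitz constant.
  have hχs : (fun x => F x - F 1 * x) ∈ Spl M (d + 1) := Spl.sub hF (Spl.const_mul _ (Spl.id_mem d))
  have hχ : (fun x => F x - F 1 * x) ∈ Sh0 M (d + 2) k :=
    ⟨Spl.subset_Sh hk hχs, by simp [hF0], by simp⟩
  have hLχ : Lip01 (2 * E) (fun x => f x - (F x - F 1 * x)) := fun x hx y hy => by
    have e : f x - (F x - F 1 * x) - (f y - (F y - F 1 * y))
        = ((f x - F x) - (f y - F y)) + F 1 * (x - y) := by ring
    rw [e]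
    refine (abs_add_le _ _).trans ?_
    rw [abs_mul]
    have := hL x hx y hy
    have := mul_le_mul_of_nonneg_right hF1 (abs_nonneg (x - y))
    linarith
  have e1 := hLχ.l2norm_dx_le (by positivity)
  have e2 := hφ.proj_best hS hη.isForm Pf hχ
  have e3 := h₂ _ (Pf.sub (Sh.pc1 hχ.1)) (by simp [f0, hF0])
  have e4 := hη.coercive (Pf.sub (Sh.pc1 (hφ.proj_mem hS f).1))
  have e5 := mul_le_mul_of_nonneg_left (pow_le_pow_left₀ (l2norm_nonneg _) e1 2) hC₂
  have e6 : l2norm (dx (fun x => f x - proj (A μ η) φ f x)) ^ 2 ≤ C₂ / α * (2 * E) ^ 2 := by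
    rw [div_mul_eq_mul_div, le_div_iff₀ hα0, mul_comm]
    exact e4.trans (e2.trans (e3.trans e5))
  have e7 : Real.sqrt (C₂ / α) * (2 * C₁) * K * M.h ^ (d + 1) = Real.sqrt (C₂ / α) * (2 * E) := by
    rw [hE]; ring
  rw [e7]
  apply le_of_sq_le_sq _ (by positivity)
  rwa [mul_pow, Real.sq_sqrt (by positivity)]

end Projection

/-! ### Differentiation in time -/

section Time
variable {T : ℝ} {w w' : ℝ → ℝ → ℝ} {g : ℝ → ℝ}

/-- Joint continuity on `[0,T] × [0,1]`. -/
def JointCont (T : ℝ) (w : ℝ → ℝ → ℝ) : Prop :=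
  ContinuousOn (fun p : ℝ × ℝ => w p.1 p.2) (Icc 0 T ×ˢ Icc 0 1)

lemma JointCont.space (h : JointCont T w) {t : ℝ} (ht : t ∈ Icc 0 T) :
    ContinuousOn (w t) (Icc 0 1) :=
  ContinuousOn.comp (f := fun x => (t, x)) h (by fun_prop) fun _ hx => ⟨ht, hx⟩

lemma JointCont.time (h : JointCont T w) {x : ℝ} (hx : x ∈ Icc (0 : ℝ) 1) :
    ContinuousOn (fun t => w t x) (Icc 0 T) :=
  ContinuousOn.comp (f := fun t => (t, x)) h (by fun_prop) fun _ ht => ⟨ht, hx⟩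

lemma JointCont.bound (h : JointCont T w) :
    ∃ K, 0 ≤ K ∧ ∀ t ∈ Icc 0 T, ∀ x ∈ Icc (0 : ℝ) 1, |w t x| ≤ K := by
  obtain ⟨K, hK⟩ := (isCompact_Icc.prod isCompact_Icc).exists_bound_of_continuousOn h
  exact ⟨|K|, abs_nonneg _, fun t ht x hx => (hK (t, x) ⟨ht, hx⟩).trans (le_abs_self _)⟩

lemma uIoc01 : uIoc (0 : ℝ) 1 = Ioc 0 1 := uIoc_of_le zero_le_one

lemma JointCont.continuousOn_ip (h : JointCont T w) (hg : EssBdd g) :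
    ContinuousOn (fun t => ip (w t) g) (Icc 0 T) := by
  obtain ⟨K, hK, hb⟩ := h.bound
  intro t ht
  have hg' : EssBdd (fun x => |g x|) := MemLp.abs hg
  refine intervalIntegral.continuousWithinAt_of_dominated_interval
    (bound := fun x => K * |g x|) ?_ ?_ (hg'.const_mul K).intervalIntegrable ?_
  · filter_upwards [self_mem_nhdsWithin] with s hs
    rw [uIoc01]
    exact ((essBdd_of_continuousOn (h.space hs)).mul hg).aestronglyMeasurable
  · filter_upwards [self_mem_nhdsWithin] with s hs
    refine ae_of_all _ fun x hx => ?_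
    rw [uIoc01] at hx
    rw [Real.norm_eq_abs, abs_mul]
    exact mul_le_mul_of_nonneg_right (hb s hs x ⟨hx.1.le, hx.2⟩) (abs_nonneg _)
  · refine ae_of_all _ fun x hx => ?_
    rw [uIoc01] at hx
    exact (h.time ⟨hx.1.le, hx.2⟩ t ht).mul continuousWithinAt_const

lemma JointCont.hasDerivAt_ip (h : JointCont T w) (h' : JointCont T w')
    (hd : ∀ t ∈ Ioo 0 T, ∀ x ∈ Icc (0 : ℝ) 1, HasDerivAt (fun s => w s x) (w' t x) t)
    (hg : EssBdd g) {t : ℝ} (ht : t ∈ Ioo 0 T) :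
    HasDerivAt (fun s => ip (w s) g) (ip (w' t) g) t := by
  obtain ⟨K, hK, hb⟩ := h'.bound
  have hg' : EssBdd (fun x => |g x|) := MemLp.abs hg
  have ht' := Ioo_subset_Icc_self ht
  have key := intervalIntegral.hasDerivAt_integral_of_dominated_loc_of_deriv_le
    (F := fun s x => w s x * g x) (F' := fun s x => w' s x * g x) (x₀ := t) (a := 0) (b := 1)
    (μ := volume) (s := Ioo 0 T) (bound := fun x => K * |g x|) (Ioo_mem_nhds ht.1 ht.2) ?_ ?_ ?_ ?_
    (hg'.const_mul K).intervalIntegrable ?_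
  · exact key.2
  · filter_upwards [Ioo_mem_nhds ht.1 ht.2] with s hs
    rw [uIoc01]
    exact ((essBdd_of_continuousOn (h.space (Ioo_subset_Icc_self hs))).mul hg).aestronglyMeasurable
  · exact ((essBdd_of_continuousOn (h.space ht')).mul hg).intervalIntegrable
  · rw [uIoc01]
    exact ((essBdd_of_continuousOn (h'.space ht')).mul hg).aestronglyMeasurable
  · refine ae_of_all _ fun x hx s hs => ?_
    rw [uIoc01] at hx
    rw [Real.norm_eq_abs, abs_mul]
    exact mul_le_mul_of_nonneg_right (hb s (Ioo_subset_Icc_self hs) x ⟨hx.1.le, hx.2⟩)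
      (abs_nonneg _)
  · refine ae_of_all _ fun x hx s hs => ?_
    rw [uIoc01] at hx
    exact (hd s hs x ⟨hx.1.le, hx.2⟩).mul_const (g x)

lemma hasDerivAt_dt (h : DiffInTime T w) {t : ℝ} (ht : t ∈ Ioo 0 T) {x : ℝ}
    (hx : x ∈ Icc (0 : ℝ) 1) : HasDerivAt (fun s => w s x) (dt T w t x) t := by
  have hn := Icc_mem_nhds ht.1 ht.2
  have := ((h x hx t (Ioo_subset_Icc_self ht)).differentiableAt hn).hasDerivAt
  rwa [← derivWithin_of_mem_nhds hn] at this

/-- Interchanging the derivatives in space and time. -/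
lemma hasDerivAt_dx (hw : JointCont T w) (hw' : JointCont T w')
    (hwx : ∀ t ∈ Icc 0 T, DifferentiableOn ℝ (w t) (Icc 0 1))
    (hwx' : ∀ t ∈ Icc 0 T, DifferentiableOn ℝ (w' t) (Icc 0 1))
    (hdx : JointCont T fun t => dx (w' t))
    (hd : ∀ t ∈ Ioo 0 T, ∀ x ∈ Icc (0 : ℝ) 1, HasDerivAt (fun s => w s x) (w' t x) t)
    {t : ℝ} (ht : t ∈ Ioo 0 T) {x : ℝ} (hx : x ∈ Icc (0 : ℝ) 1) :
    HasDerivAt (fun s => dx (w s) x) (dx (w' t) x) t := by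
  have hT : 0 < T := ht.1.trans ht.2
  have m0 : (0 : ℝ) ∈ Icc 0 T := ⟨le_rfl, hT.le⟩
  -- The integrated form of the claim, from which it follows by the fundamental theorem of calculus
  -- in time.
  have key : ∀ s ∈ Icc 0 T, dx (w s) x = dx (w 0) x + ∫ τ in (0 : ℝ)..s, dx (w' τ) x := by
    intro s hs
    have hsub : uIcc 0 s ⊆ Icc 0 T := uIcc_subset_Icc m0 hs
    have hG : ContinuousOn (fun y => ∫ τ in (0 : ℝ)..s, dx (w' τ) y) (Icc 0 1) := by
      obtain ⟨K, hK, hb⟩ := hdx.bound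
      intro y hy
      refine intervalIntegral.continuousWithinAt_of_dominated_interval (bound := fun _ => K)
        ?_ ?_ (by simp) ?_
      · filter_upwards [self_mem_nhdsWithin] with z hz
        exact ((hdx.time hz).mono (uIoc_subset_uIcc.trans hsub)).aestronglyMeasurable
          measurableSet_uIoc
      · filter_upwards [self_mem_nhdsWithin] with z hz
        exact ae_of_all _ fun τ hτ => hb τ (hsub (uIoc_subset_uIcc hτ)) z hz
      · exact ae_of_all _ fun τ hτ => hdx.space (hsub (uIoc_subset_uIcc hτ)) y hy
    have hint : ∀ y ∈ Icc (0 : ℝ) 1, w s y - w 0 y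
        = (w s 0 - w 0 0) + ∫ z in (0 : ℝ)..y, ∫ τ in (0 : ℝ)..s, dx (w' τ) z := by
      intro y hy
      have ftc : ∀ z ∈ Icc (0 : ℝ) 1, ∫ τ in (0 : ℝ)..s, w' τ z = w s z - w 0 z := by
        intro z hz
        refine intervalIntegral.integral_eq_sub_of_hasDerivAt_of_le hs.1
          ((hw.time hz).mono (Icc_subset_Icc_right hs.2))
          (fun τ hτ => hd τ ⟨hτ.1, hτ.2.trans_le hs.2⟩ z hz) ?_
        exact ((hw'.time hz).mono hsub).intervalIntegrable
      have hpc : ∀ τ ∈ uIcc 0 s, ∫ z in (0 : ℝ)..y, dx (w' τ) z = w' τ y - w' τ 0 := by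
        intro τ hτ
        have : PC1 (w' τ) := ⟨hw'.space (hsub hτ), ⟨∅, countable_empty, fun z hz =>
          (hwx' τ (hsub hτ) z (Ioo_subset_Icc_self hz.1)).differentiableAt
            (Icc_mem_nhds hz.1.1 hz.1.2)⟩, essBdd_of_continuousOn (hdx.space (hsub hτ))⟩
        exact this.integral_dx (by simp) hy
      -- By Fubini's theorem, w(s) - w(0) is a primitive in x of the time integral of the mixed
      -- derivative.
      rw [← intervalIntegral_intervalIntegral_swap (F := fun τ z => dx (w' τ) z),
        intervalIntegral.integral_congr hpc, intervalIntegral.integral_sub, ftc y hy,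
        ftc 0 (by simp)]
      · ring
      · exact ((hw'.time hy).mono hsub).intervalIntegrable
      · exact ((hw'.time (x := 0) (by simp)).mono hsub).intervalIntegrable
      · have hc : IntegrableOn (Function.uncurry fun τ z => dx (w' τ) z)
            (Icc 0 T ×ˢ Icc (0 : ℝ) 1) :=
          ContinuousOn.integrableOn_compact (isCompact_Icc.prod isCompact_Icc) hdx
        exact hc.mono_set (prod_mono (uIoc_subset_uIcc.trans hsub)
          (uIoc_subset_uIcc.trans (uIcc_subset_Icc (by simp) hy)))
    have h1 := dx_eq_of_integral (f := fun y => w s y - w 0 y) hG hint hx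
    have h2 := ((hwx s hs x hx).hasDerivWithinAt).sub ((hwx 0 m0 x hx).hasDerivWithinAt)
    have h3 := (uniqueDiffOn_Icc zero_lt_one x hx).eq_deriv _ h2 h1
    have h4 : dx (w s) x - dx (w 0) x = ∫ τ in (0 : ℝ)..s, dx (w' τ) x := h3
    linarith
  have hc := hdx.time hx
  have hI : IntervalIntegrable (fun τ => dx (w' τ) x) volume 0 t :=
    (hc.mono (uIcc_subset_Icc m0 (Ioo_subset_Icc_self ht))).intervalIntegrable
  have hn := Icc_mem_nhds ht.1 ht.2
  have h1 := intervalIntegral.integral_hasDerivAt_right hI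
    ((hc.mono Ioo_subset_Icc_self).stronglyMeasurableAtFilter isOpen_Ioo t ht)
    (hc.continuousAt hn)
  refine (h1.const_add (dx (w 0) x)).congr_of_eventuallyEq ?_
  filter_upwards [hn] with s hs using key s hs

end Time

/-! ### Weak form of the initial-boundary-value problem and regularity in time of its terms. -/

section Weak
variable {T ε μ c₁ c₂ : ℝ} {η ζ₀ u₀ χ : ℝ → ℝ} {ζ u : ℝ → ℝ → ℝ} {r : ℕ}

lemma ContInTime.jointCont {m : ℕ} {w : ℝ → ℝ → ℝ} (h : ContInTime T m w) : JointCont T w := by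
  have := h.2 0 (Nat.zero_le _)
  simp only [iteratedDerivWithin_zero] at this
  exact this

lemma ContInTime.jointCont_dx {m : ℕ} {w : ℝ → ℝ → ℝ} (hm : 1 ≤ m) (h : ContInTime T m w) :
    JointCont T fun t => dx (w t) := by
  have := h.2 1 hm
  simp only [iteratedDerivWithin_one] at this
  exact this

lemma IsBottom.cube_smooth (hη : IsBottom μ c₁ c₂ η) :
    ContDiffOn ℝ 1 (fun x => η x ^ 3) (Icc 0 1) := (hη.smooth.of_le (by norm_num)).pow 3

/-- All weights sit on the fixed test function, so differentiation in time acts only on v and `dx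
v`. -/
lemma A_eq (μ : ℝ) (η v χ : ℝ → ℝ) : A μ η v χ = ip v (fun x => massCoeff μ η x * χ x)
    + μ / 3 * ip (dx v) (fun x => η x ^ 3 * dx χ x) := by
  unfold A ip
  congr 1
  · congr 1; funext x; ring
  · congr 2; funext x; ring

lemma IsSmoothPair.hasDerivAt_A (h : IsSmoothPair T r ζ u) (hr : 1 ≤ r) (hη : IsBottom μ c₁ c₂ η)
    (hχ : PC1 χ) {t : ℝ} (ht : t ∈ Ioo 0 T) :
    HasDerivAt (fun s => A μ η (u s) χ) (A μ η (dt T u t) χ) t := by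
  simp only [A_eq]
  have hu := h.u_space.jointCont
  have hu' := h.u_time.jointCont
  have hdx := h.u_time.jointCont_dx (by norm_num)
  have hd : ∀ t ∈ Ioo 0 T, ∀ x ∈ Icc (0 : ℝ) 1, HasDerivAt (fun s => u s x) (dt T u t x) t :=
    fun t ht x hx => hasDerivAt_dt h.u_diff ht hx
  refine (hu.hasDerivAt_ip hu' hd (hη.essBdd_mass.mul hχ.essBdd) ht).add
    (HasDerivAt.const_mul _ ?_)
  refine JointCont.hasDerivAt_ip (w := fun t => dx (u t)) (w' := fun t => dx (dt T u t))
    (h.u_space.jointCont_dx hr) hdx (fun s hs x hx => ?_) (hη.essBdd_cube.mul hχ.bdd) ht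
  exact hasDerivAt_dx hu hu'
    (fun t ht => (h.u_space.1 t ht).differentiableOn (by exact_mod_cast (by omega : r ≠ 0)))
    (fun t ht => (h.u_time.1 t ht).differentiableOn (by norm_num)) hdx hd hs hx

lemma IsSmoothPair.continuousOn_A (h : IsSmoothPair T r ζ u) (hr : 1 ≤ r)
    (hη : IsBottom μ c₁ c₂ η) (hχ : PC1 χ) : ContinuousOn (fun t => A μ η (u t) χ) (Icc 0 T) := by
  simp only [A_eq]
  exact (h.u_space.jointCont.continuousOn_ip (hη.essBdd_mass.mul hχ.essBdd)).add
    (continuousOn_const.mul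
      ((h.u_space.jointCont_dx hr).continuousOn_ip (hη.essBdd_cube.mul hχ.bdd)))

lemma ContInTime.pc1 {m : ℕ} (hm : 1 ≤ m) {w : ℝ → ℝ → ℝ} (h : ContInTime T m w) {t : ℝ}
    (ht : t ∈ Icc 0 T) : PC1 (w t) :=
  pc1_of_contDiffOn ((h.1 t ht).of_le (by exact_mod_cast hm))

lemma IsIBVPSolution.weak_mass (hs : IsIBVPSolution ε μ T η ζ₀ u₀ ζ u) (h : IsSmoothPair T r ζ u)
    (hr : 1 ≤ r) (hη : IsBottom μ c₁ c₂ η) (hχ : EssBdd χ) {t : ℝ} (ht : t ∈ Icc 0 T) :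
    ip (dt T ζ t) χ = - ε * ip (dx (fun y => ζ t y * u t y)) χ
      - ip (dx (fun y => η y * u t y)) χ := by
  have P1 := ((h.zeta_space.pc1 hr ht).mul (h.u_space.pc1 hr ht)).bdd
  have P2 := (hη.pc1.mul (h.u_space.pc1 hr ht)).bdd
  rw [← ip_const_mul_left, ← ip_sub_left (P1.const_mul _) P2 hχ]
  refine ip_congr (fun x hx => ?_) fun _ _ => rfl
  linarith [hs.mass t ht x hx]

/-- The term of second order is integrated by parts, which is legitimate because u_t is C² in space
and χ vanishes at both ends. -/
lemma IsIBVPSolution.weak_momentum (hs : IsIBVPSolution ε μ T η ζ₀ u₀ ζ u)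
    (h : IsSmoothPair T r ζ u) (hr : 1 ≤ r) (hη : IsBottom μ c₁ c₂ η) (hχ : PC1 χ) (h0 : χ 0 = 0)
    (h1 : χ 1 = 0) {t : ℝ} (ht : t ∈ Icc 0 T) :
    A μ η (dt T u t) χ = - ip (fun x => η x * dx (ζ t) x) χ
      - ε * ip (fun x => η x * u t x * dx (u t) x) χ := by
  have hux : ContDiffOn ℝ 1 (dx (dt T u t)) (Icc 0 1) :=
    (h.u_time.1 t ht).derivWithin (uniqueDiffOn_Icc zero_lt_one) (by norm_num)
  have P := pc1_of_contDiffOn (hη.cube_smooth.mul hux)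
  have e1 := P.ip_dx_left hχ h0 h1
  have b1 := hη.essBdd_mass.mul (h.u_time.pc1 (by norm_num) ht).essBdd
  have b2 := (hη.pc1.essBdd.mul (h.zeta_space.pc1 hr ht).bdd)
  have b3 := ((hη.pc1.essBdd.mul (h.u_space.pc1 hr ht).essBdd).mul (h.u_space.pc1 hr ht).bdd)
  have e2 : ip (fun x => massCoeff μ η x * dt T u t x) χ
      = μ / 3 * ip (dx fun x => η x ^ 3 * dx (dt T u t) x) χ
        - ip (fun x => η x * dx (ζ t) x) χ
        - ε * ip (fun x => η x * u t x * dx (u t) x) χ := by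
    rw [← ip_const_mul_left, ← ip_const_mul_left, ← ip_sub_left (P.bdd.const_mul _) b2 hχ.essBdd,
      ← ip_sub_left ((P.bdd.const_mul _).sub b2) (b3.const_mul _) hχ.essBdd]
    refine ip_congr (fun x hx => ?_) fun _ _ => rfl
    linarith [hs.momentum t ht x hx]
  unfold A
  have e1' : ip (dx fun x => η x ^ 3 * dx (dt T u t) x) χ
      = - ip (fun x => η x ^ 3 * dx (dt T u t) x) (dx χ) := e1
  rw [e2, e1']
  ring

end Weak

/-! ### Ordinary differential equations -/

section ODE
variable {E : Type*} [NormedAddCommGroup E] [NormedSpace ℝ E] [FiniteDimensional ℝ E]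

/-- A `C¹` vector field agrees on a ball with a bounded and globally Lipschitz one. -/
lemma exists_cutoff {G : E → E} (hG : ContDiff ℝ 1 G) (R : ℝ) :
    ∃ (F : E → E) (K L : NNReal), LipschitzWith K F ∧ (∀ x, ‖F x‖ ≤ L) ∧
      ∀ x, ‖x‖ ≤ R → F x = G x := by
  let f : ContDiffBump (0 : E) := ⟨|R| + 1, |R| + 2, by positivity, by linarith⟩
  have hF : ContDiff ℝ 1 (fun x => f x • G x) := f.contDiff.smul hG
  have hc : HasCompactSupport (fun x => f x • G x) := f.hasCompactSupport.smul_right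
  obtain ⟨K, hK⟩ := hF.lipschitzWith_of_hasCompactSupport hc (by simp)
  obtain ⟨L, hL⟩ := hc.exists_bound_of_continuous hF.continuous
  refine ⟨_, K, L.toNNReal, hK, fun x => (hL x).trans (Real.le_coe_toNNReal L), fun x hx => ?_⟩
  have h1 : f x = 1 := f.one_of_mem_closedBall (by
    rw [mem_closedBall_zero_iff]
    exact (hx.trans (le_abs_self R)).trans (by simp [f]))
  simp only [h1, one_smul]

/-- A field bounded by L moves a point by at most L T in time T, so a single application of
Picard–Lindelöf covers the whole interval. -/
lemma exists_solution_of_lipschitz {F : E → E} {K L : NNReal} (hF : LipschitzWith K F)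
    (hL : ∀ x, ‖F x‖ ≤ L) {T : ℝ} (hT : 0 ≤ T) (x₀ : E) :
    ∃ α : ℝ → E, α 0 = x₀ ∧ ∀ t ∈ Icc 0 T, HasDerivWithinAt α (F (α t)) (Icc 0 T) t := by
  have hPL : IsPicardLindelof (fun _ => F) (tmin := 0) (tmax := T) ⟨0, le_rfl, hT⟩ x₀
      (L * T.toNNReal) 0 L K :=
    { lipschitzOnWith := fun _ _ => hF.lipschitzOnWith
      continuousOn := fun _ _ => continuousOn_const
      norm_le := fun _ _ x _ => hL x
      mul_max_le := by simp [hT] }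
  obtain ⟨α, h0, h⟩ := hPL.exists_eq_forall_mem_Icc_hasDerivWithinAt₀
  exact ⟨α, h0, h⟩

/-- Both trajectories are bounded on [0,T], and on a ball containing them the field agrees with a
globally Lipschitz one. -/
lemma ode_unique {G : E → E} (hG : ContDiff ℝ 1 G) {T : ℝ} {α β : ℝ → E}
    (hα : ∀ t ∈ Icc 0 T, HasDerivWithinAt α (G (α t)) (Icc 0 T) t)
    (hβ : ∀ t ∈ Icc 0 T, HasDerivWithinAt β (G (β t)) (Icc 0 T) t) (h0 : α 0 = β 0) :
    ∀ t ∈ Icc 0 T, α t = β t := by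
  have cα : ContinuousOn α (Icc 0 T) := fun t ht => (hα t ht).continuousWithinAt
  have cβ : ContinuousOn β (Icc 0 T) := fun t ht => (hβ t ht).continuousWithinAt
  obtain ⟨R₁, hR₁⟩ := isCompact_Icc.exists_bound_of_continuousOn cα
  obtain ⟨R₂, hR₂⟩ := isCompact_Icc.exists_bound_of_continuousOn cβ
  obtain ⟨F, K, -, hF, -, hFG⟩ := exists_cutoff hG (max R₁ R₂)
  have hd : ∀ {γ : ℝ → E}, (∀ t ∈ Icc 0 T, HasDerivWithinAt γ (G (γ t)) (Icc 0 T) t) →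
      (∀ t ∈ Icc 0 T, ‖γ t‖ ≤ max R₁ R₂) →
      ∀ t ∈ Ico 0 T, HasDerivWithinAt γ (F (γ t)) (Ici t) t := by
    intro γ hγ hb t ht
    have ht' := Ico_subset_Icc_self ht
    rw [hFG _ (hb t ht')]
    exact (hγ t ht').mono_of_mem_nhdsWithin (Icc_mem_nhdsGE_of_mem ht)
  exact ODE_solution_unique_of_mem_Icc_right (v := fun _ => F) (s := fun _ => univ) (K := K)
    (fun _ _ => hF.lipschitzOnWith) cα
    (hd hα fun t ht => (hR₁ t ht).trans (le_max_left _ _)) (fun _ _ => mem_univ _) cβ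
    (hd hβ fun t ht => (hR₂ t ht).trans (le_max_right _ _)) (fun _ _ => mem_univ _) h0

/-- The continuation argument. -/
lemma lt_of_continuation {T δ : ℝ} {Y : ℝ → ℝ} (hY : ContinuousOn Y (Icc 0 T)) (h0 : Y 0 < δ)
    (h : ∀ t ∈ Icc 0 T, (∀ s ∈ Icc 0 t, Y s ≤ δ) → Y t < δ) : ∀ t ∈ Icc 0 T, Y t < δ := by
  by_contra! hcon
  have hcl : IsCompact (Icc 0 T ∩ Y ⁻¹' Ici δ) :=
    isCompact_Icc.of_isClosed_subset (hY.preimage_isClosed_of_isClosed isClosed_Icc isClosed_Ici)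
      inter_subset_left
  obtain ⟨t₀, ht₀, hδ⟩ := hcon
  -- This t is the first time with Y ≥ δ. Up to t one has Y ≤ δ by continuity, and the hypothesis
  -- then contradicts the choice of t.
  obtain ⟨t, ⟨ht, htδ⟩, hmin⟩ := hcl.exists_isLeast ⟨t₀, ht₀, hδ⟩
  have hlt : ∀ s ∈ Ico 0 t, Y s < δ := fun s hs => by
    by_contra! hs'
    exact absurd (hmin ⟨⟨hs.1, hs.2.le.trans ht.2⟩, hs'⟩) (not_le.2 hs.2)
  have ht0 : 0 < t := lt_of_le_of_ne ht.1 fun e => by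
    rw [← e] at htδ
    exact absurd h0 (not_lt.2 htδ)
  have hle : ∀ s ∈ Icc 0 t, Y s ≤ δ := by
    have hcl2 : IsClosed (Icc 0 t ∩ Y ⁻¹' Iic δ) :=
      (hY.mono (Icc_subset_Icc_right ht.2)).preimage_isClosed_of_isClosed isClosed_Icc isClosed_Iic
    have hsub : closure (Ico 0 t) ⊆ Icc 0 t ∩ Y ⁻¹' Iic δ :=
      closure_minimal (fun s hs => ⟨Ico_subset_Icc_self hs, (hlt s hs).le⟩) hcl2
    rw [closure_Ico ht0.ne] at hsub
    exact fun s hs => (hsub hs).2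
  exact absurd (h t ht hle) (not_lt.2 htδ)

/-- Gronwall's inequality with derivatives in the open interval. -/
lemma gronwall_Ioo {t B D : ℝ} {Y Y' : ℝ → ℝ} (hY : ContinuousOn Y (Icc 0 t))
    (hd : ∀ s ∈ Ioo 0 t, HasDerivAt Y (Y' s) s) (hle : ∀ s ∈ Ioo 0 t, Y' s ≤ B * (D + Y s))
    (h0 : Y 0 = 0) (ht : 0 ≤ t) : Y t ≤ D * Real.exp (B * t) - D := by
  have hanti : AntitoneOn (fun s => (D + Y s) * Real.exp (-B * s)) (Icc 0 t) := by
    have hder : ∀ s ∈ Ioo 0 t, HasDerivAt (fun s => (D + Y s) * Real.exp (-B * s))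
        (Y' s * Real.exp (-B * s) + (D + Y s) * (Real.exp (-B * s) * (-B * 1))) s := fun s hs =>
      ((hd s hs).const_add D).mul (((hasDerivAt_id s).const_mul (-B)).exp)
    refine antitoneOn_of_deriv_nonpos (convex_Icc 0 t)
      ((continuousOn_const.add hY).mul (by fun_prop)) (fun s hs => ?_) fun s hs => ?_
    · rw [interior_Icc] at hs
      exact (hder s hs).differentiableAt.differentiableWithinAt
    · rw [interior_Icc] at hs
      rw [(hder s hs).deriv]
      have := mul_le_mul_of_nonneg_right (hle s hs) (Real.exp_pos (-B * s)).le
      linarith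
  have h1 := hanti ⟨le_rfl, ht⟩ ⟨ht, le_rfl⟩ ht
  simp only [h0, mul_zero, Real.exp_zero, add_zero, mul_one] at h1
  have h2 := mul_le_mul_of_nonneg_right h1 (Real.exp_pos (B * t)).le
  rw [mul_assoc, ← Real.exp_add] at h2
  have h3 : -B * t + B * t = 0 := by ring
  rw [h3, Real.exp_zero, mul_one] at h2
  linarith

end ODE

/-! ### The Galerkin system in coordinates -/

/-- Linear functionals on piecewise `C¹` functions. -/
structure IsLin (L : (ℝ → ℝ) → ℝ) : Prop where
  add : ∀ f g, PC1 f → PC1 g → L (fun x => f x + g x) = L f + L g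
  smul : ∀ (c : ℝ) f, PC1 f → L (fun x => c * f x) = c * L f

section Lin
variable {L : (ℝ → ℝ) → ℝ} {n m : ℕ} {φ : Fin n → ℝ → ℝ} {ψ : Fin m → ℝ → ℝ}

lemma IsLin.sum (hL : IsLin L) {ι : Type*} (s : Finset ι) {F : ι → ℝ → ℝ} (h : ∀ i, PC1 (F i))
    (c : ι → ℝ) : L (fun x => ∑ i ∈ s, c i * F i x) = ∑ i ∈ s, c i * L (F i) := by
  classical
  induction s using Finset.induction_on with
  | empty => simpa using hL.smul 0 _ (PC1.const 0)
  | insert a s ha ih =>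
    simp only [Finset.sum_insert ha]
    rw [hL.add _ _ ((h a).const_mul _) (PC1.sum s fun i _ => (h i).const_mul _), ih,
      hL.smul _ _ (h a)]

lemma isLin_mul_dx {w g : ℝ → ℝ} (hw : EssBdd w) (hg : EssBdd g) :
    IsLin (fun f => ip (fun x => w x * dx f x) g) where
  add f f' hf hf' := by
    rw [← ip_add_left (hw.mul hf.bdd) (hw.mul hf'.bdd) hg]
    refine ip_congr_ae ?_ (Filter.EventuallyEq.refl _ _)
    filter_upwards [hf.dx_add_ae hf'] with x hx
    rw [hx, mul_add]
  smul c f hf := by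
    rw [← ip_const_mul_left]
    refine ip_congr_ae ?_ (Filter.EventuallyEq.refl _ _)
    filter_upwards [hf.dx_const_mul_ae c] with x hx
    rw [hx, mul_left_comm]

lemma isLin_dx {g : ℝ → ℝ} (hg : EssBdd g) : IsLin (fun f => ip (dx f) g) := by
  simpa only [one_mul] using isLin_mul_dx (EssBdd.const 1) hg

lemma isLin_dx_mul {η g : ℝ → ℝ} (hη : PC1 η) (hg : EssBdd g) :
    IsLin (fun f => ip (dx fun x => η x * f x) g) where
  add f f' hf hf' := by
    have := (isLin_dx hg).add _ _ (hη.mul hf) (hη.mul hf')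
    simpa only [mul_add] using this
  smul c f hf := by
    have := (isLin_dx hg).smul c _ (hη.mul hf)
    simpa only [mul_left_comm] using this

lemma comb_mul_comb (c : Fin n → ℝ) (d : Fin m → ℝ) : (fun x => comb φ c x * comb ψ d x)
    = fun x => ∑ q : Fin n × Fin m, (c q.1 * d q.2) * (φ q.1 x * ψ q.2 x) := by
  funext x
  rw [comb, comb, Finset.sum_mul_sum, Fintype.sum_prod_type]
  refine Finset.sum_congr rfl fun i _ => Finset.sum_congr rfl fun j _ => ?_
  ring

lemma IsLin.contDiff_comb (hL : IsLin L) {E : Type*} [NormedAddCommGroup E] [NormedSpace ℝ E]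
    {c : E → Fin n → ℝ} (hc : ContDiff ℝ 1 c) (hφ : ∀ i, PC1 (φ i)) :
    ContDiff ℝ 1 (fun z => L (comb φ (c z))) := by
  have : ∀ z, L (comb φ (c z)) = ∑ i, c z i * L (φ i) := fun z => hL.sum _ hφ _
  simp only [this]
  have := contDiff_pi.1 hc
  exact ContDiff.sum fun i _ => (this i).mul contDiff_const

lemma IsLin.contDiff_comb_mul (hL : IsLin L) {E : Type*} [NormedAddCommGroup E]
    [NormedSpace ℝ E] {c : E → Fin n → ℝ} {d : E → Fin m → ℝ} (hc : ContDiff ℝ 1 c)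
    (hd : ContDiff ℝ 1 d) (hφ : ∀ i, PC1 (φ i)) (hψ : ∀ i, PC1 (ψ i)) :
    ContDiff ℝ 1 (fun z => L (fun x => comb φ (c z) x * comb ψ (d z) x)) := by
  have : ∀ z, L (fun x => comb φ (c z) x * comb ψ (d z) x)
      = ∑ q : Fin n × Fin m, (c z q.1 * d z q.2) * L (fun x => φ q.1 x * ψ q.2 x) := fun z => by
    rw [comb_mul_comb]
    exact hL.sum _ (fun q : Fin n × Fin m => (hφ q.1).mul (hψ q.2)) _
  simp only [this]
  have hc' := contDiff_pi.1 hc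
  have hd' := contDiff_pi.1 hd
  exact ContDiff.sum fun q _ => ((hc' q.1).mul (hd' q.2)).mul contDiff_const

/-- Since v v' = ½ (v²)' almost everywhere, the nonlinear term becomes a linear functional of a
product, the form that `IsLin.contDiff_comb_mul` handles. -/
lemma ip_mul_dx_self {η v g : ℝ → ℝ} (hv : PC1 v) :
    ip (fun x => η x * v x * dx v x) g = 1 / 2 * ip (fun x => η x * dx (fun y => v y * v y) x) g := by
  rw [← ip_const_mul_left]
  refine ip_congr_ae ?_ (Filter.EventuallyEq.refl _ _)
  filter_upwards [hv.dx_mul_ae hv] with x hx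
  rw [hx]
  ring

end Lin

/-- The vector field of the semidiscrete system in coordinates. -/
noncomputable def galerkinField (ε : ℝ) (η : ℝ → ℝ) {n m : ℕ} (φ : Fin n → ℝ → ℝ)
    (ψ : Fin m → ℝ → ℝ) (z : (Fin n → ℝ) × (Fin m → ℝ)) : (Fin n → ℝ) × (Fin m → ℝ) :=
  (fun i => - ε * ip (dx fun y => comb φ z.1 y * comb ψ z.2 y) (φ i)
      - ip (dx fun y => η y * comb ψ z.2 y) (φ i),
    fun j => - ip (fun x => η x * dx (comb φ z.1) x) (ψ j)
      - ε * ip (fun x => η x * comb ψ z.2 x * dx (comb ψ z.2) x) (ψ j))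

section Galerkin
variable {ε μ c₁ c₂ T : ℝ} {η ζ₀ u₀ : ℝ → ℝ} {M : Mesh} {r k n m : ℕ} {φ : Fin n → ℝ → ℝ}
  {ψ : Fin m → ℝ → ℝ} {a : Fin n → Fin M.N × Fin r → ℝ} {a' : Fin m → Fin M.N × Fin r → ℝ}

lemma PC1.comb (h : ∀ i, PC1 (φ i)) (c : Fin n → ℝ) : PC1 (comb φ c) :=
  PC1.sum _ fun i _ => (h i).const_mul _

/-- Every component is a polynomial of degree at most two in the coordinates. No mass matrix has to
be inverted, because the bases are orthonormal. -/
lemma contDiff_galerkinField (ε : ℝ) (hη : PC1 η) (hφ : ∀ i, PC1 (φ i)) (hψ : ∀ i, PC1 (ψ i)) :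
    ContDiff ℝ 1 (galerkinField ε η φ ψ) := by
  refine ContDiff.prodMk (contDiff_pi.2 fun i => ?_) (contDiff_pi.2 fun j => ?_)
  · refine (contDiff_const.mul ?_).sub ?_
    · exact (isLin_dx (hφ i).essBdd).contDiff_comb_mul contDiff_fst contDiff_snd hφ hψ
    · exact (isLin_dx_mul hη (hφ i).essBdd).contDiff_comb contDiff_snd hψ
  · have : ∀ z : (Fin n → ℝ) × (Fin m → ℝ),
        ip (fun x => η x * Boussinesq.comb ψ z.2 x * dx (Boussinesq.comb ψ z.2) x) (ψ j) = _ :=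
      fun z => ip_mul_dx_self (PC1.comb hψ z.2)
    simp only [this]
    have hL := isLin_mul_dx hη.essBdd (hψ j).essBdd
    exact (hL.contDiff_comb contDiff_fst hφ).neg.sub (contDiff_const.mul
      (contDiff_const.mul (hL.contDiff_comb_mul contDiff_snd contDiff_snd hψ hψ)))

lemma ip_comb_right {f : ℝ → ℝ} (hf : EssBdd f) (hφ : ∀ i, PC1 (φ i)) (c : Fin n → ℝ) :
    ip f (comb φ c) = ∑ i, c i * ip f (φ i) := by
  refine (ip_sum_right _ (fun i _ => ((hφ i).const_mul (c i)).essBdd) hf).trans ?_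
  simp only [ip_const_mul_right]

lemma galerkinField_fst_sum (hη : PC1 η) (hφ : ∀ i, PC1 (φ i)) (hψ : ∀ i, PC1 (ψ i))
    (z : (Fin n → ℝ) × (Fin m → ℝ)) (b : Fin n → ℝ) :
    ∑ i, b i * (galerkinField ε η φ ψ z).1 i
      = - ε * ip (dx fun y => comb φ z.1 y * comb ψ z.2 y) (comb φ b)
        - ip (dx fun y => η y * comb ψ z.2 y) (comb φ b) := by
  rw [ip_comb_right ((PC1.comb hφ z.1).mul (PC1.comb hψ z.2)).bdd hφ,
    ip_comb_right (hη.mul (PC1.comb hψ z.2)).bdd hφ, Finset.mul_sum, ← Finset.sum_sub_distrib]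
  refine Finset.sum_congr rfl fun i _ => ?_
  simp only [galerkinField]
  ring

lemma galerkinField_snd_sum (hη : PC1 η) (hφ : ∀ i, PC1 (φ i)) (hψ : ∀ i, PC1 (ψ i))
    (z : (Fin n → ℝ) × (Fin m → ℝ)) (b : Fin m → ℝ) :
    ∑ j, b j * (galerkinField ε η φ ψ z).2 j
      = - ip (fun x => η x * dx (comb φ z.1) x) (comb ψ b)
        - ε * ip (fun x => η x * comb ψ z.2 x * dx (comb ψ z.2) x) (comb ψ b) := by
  have PU := PC1.comb hψ z.2
  rw [ip_comb_right (hη.essBdd.mul (PC1.comb hφ z.1).bdd) hψ,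
    ip_comb_right ((hη.essBdd.mul PU.essBdd).mul PU.bdd) hψ, Finset.mul_sum,
    ← Finset.sum_neg_distrib, ← Finset.sum_sub_distrib]
  refine Finset.sum_congr rfl fun i _ => ?_
  simp only [galerkinField]
  ring

lemma hasDerivWithinAt_comb {s : Set ℝ} {c : ℝ → Fin n → ℝ} {c' : Fin n → ℝ} {t : ℝ}
    (h : HasDerivWithinAt c c' s t) (x : ℝ) :
    HasDerivWithinAt (fun s => comb φ (c s) x) (comb φ c' x) s t := by
  have := hasDerivWithinAt_pi.1 h
  exact HasDerivWithinAt.fun_sum fun i _ => (this i).mul_const _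

lemma dt_comb (hT : 0 < T) {c : ℝ → Fin n → ℝ} {c' : Fin n → ℝ} {t : ℝ} (ht : t ∈ Icc 0 T)
    (h : HasDerivWithinAt c c' (Icc 0 T) t) :
    dt T (fun s => comb φ (c s)) t = comb φ c' := by
  funext x
  exact (hasDerivWithinAt_comb h x).derivWithin (uniqueDiffOn_Icc hT t ht)

/-- A trajectory of the coordinate system yields a solution of the semidiscrete problem. -/
theorem isSemidiscreteSolution_of_coords (hT : 0 < T) (hη : IsBottom μ c₁ c₂ η)
    (hφ : IsOrthoBasis (Sh M r k) ip (M.pt r) φ a)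
    (hψ : IsOrthoBasis (Sh0 M r k) (A μ η) (M.pt r) ψ a')
    {ζi ui : ℝ → ℝ} (hζi : PC1 ζi) (hui : PC1 ui) (eζ : ∀ x ∈ Icc (0 : ℝ) 1, ζi x = ζ₀ x)
    (eu : ∀ x ∈ Icc (0 : ℝ) 1, ui x = u₀ x) {α : ℝ → (Fin n → ℝ) × (Fin m → ℝ)}
    (h0 : α 0 = (fun i => ip ζi (φ i), fun j => A μ η ui (ψ j)))
    (hα : ∀ t ∈ Icc 0 T, HasDerivWithinAt α (galerkinField ε η φ ψ (α t)) (Icc 0 T) t) :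
    IsSemidiscreteSolution ε μ T η ζ₀ u₀ M r k (fun t => comb φ (α t).1)
      (fun t => comb ψ (α t).2) := by
  have hS := isFESpace_Sh M r k
  have hS0 := isFESpace_Sh0 M r k
  have pφ : ∀ i, PC1 (φ i) := fun i => hS.pc1 _ (hφ.mem i)
  have pψ : ∀ i, PC1 (ψ i) := fun i => hS0.pc1 _ (hψ.mem i)
  have d1 : ∀ t ∈ Icc 0 T, HasDerivWithinAt (fun t => (α t).1) (galerkinField ε η φ ψ (α t)).1
      (Icc 0 T) t := fun t ht => (hα t ht).fst
  have d2 : ∀ t ∈ Icc 0 T, HasDerivWithinAt (fun t => (α t).2) (galerkinField ε η φ ψ (α t)).2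
      (Icc 0 T) t := fun t ht => (hα t ht).snd
  have hm : (0 : ℝ) ∈ Icc 0 T := ⟨le_rfl, hT.le⟩
  refine ⟨fun t _ => hS.comb_mem hφ.mem _, fun t _ => hS0.comb_mem hψ.mem _,
    fun x _ t ht => (hasDerivWithinAt_comb (d1 t ht) x).differentiableWithinAt,
    fun x _ t ht => (hasDerivWithinAt_comb (d2 t ht) x).differentiableWithinAt,
    fun t ht w hw => ?_, fun t ht w hw => ?_, ?_, ?_⟩
  · rw [dt_comb hT ht (d1 t ht)]
    have hw' : ∀ g, ip g w = ip g (comb φ fun i => ip w (φ i)) := fun g =>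
      ip_congr (fun _ _ => rfl) (hφ.repr w hw)
    rw [hw', hw' (dx fun y => comb φ (α t).1 y * comb ψ (α t).2 y),
      hw' (dx fun y => η y * comb ψ (α t).2 y), isForm_ip.comb_right pφ (PC1.comb pφ _)]
    simp only [hφ.comb_coef hS isForm_ip]
    rw [galerkinField_fst_sum hη.pc1 pφ pψ]
    ring
  · rw [dt_comb hT ht (d2 t ht)]
    have hw' : ∀ g, ip g w = ip g (comb ψ fun i => A μ η w (ψ i)) := fun g =>
      ip_congr (fun _ _ => rfl) (hψ.repr w hw)
    have hwA : ∀ g, A μ η g w = A μ η g (comb ψ fun i => A μ η w (ψ i)) := fun g =>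
      A_congr μ η (fun _ _ => rfl) (hψ.repr w hw)
    rw [hwA, hw' (fun x => η x * dx (comb φ (α t).1) x),
      hw' (fun x => η x * comb ψ (α t).2 x * dx (comb ψ (α t).2) x),
      hη.isForm.comb_right pψ (PC1.comb pψ _)]
    simp only [hψ.comb_coef hS0 hη.isForm]
    rw [galerkinField_snd_sum hη.pc1 pφ pψ]
    ring
  · refine ⟨hS.comb_mem hφ.mem _, fun w hw => ?_⟩
    have e := hφ.form_proj hS isForm_ip hζi hw
    rw [proj] at e
    rw [h0, e]
    exact ip_congr eζ fun _ _ => rfl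
  · refine ⟨hS0.comb_mem hψ.mem _, fun w hw => ?_⟩
    have e := hψ.form_proj hS0 hη.isForm hui hw
    rw [proj] at e
    rw [h0, e]
    exact A_congr μ η eu fun _ _ => rfl

/-- Time differentiability of coefficients. -/
lemma hasDerivWithinAt_coef {S : Set (ℝ → ℝ)} {B : (ℝ → ℝ) → (ℝ → ℝ) → ℝ} {κ : Type} [Fintype κ]
    {P : κ → ℝ} {a : Fin n → κ → ℝ} (hP : ∀ q, P q ∈ Icc (0 : ℝ) 1) (hφ : IsOrthoBasis S B P φ a)
    {v : ℝ → ℝ → ℝ} (hv : ∀ t ∈ Icc 0 T, v t ∈ S) (hd : DiffInTime T v) (hT : 0 < T) {t : ℝ}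
    (ht : t ∈ Icc 0 T) : ∃ c' : Fin n → ℝ,
      HasDerivWithinAt (fun s i => B (v s) (φ i)) c' (Icc 0 T) t ∧
      ∀ x ∈ Icc (0 : ℝ) 1, dt T v t x = comb φ c' x := by
  -- The coefficients are fixed finite combinations of point values, which are differentiable in
  -- time by hypothesis.
  have h1 : HasDerivWithinAt (fun s i => B (v s) (φ i))
      (fun i => ∑ q, a i q * dt T v t (P q)) (Icc 0 T) t := by
    refine hasDerivWithinAt_pi.2 fun i => ?_
    have h2 : HasDerivWithinAt (fun s => ∑ q, a i q * v s (P q)) (∑ q, a i q * dt T v t (P q))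
        (Icc 0 T) t :=
      HasDerivWithinAt.fun_sum fun q _ => ((hd (P q) (hP q) t ht).hasDerivWithinAt).const_mul _
    exact h2.congr (fun s hs => hφ.coef _ (hv s hs) i) (hφ.coef _ (hv t ht) i)
  refine ⟨_, h1, fun x hx => ?_⟩
  have h3 := hasDerivWithinAt_comb (φ := φ) h1 x
  exact (h3.congr (fun s hs => hφ.repr _ (hv s hs) x hx)
    (hφ.repr _ (hv t ht) x hx)).derivWithin (uniqueDiffOn_Icc hT t ht)

/-- Solutions of the semidiscrete problem are trajectories of the coordinate system. -/
theorem IsSemidiscreteSolution.coords (hT : 0 < T) (hη : IsBottom μ c₁ c₂ η)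
    (hφ : IsOrthoBasis (Sh M r k) ip (M.pt r) φ a)
    (hψ : IsOrthoBasis (Sh0 M r k) (A μ η) (M.pt r) ψ a') {ζh uh : ℝ → ℝ → ℝ}
    (h : IsSemidiscreteSolution ε μ T η ζ₀ u₀ M r k ζh uh)
    {α : ℝ → (Fin n → ℝ) × (Fin m → ℝ)}
    (hα : α = fun t => (fun i => ip (ζh t) (φ i), fun j => A μ η (uh t) (ψ j))) :
    (∀ t ∈ Icc 0 T, HasDerivWithinAt α (galerkinField ε η φ ψ (α t)) (Icc 0 T) t) ∧
    (∀ t ∈ Icc 0 T, ∀ x ∈ Icc (0 : ℝ) 1,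
      ζh t x = comb φ (α t).1 x ∧ uh t x = comb ψ (α t).2 x) ∧
    α 0 = (fun i => ip ζ₀ (φ i), fun j => A μ η u₀ (ψ j)) := by
  have hS := isFESpace_Sh M r k
  have hS0 := isFESpace_Sh0 M r k
  have pφ : ∀ i, PC1 (φ i) := fun i => hS.pc1 _ (hφ.mem i)
  have pψ : ∀ i, PC1 (ψ i) := fun i => hS0.pc1 _ (hψ.mem i)
  have eζ : ∀ t ∈ Icc 0 T, ∀ x ∈ Icc (0 : ℝ) 1, ζh t x = comb φ (α t).1 x := fun t ht x hx => by
    rw [hα]; exact hφ.repr _ (h.zeta_mem t ht) x hx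
  have eu : ∀ t ∈ Icc 0 T, ∀ x ∈ Icc (0 : ℝ) 1, uh t x = comb ψ (α t).2 x := fun t ht x hx => by
    rw [hα]; exact hψ.repr _ (h.u_mem t ht) x hx
  refine ⟨fun t ht => ?_, fun t ht x hx => ⟨eζ t ht x hx, eu t ht x hx⟩, ?_⟩
  · obtain ⟨c', hc, ec⟩ := hasDerivWithinAt_coef (M.pt_mem r) hφ h.zeta_mem h.zeta_diff hT ht
    obtain ⟨d', hd, ed⟩ := hasDerivWithinAt_coef (M.pt_mem r) hψ h.u_mem h.u_diff hT ht
    have eζ' := eζ t ht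
    have eu' := eu t ht
    have key : (c', d') = galerkinField ε η φ ψ (α t) := by
      refine Prod.ext (funext fun i => ?_) (funext fun j => ?_)
      · have e1 : ip (dt T ζh t) (φ i) = c' i := by
          rw [ip_congr ec fun _ _ => rfl]
          exact hφ.comb_coef hS isForm_ip c' i
        have e2 : ip (dx fun y => ζh t y * uh t y) (φ i)
            = ip (dx fun y => comb φ (α t).1 y * comb ψ (α t).2 y) (φ i) :=
          ip_congr (dx_congr fun x hx => by rw [eζ' x hx, eu' x hx]) fun _ _ => rfl
        have e3 : ip (dx fun y => η y * uh t y) (φ i)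
            = ip (dx fun y => η y * comb ψ (α t).2 y) (φ i) :=
          ip_congr (dx_congr fun x hx => by rw [eu' x hx]) fun _ _ => rfl
        have e4 := h.mass t ht (φ i) (hφ.mem i)
        rw [e1, e2, e3] at e4
        simp only [galerkinField]
        linarith
      · have e1 : A μ η (dt T uh t) (ψ j) = d' j := by
          rw [A_congr μ η ed fun _ _ => rfl]
          exact hψ.comb_coef hS0 hη.isForm d' j
        have e2 : ip (fun x => η x * dx (ζh t) x) (ψ j)
            = ip (fun x => η x * dx (comb φ (α t).1) x) (ψ j) :=
          ip_congr (fun x hx => by rw [dx_congr eζ' x hx]) fun _ _ => rfl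
        have e3 : ip (fun x => η x * uh t x * dx (uh t) x) (ψ j)
            = ip (fun x => η x * comb ψ (α t).2 x * dx (comb ψ (α t).2) x) (ψ j) :=
          ip_congr (fun x hx => by rw [dx_congr eu' x hx, eu' x hx]) fun _ _ => rfl
        have e4 := h.momentum t ht (ψ j) (hψ.mem j)
        rw [e1, e2, e3] at e4
        simp only [galerkinField]
        linarith
    rw [← key, hα]
    exact hc.prodMk hd
  · rw [hα]
    exact Prod.ext (funext fun i => h.init_zeta.2 _ (hφ.mem i))
      (funext fun j => h.init_u.2 _ (hψ.mem j))

end Galerkin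

/-! ### The energy of the error -/

lemma IsLin.sub {L : (ℝ → ℝ) → ℝ} (hL : IsLin L) {f g : ℝ → ℝ} (hf : PC1 f) (hg : PC1 g) :
    L (fun x => f x - g x) = L f - L g := by
  have h := hL.add f (fun x => (-1) * g x) hf (hg.const_mul _)
  rw [hL.smul _ _ hg] at h
  simpa [sub_eq_add_neg] using h

lemma proj_sub_comb {n : ℕ} (B : (ℝ → ℝ) → (ℝ → ℝ) → ℝ) (φ : Fin n → ℝ → ℝ) (v : ℝ → ℝ)
    (c : Fin n → ℝ) :
    (fun x => proj B φ v x - comb φ c x) = comb φ fun i => B v (φ i) - c i := by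
  funext x
  simp only [proj, comb, ← Finset.sum_sub_distrib, sub_mul]

section Energy
variable {ε μ c₁ c₂ T : ℝ} {η ζ₀ u₀ : ℝ → ℝ} {ζ u : ℝ → ℝ → ℝ} {M : Mesh} {r k n m : ℕ}
  {φ : Fin n → ℝ → ℝ} {ψ : Fin m → ℝ → ℝ} {a : Fin n → Fin M.N × Fin r → ℝ}
  {a' : Fin m → Fin M.N × Fin r → ℝ}

/-- The squared distance between the coordinates of the projections and those of the discrete
solution. -/
noncomputable def coordEnergy (μ : ℝ) (η : ℝ → ℝ) (φ : Fin n → ℝ → ℝ) (ψ : Fin m → ℝ → ℝ)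
    (v w : ℝ → ℝ) (z : (Fin n → ℝ) × (Fin m → ℝ)) : ℝ :=
  ∑ i, (ip v (φ i) - z.1 i) ^ 2 + ∑ j, (A μ η w (ψ j) - z.2 j) ^ 2

/-- Parseval's identity for the two orthonormal bases. -/
lemma coordEnergy_eq (hη : IsBottom μ c₁ c₂ η) (hφ : IsOrthoBasis (Sh M r k) ip (M.pt r) φ a)
    (hψ : IsOrthoBasis (Sh0 M r k) (A μ η) (M.pt r) ψ a') (v w : ℝ → ℝ)
    (z : (Fin n → ℝ) × (Fin m → ℝ)) :
    coordEnergy μ η φ ψ v w z = l2norm (fun x => proj ip φ v x - comb φ z.1 x) ^ 2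
      + A μ η (fun x => proj (A μ η) ψ w x - comb ψ z.2 x)
        (fun x => proj (A μ η) ψ w x - comb ψ z.2 x) := by
  rw [l2norm_sq, proj_sub_comb, proj_sub_comb, hφ.comb_self (isFESpace_Sh M r k) isForm_ip,
    hψ.comb_self (isFESpace_Sh0 M r k) hη.isForm, coordEnergy]

/-- The derivative of the energy along the semidiscrete flow. -/
theorem hasDerivAt_coordEnergy (hr : 1 ≤ r) (hη : IsBottom μ c₁ c₂ η) (hsm : IsSmoothPair T r ζ u)
    (hsol : IsIBVPSolution ε μ T η ζ₀ u₀ ζ u) (hφ : IsOrthoBasis (Sh M r k) ip (M.pt r) φ a)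
    (hψ : IsOrthoBasis (Sh0 M r k) (A μ η) (M.pt r) ψ a')
    {α : ℝ → (Fin n → ℝ) × (Fin m → ℝ)} {t : ℝ} (ht : t ∈ Ioo 0 T)
    (hα : HasDerivAt α (galerkinField ε η φ ψ (α t)) t)
    {ζh uh θ ξ : ℝ → ℝ} (hζh : ζh = comb φ (α t).1) (huh : uh = comb ψ (α t).2)
    (hθ : θ = fun x => proj ip φ (ζ t) x - ζh x)
    (hξ : ξ = fun x => proj (A μ η) ψ (u t) x - uh x) :
    HasDerivAt (fun s => coordEnergy μ η φ ψ (ζ s) (u s) (α s))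
      (2 * (- ε * ip (dx (fun x => ζ t x * u t x - ζh x * uh x)) θ
      - ip (dx (fun x => η x * (u t x - uh x))) θ
      - ip (fun x => η x * dx (fun y => ζ t y - ζh y) x) ξ
      - ε * ip (fun x => η x * (u t x * dx (u t) x - uh x * dx uh x)) ξ)) t := by
  have hS := isFESpace_Sh M r k
  have hS0 := isFESpace_Sh0 M r k
  have pφ : ∀ i, PC1 (φ i) := fun i => hS.pc1 _ (hφ.mem i)
  have pψ : ∀ i, PC1 (ψ i) := fun i => hS0.pc1 _ (hψ.mem i)
  have ht' := Ioo_subset_Icc_self ht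
  have Pζ := hsm.zeta_space.pc1 hr ht'
  have Pu := hsm.u_space.pc1 hr ht'
  have Put := hsm.u_time.pc1 (by norm_num) ht'
  have Eζt : EssBdd (dt T ζ t) := essBdd_of_continuousOn (hsm.zeta_time.jointCont.space ht')
  set b : Fin n → ℝ := fun i => ip (ζ t) (φ i) - (α t).1 i with hb
  set b' : Fin m → ℝ := fun j => A μ η (u t) (ψ j) - (α t).2 j with hb'
  have hθ' : θ = comb φ b := by rw [hθ, hζh, proj_sub_comb]
  have hξ' : ξ = comb ψ b' := by rw [hξ, huh, proj_sub_comb]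
  have Pθ : PC1 θ := hθ' ▸ PC1.comb pφ b
  have hξm : ξ ∈ Sh0 M r k := hξ' ▸ hS0.comb_mem hψ.mem b'
  have Pξ : PC1 ξ := hS0.pc1 _ hξm
  have Pζh : PC1 ζh := hζh ▸ PC1.comb pφ _
  have Puh : PC1 uh := huh ▸ PC1.comb pψ _
  have d1 := hasDerivAt_pi.1 hα.fst
  have d2 := hasDerivAt_pi.1 hα.snd
  have D1 : HasDerivAt (fun s => ∑ i, (ip (ζ s) (φ i) - (α s).1 i) ^ 2)
      (∑ i, 2 * b i * (ip (dt T ζ t) (φ i) - (galerkinField ε η φ ψ (α t)).1 i)) t := by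
    refine HasDerivAt.fun_sum fun i _ => ?_
    have h1 := (hsm.zeta_space.jointCont.hasDerivAt_ip hsm.zeta_time.jointCont
      (fun t ht x hx => hasDerivAt_dt hsm.zeta_diff ht hx) (pφ i).essBdd ht).sub (d1 i)
    simpa [hb] using h1.fun_pow 2
  have D2 : HasDerivAt (fun s => ∑ j, (A μ η (u s) (ψ j) - (α s).2 j) ^ 2)
      (∑ j, 2 * b' j * (A μ η (dt T u t) (ψ j) - (galerkinField ε η φ ψ (α t)).2 j)) t := by
    refine HasDerivAt.fun_sum fun j _ => ?_
    have h1 := (hsm.hasDerivAt_A hr hη (pψ j) ht).sub (d2 j)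
    simpa [hb'] using h1.fun_pow 2
  refine (D1.add D2).congr_deriv ?_
  -- The b i are the coefficients of θ, so the sum is the weak equation tested with θ. The
  -- projection disappears and only ζ_t remains; the same happens for ξ.
  have s1 : ∑ i, 2 * b i * (ip (dt T ζ t) (φ i) - (galerkinField ε η φ ψ (α t)).1 i)
      = 2 * (ip (dt T ζ t) θ - (- ε * ip (dx fun y => ζh y * uh y) θ
        - ip (dx fun y => η y * uh y) θ)) := by
    rw [hθ', ip_comb_right Eζt pφ, hζh, huh, ← galerkinField_fst_sum hη.pc1 pφ pψ,
      ← Finset.sum_sub_distrib, Finset.mul_sum]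
    exact Finset.sum_congr rfl fun i _ => by ring
  have s2 : ∑ j, 2 * b' j * (A μ η (dt T u t) (ψ j) - (galerkinField ε η φ ψ (α t)).2 j)
      = 2 * (A μ η (dt T u t) ξ - (- ip (fun x => η x * dx ζh x) ξ
        - ε * ip (fun x => η x * uh x * dx uh x) ξ)) := by
    rw [hξ', hη.isForm.comb_right pψ Put, hζh, huh, ← galerkinField_snd_sum hη.pc1 pφ pψ,
      ← Finset.sum_sub_distrib, Finset.mul_sum]
    exact Finset.sum_congr rfl fun i _ => by ring
  have w1 := hsol.weak_mass hsm hr hη Pθ.essBdd ht'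
  have w2 := hsol.weak_momentum hsm hr hη Pξ hξm.2.1 hξm.2.2 ht'
  have l1 : ip (dx (fun x => ζ t x * u t x - ζh x * uh x)) θ = _ :=
    (isLin_dx Pθ.essBdd).sub (Pζ.mul Pu) (Pζh.mul Puh)
  have l2 : ip (dx (fun x => η x * (u t x - uh x))) θ = _ :=
    (isLin_dx_mul hη.pc1 Pθ.essBdd).sub Pu Puh
  have l3 : ip (fun x => η x * dx (fun y => ζ t y - ζh y) x) ξ = _ :=
    (isLin_mul_dx hη.pc1.essBdd Pξ.essBdd).sub Pζ Pζh
  have l4 : ip (fun x => η x * (u t x * dx (u t) x - uh x * dx uh x)) ξ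
      = ip (fun x => η x * u t x * dx (u t) x) ξ - ip (fun x => η x * uh x * dx uh x) ξ := by
    have hE := hη.pc1.essBdd
    rw [← ip_sub_left ((hE.mul Pu.essBdd).mul Pu.bdd) ((hE.mul Puh.essBdd).mul Puh.bdd) Pξ.essBdd]
    exact ip_congr (fun x _ => by ring) fun _ _ => rfl
  rw [s1, s2, w1, w2, l1, l2, l3, l4]
  ring

lemma continuousOn_coordEnergy (hr : 1 ≤ r) (hη : IsBottom μ c₁ c₂ η) (hsm : IsSmoothPair T r ζ u)
    (hφ : IsOrthoBasis (Sh M r k) ip (M.pt r) φ a)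
    (hψ : IsOrthoBasis (Sh0 M r k) (A μ η) (M.pt r) ψ a')
    {α : ℝ → (Fin n → ℝ) × (Fin m → ℝ)} (hα : ContinuousOn α (Icc 0 T)) :
    ContinuousOn (fun s => coordEnergy μ η φ ψ (ζ s) (u s) (α s)) (Icc 0 T) := by
  have pφ : ∀ i, PC1 (φ i) := fun i => (isFESpace_Sh M r k).pc1 _ (hφ.mem i)
  have pψ : ∀ i, PC1 (ψ i) := fun i => (isFESpace_Sh0 M r k).pc1 _ (hψ.mem i)
  have h1 := continuousOn_pi.1 (continuous_fst.comp_continuousOn hα)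
  have h2 := continuousOn_pi.1 (continuous_snd.comp_continuousOn hα)
  refine (continuousOn_finsetSum _ fun i _ => ContinuousOn.pow ?_ 2).add
    (continuousOn_finsetSum _ fun j _ => ContinuousOn.pow ?_ 2)
  · exact (hsm.zeta_space.jointCont.continuousOn_ip (pφ i).essBdd).sub (h1 i)
  · exact (hsm.continuousOn_A hr hη (pψ j)).sub (h2 j)

/-- Constants that bound the data uniformly in time. -/
structure DataBound (K : ℝ) (η ζ u : ℝ → ℝ) : Prop where
  eta : ∀ x ∈ Icc (0 : ℝ) 1, |η x| ≤ K
  eta' : ∀ x ∈ Icc (0 : ℝ) 1, |dx η x| ≤ K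
  zeta : ∀ x ∈ Icc (0 : ℝ) 1, |ζ x| ≤ K
  zeta' : ∀ x ∈ Icc (0 : ℝ) 1, |dx ζ x| ≤ K
  vel : ∀ x ∈ Icc (0 : ℝ) 1, |u x| ≤ K
  vel' : ∀ x ∈ Icc (0 : ℝ) 1, |dx u x| ≤ K

lemma exists_dataBound (hr : 1 ≤ r) (hη : IsBottom μ c₁ c₂ η) (hsm : IsSmoothPair T r ζ u) :
    ∃ K, 1 ≤ K ∧ ∀ t ∈ Icc 0 T, DataBound K η (ζ t) (u t) := by
  obtain ⟨K₁, h₁, b₁⟩ := exists_bound hη.cont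
  obtain ⟨K₂, h₂, b₂⟩ := exists_bound hη.dx_smooth.continuousOn
  obtain ⟨K₃, h₃, b₃⟩ := hsm.zeta_space.jointCont.bound
  obtain ⟨K₄, h₄, b₄⟩ := (hsm.zeta_space.jointCont_dx hr).bound
  obtain ⟨K₅, h₅, b₅⟩ := hsm.u_space.jointCont.bound
  obtain ⟨K₆, h₆, b₆⟩ := (hsm.u_space.jointCont_dx hr).bound
  refine ⟨1 + K₁ + K₂ + K₃ + K₄ + K₅ + K₆, by linarith, fun t ht =>
    ⟨fun x hx => (b₁ x hx).trans (by linarith), fun x hx => (b₂ x hx).trans (by linarith),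
    fun x hx => (b₃ t ht x hx).trans (by linarith), fun x hx => (b₄ t ht x hx).trans (by linarith),
    fun x hx => (b₅ t ht x hx).trans (by linarith),
    fun x hx => (b₆ t ht x hx).trans (by linarith)⟩⟩

lemma DataBound.mono {K K' : ℝ} {ζ u : ℝ → ℝ} (h : DataBound K η ζ u) (hK : K ≤ K') :
    DataBound K' η ζ u :=
  ⟨fun x hx => (h.eta x hx).trans hK, fun x hx => (h.eta' x hx).trans hK,
    fun x hx => (h.zeta x hx).trans hK, fun x hx => (h.zeta' x hx).trans hK,
    fun x hx => (h.vel x hx).trans hK, fun x hx => (h.vel' x hx).trans hK⟩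

lemma ContInTime.exists_iteratedDeriv_bound {w : ℝ → ℝ → ℝ} (h : ContInTime T r w) :
    ∃ K, 0 ≤ K ∧ ∀ t ∈ Icc 0 T, ∀ x ∈ Icc (0 : ℝ) 1,
      |iteratedDerivWithin r (w t) (Icc 0 1) x| ≤ K :=
  JointCont.bound (w := fun t => iteratedDerivWithin r (w t) (Icc 0 1)) (h.2 r le_rfl)

end Energy

/-! ### The error estimate on a fixed mesh -/

section Fixed
variable {ε μ c₁ c₂ T : ℝ} {η ζ₀ u₀ : ℝ → ℝ} {ζ u : ℝ → ℝ → ℝ} {M : Mesh} {r k n m : ℕ}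
  {φ : Fin n → ℝ → ℝ} {ψ : Fin m → ℝ → ℝ} {a : Fin n → Fin M.N × Fin r → ℝ}
  {a' : Fin m → Fin M.N × Fin r → ℝ}

/-- As long as the energy is small, it grows at most exponentially. -/
lemma energy_deriv_le {K κ Cs δ c : ℝ} (hr : 1 ≤ r) (hε : 0 < ε) (hη : IsBottom μ c₁ c₂ η)
    (hsm : IsSmoothPair T r ζ u) (hsol : IsIBVPSolution ε μ T η ζ₀ u₀ ζ u)
    (hφ : IsOrthoBasis (Sh M r k) ip (M.pt r) φ a)
    (hψ : IsOrthoBasis (Sh0 M r k) (A μ η) (M.pt r) ψ a')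
    (hK : 1 ≤ K) (hδ0 : 0 ≤ δ) (hδ1 : δ ≤ 1) {t : ℝ} (ht : t ∈ Icc 0 T)
    (hdata : DataBound K η (ζ t) (u t))
    (hρ : l2norm (fun x => ζ t x - proj ip φ (ζ t) x) ≤ K * δ)
    (hρ' : l2norm (dx (fun x => ζ t x - proj ip φ (ζ t) x)) ≤ K * δ)
    (hσ' : l2norm (dx (fun x => u t x - proj (A μ η) ψ (u t) x)) ≤ K * δ)
    (hCs : 0 ≤ Cs) (hinv : ∀ v ∈ Sh M r k, ∀ x ∈ Icc (0 : ℝ) 1, v x ^ 2 * M.h ≤ Cs * ip v v)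
    (hκ : Cs * κ ≤ 1) (hc : c = μ / 3 * c₁ ^ 3) (hκc : κ ≤ c)
    {z : (Fin n → ℝ) × (Fin m → ℝ)} (hz : coordEnergy μ η φ ψ (ζ t) (u t) z ≤ κ * M.h)
    {ζh uh θ ξ : ℝ → ℝ} (hζh : ζh = comb φ z.1) (huh : uh = comb ψ z.2)
    (hθ : θ = fun x => proj ip φ (ζ t) x - ζh x)
    (hξ : ξ = fun x => proj (A μ η) ψ (u t) x - uh x) :
    2 * (- ε * ip (dx (fun x => ζ t x * u t x - ζh x * uh x)) θ
      - ip (dx (fun x => η x * (u t x - uh x))) θ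
      - ip (fun x => η x * dx (fun y => ζ t y - ζh y) x) ξ
      - ε * ip (fun x => η x * (u t x * dx (u t) x - uh x * dx uh x)) ξ)
    ≤ 2 * ((48 * ε + 15) * K ^ 3) * (1 + 1 / c)
      * (δ ^ 2 + coordEnergy μ η φ ψ (ζ t) (u t) z) := by
  have hS := isFESpace_Sh M r k
  have hS0 := isFESpace_Sh0 M r k
  have hc0 : 0 < c := by have := hη.mu_pos; have := hη.c1_pos; rw [hc]; positivity
  have hh := M.h_pos
  have mp := hφ.proj_mem hS (ζ t)
  have mq := hψ.proj_mem hS0 (u t)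
  have mζh : ζh ∈ Sh M r k := hζh ▸ hS.comb_mem hφ.mem _
  have muh : uh ∈ Sh0 M r k := huh ▸ hS0.comb_mem hψ.mem _
  have mθ : θ ∈ Sh M r k := hθ ▸ hS.sub mp mζh
  have mξ : ξ ∈ Sh0 M r k := hξ ▸ hS0.sub mq muh
  have hE := coordEnergy_eq hη hφ hψ (ζ t) (u t) z
  rw [← hζh, ← huh, ← hθ, ← hξ] at hE
  have hco := hη.coercive (hS0.pc1 _ mξ)
  rw [← hc] at hco
  set Y := coordEnergy μ η φ ψ (ζ t) (u t) z with hY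
  have hAξ := hη.isForm.nonneg _ (hS0.pc1 _ mξ)
  have hθ2 : l2norm θ ^ 2 ≤ Y := by linarith
  have hξ2 : c * l2norm (dx ξ) ^ 2 ≤ Y := by
    have := sq_nonneg (l2norm θ)
    linarith
  have Y0 : 0 ≤ Y := (sq_nonneg _).trans hθ2
  -- The inverse inequality gives θ² h ≤ Cs ‖θ‖² ≤ Cs κ h ≤ h.
  have bθ : ∀ x ∈ Icc (0 : ℝ) 1, |θ x| ≤ 1 := fun x hx => by
    have h1 := hinv θ mθ x hx
    rw [← l2norm_sq] at h1
    have h2 := mul_le_mul_of_nonneg_left (hθ2.trans hz) hCs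
    have h3 := mul_le_mul_of_nonneg_right hκ hh.le
    have h4 : θ x ^ 2 ≤ 1 := le_of_mul_le_mul_right (by linarith) hh
    exact (sq_le_one_iff_abs_le_one _).1 h4
  -- Here coercivity gives c ‖ξ'‖² ≤ κ h ≤ c, because κ ≤ c and h ≤ 1.
  have bξ : l2norm (dx ξ) ≤ 1 := by
    have h1 : c * l2norm (dx ξ) ^ 2 ≤ c * 1 := by
      have h2 := mul_le_mul hκc M.h_le_one hh.le hc0.le
      linarith
    have h4 := le_of_mul_le_mul_left h1 hc0
    exact (abs_le.1 ((sq_le_one_iff_abs_le_one _).1 h4)).2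
  have Pu := hsm.u_space.pc1 hr ht
  have key := energy_rhs_le (p := proj ip φ (ζ t)) (q := proj (A μ η) ψ (u t)) (ζh := ζh) (uh := uh)
    hε hK hδ0 hδ1 hη.pc1 (hsm.zeta_space.pc1 hr ht) Pu (hS.pc1 _ mp) (hS0.pc1 _ mq)
    (hS.pc1 _ mζh) (hS0.pc1 _ muh) hdata.eta hdata.eta' hdata.zeta hdata.zeta' hdata.vel hdata.vel'
    (hsol.bdry_left t ht) mq.2.1 mq.2.2 muh.2.1 muh.2.2 hρ hρ' hσ' (by rwa [hθ] at bθ)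
    (by rwa [hξ] at bξ)
  rw [← hθ, ← hξ] at key
  have h5 : l2norm (dx ξ) ^ 2 ≤ 1 / c * Y := by
    rw [one_div, ← div_eq_inv_mul, le_div_iff₀ hc0]
    linarith
  have h6 : δ ^ 2 + l2norm θ ^ 2 + l2norm (dx ξ) ^ 2 ≤ (1 + 1 / c) * (δ ^ 2 + Y) := by
    have : 0 ≤ 1 / c * δ ^ 2 := by positivity
    linarith
  have h7 := mul_le_mul_of_nonneg_left h6 (show 0 ≤ (48 * ε + 15) * K ^ 3 by positivity)
  linarith

/-- Existence and the energy bound for the semidiscrete trajectory. -/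
lemma exists_trajectory {K κ Cs δ c B : ℝ} (hr : 1 ≤ r) (hT : 0 < T) (hε : 0 < ε)
    (hη : IsBottom μ c₁ c₂ η)
    (hsm : IsSmoothPair T r ζ u) (hsol : IsIBVPSolution ε μ T η ζ₀ u₀ ζ u)
    (hφ : IsOrthoBasis (Sh M r k) ip (M.pt r) φ a)
    (hψ : IsOrthoBasis (Sh0 M r k) (A μ η) (M.pt r) ψ a')
    (hK : 1 ≤ K) (hδ0 : 0 ≤ δ) (hδ1 : δ ≤ 1) (hdata : ∀ t ∈ Icc 0 T, DataBound K η (ζ t) (u t))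
    (hρ : ∀ t ∈ Icc 0 T, l2norm (fun x => ζ t x - proj ip φ (ζ t) x) ≤ K * δ)
    (hρ' : ∀ t ∈ Icc 0 T, l2norm (dx (fun x => ζ t x - proj ip φ (ζ t) x)) ≤ K * δ)
    (hσ' : ∀ t ∈ Icc 0 T, l2norm (dx (fun x => u t x - proj (A μ η) ψ (u t) x)) ≤ K * δ)
    (hCs : 0 ≤ Cs) (hinv : ∀ v ∈ Sh M r k, ∀ x ∈ Icc (0 : ℝ) 1, v x ^ 2 * M.h ≤ Cs * ip v v)
    (hκ0 : 0 < κ) (hκ1 : κ ≤ 1) (hκ : Cs * κ ≤ 1) (hc : c = μ / 3 * c₁ ^ 3) (hκc : κ ≤ c)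
    (hB : B = 2 * ((48 * ε + 15) * K ^ 3) * (1 + 1 / c))
    (hsmall : δ ^ 2 * Real.exp (B * T) < κ * M.h) :
    ∃ α : ℝ → (Fin n → ℝ) × (Fin m → ℝ),
      α 0 = (fun i => ip (ζ 0) (φ i), fun j => A μ η (u 0) (ψ j)) ∧
      (∀ t ∈ Icc 0 T, HasDerivWithinAt α (galerkinField ε η φ ψ (α t)) (Icc 0 T) t) ∧
      ∀ t ∈ Icc 0 T, coordEnergy μ η φ ψ (ζ t) (u t) (α t) ≤ δ ^ 2 * Real.exp (B * T) := by
  have pφ : ∀ i, PC1 (φ i) := fun i => (isFESpace_Sh M r k).pc1 _ (hφ.mem i)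
  have pψ : ∀ i, PC1 (ψ i) := fun i => (isFESpace_Sh0 M r k).pc1 _ (hψ.mem i)
  have hh := M.h_pos
  have hc0 : 0 < c := by have := hη.mu_pos; have := hη.c1_pos; rw [hc]; positivity
  have hB0 : 0 ≤ B := by rw [hB]; positivity
  -- π(t) collects the coordinates of the two projections, bounded by R. The cutoff at R + 1 leaves
  -- room for a distance of one, which the energy bound Y ≤ κ h ≤ 1 ensures for the trajectory.
  let π : ℝ → (Fin n → ℝ) × (Fin m → ℝ) :=
    fun t => (fun i => ip (ζ t) (φ i), fun j => A μ η (u t) (ψ j))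
  have hπ : ContinuousOn π (Icc 0 T) :=
    (continuousOn_pi.2 fun i => hsm.zeta_space.jointCont.continuousOn_ip (pφ i).essBdd).prodMk
      (continuousOn_pi.2 fun j => hsm.continuousOn_A hr hη (pψ j))
  obtain ⟨R, hR⟩ := isCompact_Icc.exists_bound_of_continuousOn hπ
  obtain ⟨F, KF, LF, hF, hFL, hFG⟩ :=
    exists_cutoff (contDiff_galerkinField ε hη.pc1 pφ pψ) (R + 1)
  obtain ⟨α, hα0, hα⟩ := exists_solution_of_lipschitz hF hFL hT.le (π 0)
  have cα : ContinuousOn α (Icc 0 T) := fun t ht => (hα t ht).continuousWithinAt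
  set Y : ℝ → ℝ := fun t => coordEnergy μ η φ ψ (ζ t) (u t) (α t) with hY
  have hYc : ContinuousOn Y (Icc 0 T) := continuousOn_coordEnergy hr hη hsm hφ hψ cα
  have hY0 : Y 0 = 0 := by simp [hY, coordEnergy, hα0, π]
  have hball : ∀ t ∈ Icc 0 T, Y t ≤ κ * M.h → F (α t) = galerkinField ε η φ ψ (α t) := by
    intro t ht hYt
    have hY1 : Y t ≤ 1 := hYt.trans (mul_le_one₀ hκ1 hh.le M.h_le_one)
    have n1 : 0 ≤ ∑ i, (ip (ζ t) (φ i) - (α t).1 i) ^ 2 := Finset.sum_nonneg fun _ _ => sq_nonneg _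
    have n2 : 0 ≤ ∑ j, (A μ η (u t) (ψ j) - (α t).2 j) ^ 2 :=
      Finset.sum_nonneg fun _ _ => sq_nonneg _
    have hYe : Y t = ∑ i, (ip (ζ t) (φ i) - (α t).1 i) ^ 2
      + ∑ j, (A μ η (u t) (ψ j) - (α t).2 j) ^ 2 := rfl
    have hd : ‖π t - α t‖ ≤ 1 := by
      refine max_le ?_ ?_
      · refine (pi_norm_le_iff_of_nonneg zero_le_one).2 fun i => ?_
        have h1 := Finset.single_le_sum (f := fun i => (ip (ζ t) (φ i) - (α t).1 i) ^ 2)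
          (fun _ _ => sq_nonneg _) (Finset.mem_univ i)
        exact (sq_le_one_iff_abs_le_one _).1 (h1.trans (by linarith))
      · refine (pi_norm_le_iff_of_nonneg zero_le_one).2 fun j => ?_
        have h1 := Finset.single_le_sum (f := fun j => (A μ η (u t) (ψ j) - (α t).2 j) ^ 2)
          (fun _ _ => sq_nonneg _) (Finset.mem_univ j)
        exact (sq_le_one_iff_abs_le_one _).1 (h1.trans (by linarith))
    refine hFG _ ?_
    have h1 : α t = π t - (π t - α t) := by abel
    rw [h1]
    exact (norm_sub_le _ _).trans (add_le_add (hR t ht) hd)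
  -- Conditional on Y ≤ κ h up to time t, the truncated field is the true one and Gronwall's
  -- inequality applies. The next use of `lt_of_continuation`, with `hsmall`, discharges the
  -- condition.
  have hgron : ∀ t ∈ Icc 0 T, (∀ s ∈ Icc 0 t, Y s ≤ κ * M.h) → Y t ≤ δ ^ 2 * Real.exp (B * T) := by
    intro t ht hs
    have hsub : ∀ s ∈ Ioo 0 t, s ∈ Ioo 0 T := fun s h => ⟨h.1, h.2.trans_le ht.2⟩
    have hder : ∀ s ∈ Ioo 0 t, HasDerivAt Y (deriv Y s) s ∧ deriv Y s ≤ B * (δ ^ 2 + Y s) := by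
      intro s hst
      have hsT := hsub s hst
      have hYs := hs s (Ioo_subset_Icc_self hst)
      have hd := (hα s (Ioo_subset_Icc_self hsT)).hasDerivAt (Icc_mem_nhds hsT.1 hsT.2)
      rw [hball s (Ioo_subset_Icc_self hsT) hYs] at hd
      have h1 := hasDerivAt_coordEnergy hr hη hsm hsol hφ hψ hsT hd rfl rfl rfl rfl
      have h2 := energy_deriv_le hr hε hη hsm hsol hφ hψ hK hδ0 hδ1 (Ioo_subset_Icc_self hsT)
        (hdata s (Ioo_subset_Icc_self hsT)) (hρ s (Ioo_subset_Icc_self hsT))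
        (hρ' s (Ioo_subset_Icc_self hsT)) (hσ' s (Ioo_subset_Icc_self hsT)) hCs hinv hκ hc hκc hYs
        rfl rfl rfl rfl
      rw [← hB] at h2
      have h3 : HasDerivAt Y _ s := h1
      rw [h3.deriv]
      exact ⟨h3, h2⟩
    have h1 := gronwall_Ioo (hYc.mono (Icc_subset_Icc_right ht.2)) (fun s h => (hder s h).1)
      (fun s h => (hder s h).2) hY0 ht.1
    have h2 : Real.exp (B * t) ≤ Real.exp (B * T) :=
      Real.exp_le_exp.2 (mul_le_mul_of_nonneg_left ht.2 hB0)
    have h3 := mul_le_mul_of_nonneg_left h2 (sq_nonneg δ)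
    linarith [sq_nonneg δ]
  have hall := lt_of_continuation hYc (δ := κ * M.h) (by rw [hY0]; positivity)
    fun t ht hs => (hgron t ht hs).trans_lt hsmall
  refine ⟨α, hα0, fun t ht => ?_, fun t ht => hgron t ht fun s hs =>
    (hall s ⟨hs.1, hs.2.trans ht.2⟩).le⟩
  rw [← hball t ht (hall t ht).le]
  exact hα t ht

end Fixed

/-! ### From the energy bound to the error estimate. -/

lemma PC1.h1norm_le_of_zero {f : ℝ → ℝ} (hf : PC1 f) (h0 : f 0 = 0) :
    h1norm f ≤ 2 * l2norm (dx f) := by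
  have h1 := hf.l2norm_le_of_zero h0
  have n0 := l2norm_nonneg f
  have n1 := l2norm_nonneg (dx f)
  rw [h1norm, ← l2norm_sq, ← l2norm_sq]
  refine Real.sqrt_le_iff.2 ⟨by positivity, ?_⟩
  have := pow_le_pow_left₀ n0 h1 2
  nlinarith

/-- The error bound that follows from the bound of the energy. -/
lemma error_le {μ c₁ c₂ K δ D c : ℝ} {η ζ u : ℝ → ℝ} {M : Mesh} {r k n m : ℕ}
    {φ : Fin n → ℝ → ℝ} {ψ : Fin m → ℝ → ℝ} {a : Fin n → Fin M.N × Fin r → ℝ}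
    {a' : Fin m → Fin M.N × Fin r → ℝ} (hη : IsBottom μ c₁ c₂ η)
    (hφ : IsOrthoBasis (Sh M r k) ip (M.pt r) φ a)
    (hψ : IsOrthoBasis (Sh0 M r k) (A μ η) (M.pt r) ψ a') (hζ : PC1 ζ) (hu : PC1 u) (u0 : u 0 = 0)
    (hδ0 : 0 ≤ δ) (hρ : l2norm (fun x => ζ x - proj ip φ ζ x) ≤ K * δ)
    (hσ' : l2norm (dx (fun x => u x - proj (A μ η) ψ u x)) ≤ K * δ)
    (hc : c = μ / 3 * c₁ ^ 3) (hD : 0 ≤ D) {z : (Fin n → ℝ) × (Fin m → ℝ)}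
    (hz : coordEnergy μ η φ ψ ζ u z ≤ δ ^ 2 * D) :
    l2norm (fun x => ζ x - comb φ z.1 x) + h1norm (fun x => u x - comb ψ z.2 x)
      ≤ (3 * K + Real.sqrt D + 2 * Real.sqrt (D / c)) * δ := by
  have hS := isFESpace_Sh M r k
  have hS0 := isFESpace_Sh0 M r k
  have hc0 : 0 < c := by have := hη.mu_pos; have := hη.c1_pos; rw [hc]; positivity
  have mp := hφ.proj_mem hS ζ
  have mq := hψ.proj_mem hS0 u
  have mζ : comb φ z.1 ∈ Sh M r k := hS.comb_mem hφ.mem _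
  have mu : comb ψ z.2 ∈ Sh0 M r k := hS0.comb_mem hψ.mem _
  have mξ := hS0.sub mq mu
  have hE := coordEnergy_eq hη hφ hψ ζ u z
  have hco := hη.coercive (hS0.pc1 _ mξ)
  rw [← hc] at hco
  have hA0 := hη.isForm.nonneg _ (hS0.pc1 _ mξ)
  have h1 : l2norm (fun x => proj ip φ ζ x - comb φ z.1 x) ≤ Real.sqrt D * δ := by
    apply le_of_sq_le_sq _ (by positivity)
    rw [mul_pow, Real.sq_sqrt hD]
    linarith
  have h2 : l2norm (dx fun x => proj (A μ η) ψ u x - comb ψ z.2 x) ≤ Real.sqrt (D / c) * δ := by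
    apply le_of_sq_le_sq _ (by positivity)
    rw [mul_pow, Real.sq_sqrt (by positivity), div_mul_eq_mul_div, le_div_iff₀ hc0]
    have := sq_nonneg (l2norm fun x => proj ip φ ζ x - comb φ z.1 x)
    linarith
  have P1 := hζ.sub (hS.pc1 _ mp)
  have P2 := hS.pc1 _ (hS.sub mp mζ)
  have P3 := hu.sub (hS0.pc1 _ mq)
  have P4 := hS0.pc1 _ mξ
  have e1 : (fun x => ζ x - comb φ z.1 x)
      = fun x => (ζ x - proj ip φ ζ x) + (proj ip φ ζ x - comb φ z.1 x) := by funext x; ring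
  have e2 : (fun x => u x - comb ψ z.2 x)
      = fun x => (u x - proj (A μ η) ψ u x) + (proj (A μ η) ψ u x - comb ψ z.2 x) := by
    funext x; ring
  have h3 := l2norm_add_le P1.essBdd P2.essBdd
  -- Passing from H¹ to the derivative costs a factor 2. Hence 3K = K + 2K and the 2 in front of the
  -- last root.
  have h4 := (P3.add P4).h1norm_le_of_zero (by simp [u0, mu.2.1])
  have h5 := P3.l2norm_dx_add_le P4
  rw [e1, e2]
  linarith

/-- The error estimate for a general bottom topography. -/
theorem galerkin_error_estimate {ε μ c₁ c₂ T : ℝ} (hε : 0 < ε) (hT : 0 < T) {η ζ₀ u₀ : ℝ → ℝ}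
    {ζ u : ℝ → ℝ → ℝ} {r k : ℕ} (hr : 2 ≤ r) (hk : k ≤ r - 2) (hη : IsBottom μ c₁ c₂ η)
    (hsm : IsSmoothPair T r ζ u) (hsol : IsIBVPSolution ε μ T η ζ₀ u₀ ζ u) (ν : ℝ) :
    ∃ h₀ > (0 : ℝ), ∃ C : ℝ, ∀ M : Mesh, M.Quasiuniform ν → M.h ≤ h₀ →
      ∃ ζh uh : ℝ → ℝ → ℝ, IsSemidiscreteSolution ε μ T η ζ₀ u₀ M r k ζh uh ∧
        (∀ ζh' uh' : ℝ → ℝ → ℝ, IsSemidiscreteSolution ε μ T η ζ₀ u₀ M r k ζh' uh' →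
          ∀ t ∈ Icc 0 T, ∀ x ∈ Icc (0 : ℝ) 1, ζh' t x = ζh t x ∧ uh' t x = uh t x) ∧
        ∀ t ∈ Icc 0 T, l2norm (fun x => ζ t x - ζh t x) + h1norm (fun x => u t x - uh t x)
          ≤ C * M.h ^ (r - 1) := by
  have hr1 : 1 ≤ r := by omega
  obtain ⟨K₁, hK₁, hdata⟩ := exists_dataBound hr1 hη hsm
  obtain ⟨Kζ, hKζ, bζ⟩ := hsm.zeta_space.exists_iteratedDeriv_bound
  obtain ⟨Ku, hKu, bu⟩ := hsm.u_space.exists_iteratedDeriv_bound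
  obtain ⟨CP, hCP, errP⟩ := exists_l2Projection_error hr ν
  obtain ⟨CA, hCA, errA⟩ := exists_ellipticProjection_error hr hη
  obtain ⟨Cs, hCs, hinv⟩ := exists_inverse_sup r ν
  obtain ⟨c, hc⟩ : ∃ c, c = μ / 3 * c₁ ^ 3 := ⟨_, rfl⟩
  have hc0 : 0 < c := by have := hη.mu_pos; have := hη.c1_pos; rw [hc]; positivity
  have nP : 0 ≤ CP * Kζ := mul_nonneg hCP hKζ
  have nA : 0 ≤ CA * Ku := mul_nonneg hCA hKu
  obtain ⟨K, hKd⟩ : ∃ K, K = K₁ + CP * Kζ + CA * Ku := ⟨_, rfl⟩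
  have hK : 1 ≤ K := by linarith
  -- The three entries of the minimum yield, in turn, energy at most 1 (inside the cutoff ball),
  -- ‖ξ'‖ ≤ 1 and |θ| ≤ 1.
  obtain ⟨κ, hκd⟩ : ∃ κ, κ = min 1 (min c (1 / (Cs + 1))) := ⟨_, rfl⟩
  have hκ0 : 0 < κ := by rw [hκd]; positivity
  have hκ1 : κ ≤ 1 := by rw [hκd]; exact min_le_left _ _
  have hκc : κ ≤ c := by rw [hκd]; exact (min_le_right _ _).trans (min_le_left _ _)
  have hκs : Cs * κ ≤ 1 := by
    have h1 : κ ≤ 1 / (Cs + 1) := by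
      rw [hκd]; exact (min_le_right _ _).trans (min_le_right _ _)
    rw [le_div_iff₀ (by positivity)] at h1
    linarith
  obtain ⟨B, hB⟩ : ∃ B, B = 2 * ((48 * ε + 15) * K ^ 3) * (1 + 1 / c) := ⟨_, rfl⟩
  have hexp := Real.exp_pos (B * T)
  -- Since r ≥ 2 and h ≤ 1, δ = h^(r-1) ≤ h. This h₀ then makes δ² e^(BT) ≤ h² e^(BT) ≤ κ h / 2,
  -- strictly below the threshold κ h.
  refine ⟨κ / (2 * Real.exp (B * T)), by positivity,
    3 * K + Real.sqrt (Real.exp (B * T)) + 2 * Real.sqrt (Real.exp (B * T) / c),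
    fun M hν hMh => ?_⟩
  have hh := M.h_pos
  have hδ0 : 0 ≤ M.h ^ (r - 1) := by positivity
  have hδh : M.h ^ (r - 1) ≤ M.h := pow_le_of_le_one hh.le M.h_le_one (by omega)
  have hδ1 := hδh.trans M.h_le_one
  have hsmall : (M.h ^ (r - 1)) ^ 2 * Real.exp (B * T) < κ * M.h := by
    rw [le_div_iff₀ (by positivity)] at hMh
    have h1 := mul_le_mul_of_nonneg_right (pow_le_pow_left₀ hδ0 hδh 2) hexp.le
    have h2 := mul_le_mul_of_nonneg_left hMh hh.le
    have h3 : 0 < κ * M.h := by positivity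
    nlinarith
  obtain ⟨n, φ, a, hφ⟩ := exists_basis_Sh (r := r) M k (by omega)
  obtain ⟨m, ψ, a', hψ⟩ := exists_basis_Sh0 (r := r) hη M k (by omega)
  have hρ : ∀ t ∈ Icc 0 T, l2norm (fun x => ζ t x - proj ip φ (ζ t) x) ≤ K * M.h ^ (r - 1) ∧
      l2norm (dx (fun x => ζ t x - proj ip φ (ζ t) x)) ≤ K * M.h ^ (r - 1) := fun t ht => by
    obtain ⟨h1, h2⟩ := errP M k hν hk (ζ t) Kζ hKζ (hsm.zeta_space.1 t ht) (bζ t ht) hφ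
    have h3 : CP * Kζ * M.h ^ (r - 1) ≤ K * M.h ^ (r - 1) :=
      mul_le_mul_of_nonneg_right (by linarith) hδ0
    exact ⟨h1.trans h3, h2.trans h3⟩
  have hσ : ∀ t ∈ Icc 0 T, l2norm (dx (fun x => u t x - proj (A μ η) ψ (u t) x))
      ≤ K * M.h ^ (r - 1) := fun t ht => by
    refine (errA M k hk (u t) Ku hKu (hsm.u_space.1 t ht) (hsol.bdry_left t ht)
      (hsol.bdry_right t ht) (bu t ht) hψ).trans ?_
    exact mul_le_mul_of_nonneg_right (by linarith) hδ0
  obtain ⟨α, hα0, hα, hαE⟩ := exists_trajectory hr1 hT hε hη hsm hsol hφ hψ hK hδ0 hδ1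
    (fun t ht => (hdata t ht).mono (by linarith)) (fun t ht => (hρ t ht).1)
    (fun t ht => (hρ t ht).2) hσ hCs (hinv M k hν) hκ0 hκ1 hκs hc hκc hB hsmall
  have m0 : (0 : ℝ) ∈ Icc 0 T := ⟨le_rfl, hT.le⟩
  refine ⟨fun t => comb φ (α t).1, fun t => comb ψ (α t).2,
    isSemidiscreteSolution_of_coords hT hη hφ hψ (hsm.zeta_space.pc1 hr1 m0)
      (hsm.u_space.pc1 hr1 m0) hsol.init_zeta hsol.init_u hα0 hα, fun ζh' uh' hsd t ht x hx => ?_,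
    fun t ht => ?_⟩
  · obtain ⟨hβ, hβr, hβ0⟩ := hsd.coords hT hη hφ hψ rfl
    -- The data ζ₀ and u₀ agree with ζ and u at time zero only on [0,1], which is all that the inner
    -- products see.
    have e0 : α 0 = (fun i => ip ζ₀ (φ i), fun j => A μ η u₀ (ψ j)) := by
      rw [hα0]
      exact Prod.ext (funext fun i => ip_congr hsol.init_zeta fun _ _ => rfl)
        (funext fun j => A_congr μ η hsol.init_u fun _ _ => rfl)
    have pφ : ∀ i, PC1 (φ i) := fun i => (isFESpace_Sh M r k).pc1 _ (hφ.mem i)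
    have pψ : ∀ i, PC1 (ψ i) := fun i => (isFESpace_Sh0 M r k).pc1 _ (hψ.mem i)
    have heq := ode_unique (contDiff_galerkinField ε hη.pc1 pφ pψ) hα hβ (e0.trans hβ0.symm) t ht
    have := hβr t ht x hx
    rw [← heq] at this
    exact this
  · exact error_le hη hφ hψ (hsm.zeta_space.pc1 hr1 ht) (hsm.u_space.pc1 hr1 ht)
      (hsol.bdry_left t ht) hδ0 (hρ t ht).1 (hσ t ht) hc hexp.le (hαE t ht)

end Boussinesq

theorem theorem2p1
    (ε μ β T c₁ c₂ : ℝ) (hε : 0 < ε) (hμ : 0 < μ) (hβ : 0 < β) (hT : 0 < T)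
    (hc₁ : 0 < c₁) (hc₂ : 0 < c₂)
    (b : ℝ → ℝ) (hb : ContDiffOn ℝ 2 b (Set.Icc 0 1))
    (hpos₁ : ∀ x ∈ Set.Icc (0 : ℝ) 1, c₁ ≤ Boussinesq.etaB β b x)
    (hpos₂ : ∀ x ∈ Set.Icc (0 : ℝ) 1, c₂ ≤ Boussinesq.massCoeff μ (Boussinesq.etaB β b) x)
    (r k : ℕ) (hr : 2 ≤ r) (hk : k ≤ r - 2)
    (ζ₀ u₀ : ℝ → ℝ) (ζ u : ℝ → ℝ → ℝ)
    (hsmooth : Boussinesq.IsSmoothPair T r ζ u)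
    (hsol : Boussinesq.IsIBVPSolution ε μ T (Boussinesq.etaB β b) ζ₀ u₀ ζ u)
    (ν : ℝ) :
    ∃ h₀ > (0 : ℝ), ∃ C : ℝ, ∀ M : Boussinesq.Mesh, M.Quasiuniform ν → M.h ≤ h₀ →
      ∃ ζh uh : ℝ → ℝ → ℝ,
        Boussinesq.IsSemidiscreteSolution ε μ T (Boussinesq.etaB β b) ζ₀ u₀ M r k ζh uh ∧
        (∀ ζh' uh' : ℝ → ℝ → ℝ,
          Boussinesq.IsSemidiscreteSolution ε μ T (Boussinesq.etaB β b) ζ₀ u₀ M r k ζh' uh' →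
          ∀ t ∈ Set.Icc 0 T, ∀ x ∈ Set.Icc (0 : ℝ) 1, ζh' t x = ζh t x ∧ uh' t x = uh t x) ∧
        ∀ t ∈ Set.Icc 0 T,
          Boussinesq.l2norm (fun x => ζ t x - ζh t x)
            + Boussinesq.h1norm (fun x => u t x - uh t x) ≤ C * M.h ^ (r - 1) := by
  have hη : Boussinesq.IsBottom μ c₁ c₂ (Boussinesq.etaB β b) :=
    ⟨hμ, hc₁, hc₂, contDiffOn_const.sub (contDiffOn_const.mul hb), hpos₁, hpos₂⟩
  exact Boussinesq.galerkin_error_estimate hε hT hr hk hη hsmooth hsol ν
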